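/- **Setting.** For $|p|<1$ put $\theta_p(x)=\prod_{k\ge 0}(1-p^kx)(1-p^{k+1}/x)$, and for $|p|,|q|,|t|<1$ put $$\Gamma_{p,q,t}(x)=\prod_{i,j,k\ge 0}\bigl(1-p^{i+1}q^{j+1}t^{k+1}/x\bigr)\bigl(1-p^iq^jt^kx\bigr),\qquad \Gamma_{p,q,t}(x_1,\dots,x_n)=\prod_m\Gamma_{p,q,t}(x_m).$$ Let $\alpha,\beta,\gamma\ge 0$ be integers, $p,q,u_1,u_2,u_3\in\mathbb C$ with $|p|<1$, $q\ne 0$, $u_1u_2u_3=1$, and fix square roots $\sqrt q,\sqrt{u_1},\sqrt{u_2},\sqrt{u_3}$ (so $\sqrt{u_1}\sqrt{u_2}\sqrt{u_3}=\pm1$; half-integer powers of $q$ and $u_i$ are powers of these roots). Points of the triangular lattice are written as triples $(x,y,z)\in\mathbb Z^3$ modulo the diagonal. The $\alpha\times\beta\times\gamma$ hexagon is the image of the box $[0,\alpha]\times[0,\beta]\times[0,\gamma]$, and it is tiled by the lozenges that are the images of unit squares orthogonal to the $x$-, $y$- or $z$-axis (types $1,2,3$). A lozenge with center $(x,y,z)$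 has the label $$\tilde u_1=q^{y+z-2x}u_1,\qquad \tilde u_2=q^{x+z-2y}u_2,\qquad \tilde u_3=q^{x+y-2z}u_3$$ according to its type, and the weight $\tilde u_i^{-1/2}\theta_p(\tilde u_i)$, where $\tilde u_i^{1/2}=(\sqrt q)^{e}\sqrt{u_i}$ if $\tilde u_i=q^eu_i$. The partition function $Z$ is the sum, over all lozenge tilings of the hexagon, of the product of the weights of the lozenges of the tiling. Put $$L_0=q^{3\beta}\tfrac{u_1}{u_2},\quad L_1=q^{-3\gamma}\tfrac{u_3}{u_1},\quad L_2=q^{3\gamma}\tfrac{u_2}{u_3},\quad L_3=q^{-3\alpha}\tfrac{u_1}{u_2},\quad L_4=q^{3\alpha}\tfrac{u_3}{u_1},\quad L_5=q^{-3\beta}\tfrac{u_2}{u_3}$$ (on the six bounding edges $\tilde u_1/\tilde u_2$, $\tilde u_3/\tilde u_1$, $\tilde u_2/\tilde u_3$ take these values). For cube roots $t_i$ of $u_i$ with $t_1t_2t_3=1$ let $L_i^{1/3}$ be the cube root of $L_i$ obtained by replacing $u_j$ by $t_j$ and $q^{\pm 3n}$ by $q^{\pm n}$ in the definition of $L_i$;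 a cube root of a product or quotient of the $L_i$ is the product or quotient of these. **Proposition.** (1) Assume $|q|<1$ and that $\Gamma_{p,q,q}(q,q^{1+\alpha+\beta},q^{1+\alpha+\gamma},q^{1+\beta+\gamma})\neq0$ and $\Gamma_{p,q,q}(q^{1-\alpha+\beta}u_1,q^{1-\alpha+\gamma}u_1,q^{1-\beta+\alpha}u_2,q^{1-\beta+\gamma}u_2,q^{1-\gamma+\alpha}u_3,q^{1-\gamma+\beta}u_3)\ne0$. Then, with $$P=q^{\alpha\beta\gamma-\frac{\alpha\beta^2+\beta\alpha^2+\alpha\gamma^2+\gamma\alpha^2+\beta\gamma^2+\gamma\beta^2}{4}}\,u_1^{-\frac{\beta\gamma}2}u_2^{-\frac{\alpha\gamma}2}u_3^{-\frac{\alpha\beta}2},$$ the limits below exist and, for every choice of $t_1,t_2,t_3$, $$\begin{aligned}Z&=P\cdot\lim_{\rho\to1}\frac{\Gamma_{p,q,q}(q^{1+\alpha+\beta+\gamma}\rho,\,q^{1+\alpha}\rho,\,q^{1+\beta}\rho,\,q^{1+\gamma}\rho)}{\Gamma_{p,q,q}(q\rho,\,q^{1+\alpha+\beta}\rho,\,q^{1+\alpha+\gamma}\rho,\,q^{1+\beta+\gamma}\rho)}\\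 &\quad\times\frac{\Gamma_{p,q,q}(q^{1-\alpha+\beta+\gamma}u_1,q^{1-\alpha}u_1,q^{1-\beta+\alpha+\gamma}u_2,q^{1-\beta}u_2,q^{1-\gamma+\alpha+\beta}u_3,q^{1-\gamma}u_3)}{\Gamma_{p,q,q}(q^{1-\alpha+\beta}u_1,q^{1-\alpha+\gamma}u_1,q^{1-\beta+\alpha}u_2,q^{1-\beta+\gamma}u_2,q^{1-\gamma+\alpha}u_3,q^{1-\gamma+\beta}u_3)}\\ &=P\cdot\lim_{\rho\to1}\frac{\Gamma_{p,q,q}(q(L_0L_2L_4)^{1/3}\rho,\,q(L_0L_4L_5)^{1/3}\rho,\,q(L_0L_1L_2)^{1/3}\rho,\,q(L_2L_3L_4)^{1/3}\rho)}{\Gamma_{p,q,q}(q\rho,\,q(L_0/L_3)^{1/3}\rho,\,q(L_4/L_1)^{1/3}\rho,\,q(L_2/L_5)^{1/3}\rho)}\\ &\quad\times\frac{\Gamma_{p,q,q}(q(L_0L_2L_3)^{1/3},q(L_0L_3L_5)^{1/3},q(L_2L_4L_5)^{1/3},q(L_1L_2L_5)^{1/3},q(L_0L_1L_4)^{1/3},q(L_1L_3L_4)^{1/3})}{\Gamma_{p,q,q}(q(L_0/L_4)^{1/3},q(L_3/L_1)^{1/3},q(L_5/L_3)^{1/3},q(L_2/L_0)^{1/3},q(L_4/L_2)^{1/3},q(L_1/L_5)^{1/3})}.\end{aligned}$$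 (2) For every $q\neq 0$, $Z$ is invariant under $S_3$ permuting the triples $(\alpha,u_1,\sqrt{u_1})$, $(\beta,u_2,\sqrt{u_2})$, $(\gamma,u_3,\sqrt{u_3})$. (3) For every $q\ne0$, put $A=-2\alpha+\beta+\gamma$, $B=\alpha-2\beta+\gamma$, $C=\alpha+\beta-2\gamma$. $Z$ is invariant under the involution $$(u_1,u_2,u_3)\mapsto\Bigl(\frac1{q^Au_1},\frac1{q^Bu_2},\frac1{q^Cu_3}\Bigr)\qquad(\alpha,\beta,\gamma\text{ fixed}),$$ where the new square roots are $-1/(q^{A/2}\sqrt{u_1})$, $-1/(q^{B/2}\sqrt{u_2})$, $-1/(q^{C/2}\sqrt{u_3})$. If instead the new square roots are $1/(q^{A/2}\sqrt{u_1})$, $1/(q^{B/2}\sqrt{u_2})$, $1/(q^{C/2}\sqrt{u_3})$ (whose product is $1$ if $\sqrt{u_1}\sqrt{u_2}\sqrt{u_3}=1$), then $Z$ is multiplied by $(-1)^{\alpha\beta+\beta\gamma+\gamma\alpha}$. (4) For every $q\neq 0$, $Z$ is invariant under the group of transformations of the parameters $(\alpha,\beta,\gamma,\sqrt{u_1},\sqrt{u_2},\sqrt{u_3})$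 generated by the permutations in (2) and the first involution in (3), and this group is isomorphic to $S_3\times\mathbb Z_2$, to the dihedral group $\mathrm{Dih}_6$ of order $12$ (the symmetry group of a regular hexagon) and to the Coxeter group $W(G_2)$. -/

import Mathlib

open Filter Topology

namespace EllipticHexagon

noncomputable section

/-! ### Special functions -/

/-- The theta function `θ_p(x) = ∏_{k ≥ 0} (1 - p^k x) (1 - p^(k+1) / x)`. -/
def theta (p x : ℂ) : ℂ :=
  ∏' k : ℕ, (1 - p ^ k * x) * (1 - p ^ (k + 1) / x)

/-- The triple elliptic gamma function
`Γ_{p,q,t}(x) = ∏_{i,j,k ≥ 0} (1 - p^(i+1) q^(j+1) t^(k+1) / x) (1 - p^i q^j t^k x)`. -/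
def tripleGamma (p q t x : ℂ) : ℂ :=
  ∏' n : ℕ × ℕ × ℕ,
    (1 - p ^ (n.1 + 1) * q ^ (n.2.1 + 1) * t ^ (n.2.2 + 1) / x) *
      (1 - p ^ n.1 * q ^ n.2.1 * t ^ n.2.2 * x)

/-- `Γ_{p,q,q}(x₁, …, xₙ)`: several arguments mean the product of the values. -/
def tripleGammas (p q : ℂ) (l : List ℂ) : ℂ :=
  (l.map (tripleGamma p q q)).prod

/-! ### The triangular lattice, lozenges and tilings

A point `(x, y, z) ∈ ℤ³` modulo the diagonal is represented by `(x - z, y - z) ∈ ℤ × ℤ`. -/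

/-- The images of the three unit coordinate vectors of `ℤ³`. -/
def step : Fin 3 → ℤ × ℤ := ![(1, 0), (0, 1), (-1, -1)]

/-- The unit triangle with vertices `v`, `v + e_i`, `v + e_i + e_j` (for `i ≠ j`). -/
def triangle (v : ℤ × ℤ) (i j : Fin 3) : Finset (ℤ × ℤ) :=
  {v, v + step i, v + step i + step j}

/-- Unit triangles of the lattice, as sets of three vertices. -/
def IsUnitTriangle (t : Finset (ℤ × ℤ)) : Prop :=
  ∃ (v : ℤ × ℤ) (i j : Fin 3), i ≠ j ∧ t = triangle v i j

/-- The lozenge `(k, v)` is the unit rhombus with corner `v` spanned by the two unit coordinate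
vectors other than the `k`-th: it is the projection of a unit square orthogonal to the `k`-th
axis. -/
abbrev Lozenge : Type := Fin 3 × (ℤ × ℤ)

/-- The two unit triangles that make up a lozenge. -/
def lozengeTriangles (l : Lozenge) : Finset (Finset (ℤ × ℤ)) :=
  {triangle l.2 (l.1 + 1) (l.1 + 2), triangle l.2 (l.1 + 2) (l.1 + 1)}

/-- The lattice points of the `a₀ × a₁ × a₂` hexagon. -/
def hexagon (a : Fin 3 → ℕ) : Finset (ℤ × ℤ) :=
  (Finset.Icc (-(a 2 : ℤ)) (a 0) ×ˢ Finset.Icc (-(a 2 : ℤ)) (a 1)).filter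
    fun v => -(a 0 : ℤ) ≤ v.2 - v.1 ∧ v.2 - v.1 ≤ a 1

/-- The hexagon is the projection of the box `[0, a₀] × [0, a₁] × [0, a₂]`, with the origin as the
hidden corner. -/
theorem mem_hexagon_iff (a : Fin 3 → ℕ) (v : ℤ × ℤ) :
    v ∈ hexagon a ↔ ∃ x y z : ℤ, (0 ≤ x ∧ x ≤ a 0) ∧ (0 ≤ y ∧ y ≤ a 1) ∧ (0 ≤ z ∧ z ≤ a 2) ∧
      v = (x - z, y - z) := by
  obtain ⟨b, c⟩ := v
  simp only [hexagon, Finset.mem_filter, Finset.mem_product, Finset.mem_Icc, Prod.mk.injEq]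
  constructor
  · rintro ⟨⟨⟨h1, h2⟩, h3, h4⟩, h5, h6⟩
    refine ⟨b + max 0 (max (-b) (-c)), c + max 0 (max (-b) (-c)), max 0 (max (-b) (-c)), ?_⟩
    omega
  · rintro ⟨x, y, z, h⟩
    omega

/-- A set of lozenges tiles the hexagon: every lozenge lies in the hexagon and every unit triangle
of the hexagon lies in exactly one of the lozenges. -/
def IsTiling (a : Fin 3 → ℕ) (T : Finset Lozenge) : Prop :=
  (∀ l ∈ T, ∀ t ∈ lozengeTriangles l, t ⊆ hexagon a) ∧
    ∀ t, IsUnitTriangle t → t ⊆ hexagon a → ∃! l, l ∈ T ∧ t ∈ lozengeTriangles l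

open Classical in
/-- The finite set of all tilings of the `a₀ × a₁ × a₂` hexagon. -/
def tilings (a : Fin 3 → ℕ) : Finset (Finset Lozenge) :=
  (Finset.univ ×ˢ hexagon a : Finset Lozenge).powerset.filter (IsTiling a)

theorem mem_tilings_iff (a : Fin 3 → ℕ) (T : Finset Lozenge) :
    T ∈ tilings a ↔ IsTiling a T := by
  simp only [tilings, Finset.mem_filter, Finset.mem_powerset, and_iff_right_iff_imp]
  intro h l hl
  have h1 := h.1 l hl (triangle l.2 (l.1 + 1) (l.1 + 2)) (by simp [lozengeTriangles])
  simp only [Finset.mem_product, Finset.mem_univ, true_and]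
  exact h1 (by simp [triangle])

/-! ### The `S₃`-invariant weight -/

/-- A representative in `ℚ³` (modulo the diagonal) of the center of a lozenge. -/
def lozengeCenter (l : Lozenge) : Fin 3 → ℚ :=
  fun i => (![l.2.1, l.2.2, 0] i : ℤ) + if i = l.1 then 0 else 1 / 2

/-- The exponent of `q` in the label of a lozenge. -/
def labelExponent (l : Lozenge) : ℤ :=
  l.2.1 + l.2.2 + 1 - 3 * ![l.2.1, l.2.2, 0] l.1

/-- If `(x, y, z)` is the center of the lozenge, the exponent is `y + z - 2x`, `x + z - 2y` or
`x + y - 2z`, according to the type of the lozenge. -/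
theorem labelExponent_eq (l : Lozenge) :
    (labelExponent l : ℚ) =
      lozengeCenter l (l.1 + 1) + lozengeCenter l (l.1 + 2) - 2 * lozengeCenter l l.1 := by
  obtain ⟨k, b, c⟩ := l
  fin_cases k <;> simp [labelExponent, lozengeCenter] <;> ring

/-- The weight `ũ ^ (-1/2) * θ_p(ũ)` of a lozenge of type `k` with label `ũ = q ^ e * u_k`.
Here `s` and `w k` are the chosen square roots of `q` and `u_k`, and `ũ ^ (1/2) = s ^ e * w k`. -/
def lozengeWeight (p s : ℂ) (w : Fin 3 → ℂ) (l : Lozenge) : ℂ :=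
  (s ^ labelExponent l * w l.1)⁻¹ * theta p ((s ^ labelExponent l * w l.1) ^ 2)

/-- The partition function: the sum over all tilings of the product of the weights of the
lozenges. -/
def partitionFunction (p s : ℂ) (a : Fin 3 → ℕ) (w : Fin 3 → ℂ) : ℂ :=
  ∑ T ∈ tilings a, ∏ l ∈ T, lozengeWeight p s w l

/-! ### Parameters and their symmetries -/

/-- The side lengths of the hexagon and square roots of `u₁, u₂, u₃`, where `u₁ u₂ u₃ = 1`. -/
@[ext]
structure Params where
  side : Fin 3 → ℕ
  root : Fin 3 → ℂ
  balanced : ∏ i, root i ^ 2 = 1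

/-- The parameters `u₁, u₂, u₃`. -/
def Params.u (x : Params) (i : Fin 3) : ℂ := x.root i ^ 2

/-- The partition function at `x`. -/
def Params.Z (p s : ℂ) (x : Params) : ℂ := partitionFunction p s x.side x.root

theorem Params.root_ne_zero (x : Params) (i : Fin 3) : x.root i ≠ 0 := by
  intro h
  have h1 := x.balanced
  rw [Finset.prod_eq_zero (Finset.mem_univ i) (by simp [h])] at h1
  exact zero_ne_one h1

/-- `S₃` permutes the three axes, that is the pairs `(side i, u i)`. -/
def permute (σ : Equiv.Perm (Fin 3)) : Equiv.Perm Params where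
  toFun x := ⟨x.side ∘ σ, x.root ∘ σ, by
    rw [← x.balanced]; exact Equiv.prod_comp σ fun i => x.root i ^ 2⟩
  invFun x := ⟨x.side ∘ σ.symm, x.root ∘ σ.symm, by
    rw [← x.balanced]; exact Equiv.prod_comp σ.symm fun i => x.root i ^ 2⟩
  left_inv x := by ext i <;> simp
  right_inv x := by ext i <;> simp

/-- `A = -2α + β + γ`, `B = α - 2β + γ`, `C = α + β - 2γ`. -/
def reflectExponent (a : Fin 3 → ℕ) (i : Fin 3) : ℤ :=
  (∑ j, (a j : ℤ)) - 3 * a i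

theorem sum_reflectExponent (a : Fin 3 → ℕ) : ∑ i, reflectExponent a i = 0 := by
  simp only [reflectExponent, Fin.sum_univ_three]
  ring

theorem reflect_balanced {s : ℂ} (hs : s ≠ 0) (x : Params) :
    ∏ i, (-(s ^ reflectExponent x.side i * x.root i)⁻¹) ^ 2 = 1 := by
  have h : ∏ i, s ^ reflectExponent x.side i = 1 := by
    rw [Fin.prod_univ_three, ← zpow_add₀ hs, ← zpow_add₀ hs, ← Fin.sum_univ_three,
      sum_reflectExponent, zpow_zero]
  simp only [neg_sq, inv_pow, mul_pow, Finset.prod_inv_distrib, Finset.prod_mul_distrib,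
    x.balanced, Finset.prod_pow, h]
  simp

/-- The extra involution. It fixes the side lengths and sends `u_i` to `1 / (q ^ A_i u_i)`, see
`reflect_u`; the square root of `u_i` goes to `-1 / (q ^ (A_i / 2) u_i ^ (1 / 2))`. -/
def reflect (s : ℂ) (hs : s ≠ 0) : Equiv.Perm Params :=
  Function.Involutive.toPerm
    (fun x => ⟨x.side, fun i => -(s ^ reflectExponent x.side i * x.root i)⁻¹,
      reflect_balanced hs x⟩)
    (by
      intro x
      ext i
      · rfl
      · have h := zpow_ne_zero (reflectExponent x.side i) hs
        have h' := x.root_ne_zero i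
        simp only
        field_simp)

theorem reflect_u (s : ℂ) (hs : s ≠ 0) (x : Params) (i : Fin 3) :
    (reflect s hs x).u i = 1 / ((s ^ 2) ^ reflectExponent x.side i * x.u i) := by
  have h : (s ^ 2) ^ reflectExponent x.side i = (s ^ reflectExponent x.side i) ^ 2 := by
    rw [← zpow_natCast, ← zpow_natCast, ← zpow_mul, ← zpow_mul, mul_comm]
  change (-(s ^ reflectExponent x.side i * x.root i)⁻¹) ^ 2 = _
  simp only [Params.u, neg_sq, inv_pow, one_div, h, mul_pow]

/-- The group of transformations of the parameters generated by `S₃` and the extra involution. -/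
def symmetryGroup (s : ℂ) (hs : s ≠ 0) : Subgroup (Equiv.Perm Params) :=
  Subgroup.closure (Set.range permute ∪ {reflect s hs})

/-! ### The closed formula -/

/-- The prefactor `P = q ^ (αβγ - (αβ² + βα² + αγ² + γα² + βγ² + γβ²) / 4) *
u₁ ^ (-βγ/2) * u₂ ^ (-αγ/2) * u₃ ^ (-αβ/2)`, where `s = q ^ (1/2)` and `w i = u_i ^ (1/2)`.
The sum in parentheses is even, so that the exponent of `s` below is `2αβγ - (…) / 2` exactly. -/
def prefactor (s : ℂ) (w : Fin 3 → ℂ) (α β γ : ℕ) : ℂ :=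
  s ^ (2 * α * β * γ - (α * β ^ 2 + β * α ^ 2 + α * γ ^ 2 + γ * α ^ 2 + β * γ ^ 2 + γ * β ^ 2) / 2
      : ℤ) *
    w 0 ^ (-(β * γ) : ℤ) * w 1 ^ (-(α * γ) : ℤ) * w 2 ^ (-(α * β) : ℤ)

theorem two_dvd_prefactor_exponent (α β γ : ℤ) :
    2 ∣ α * β ^ 2 + β * α ^ 2 + α * γ ^ 2 + γ * α ^ 2 + β * γ ^ 2 + γ * β ^ 2 := by
  have h (m n : ℤ) : 2 ∣ m * n ^ 2 + n * m ^ 2 := by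
    rcases Int.even_or_odd' m with ⟨k, rfl | rfl⟩ <;> rcases Int.even_or_odd' n with ⟨l, rfl | rfl⟩
    · exact ⟨k * (2 * l) ^ 2 + 2 * l * (2 * k ^ 2), by ring⟩
    · exact ⟨k * (2 * l + 1) ^ 2 + (2 * l + 1) * (2 * k ^ 2), by ring⟩
    · exact ⟨(2 * k + 1) * (2 * l ^ 2) + l * (2 * k + 1) ^ 2, by ring⟩
    · exact ⟨(2 * k + 1) * (2 * l + 1) * (k + l + 1), by ring⟩
  have h3 := dvd_add (dvd_add (h α β) (h α γ)) (h β γ)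
  rwa [show α * β ^ 2 + β * α ^ 2 + α * γ ^ 2 + γ * α ^ 2 + β * γ ^ 2 + γ * β ^ 2 =
    α * β ^ 2 + β * α ^ 2 + (α * γ ^ 2 + γ * α ^ 2) + (β * γ ^ 2 + γ * β ^ 2) by ring]

/-- Numerator of the factor without `u₁, u₂, u₃`. -/
def constNum (p q ρ : ℂ) (α β γ : ℕ) : ℂ :=
  tripleGammas p q
    [q ^ (1 + α + β + γ) * ρ, q ^ (1 + α) * ρ, q ^ (1 + β) * ρ, q ^ (1 + γ) * ρ]

/-- Denominator of the factor without `u₁, u₂, u₃`. -/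
def constDen (p q ρ : ℂ) (α β γ : ℕ) : ℂ :=
  tripleGammas p q
    [q * ρ, q ^ (1 + α + β) * ρ, q ^ (1 + α + γ) * ρ, q ^ (1 + β + γ) * ρ]

/-- Numerator of the factor with `u₁, u₂, u₃`. -/
def paramNum (p q : ℂ) (α β γ : ℕ) (u : Fin 3 → ℂ) : ℂ :=
  tripleGammas p q
    [q ^ (1 - α + β + γ : ℤ) * u 0, q ^ (1 - α : ℤ) * u 0,
      q ^ (1 - β + α + γ : ℤ) * u 1, q ^ (1 - β : ℤ) * u 1,
      q ^ (1 - γ + α + β : ℤ) * u 2, q ^ (1 - γ : ℤ) * u 2]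

/-- Denominator of the factor with `u₁, u₂, u₃`. -/
def paramDen (p q : ℂ) (α β γ : ℕ) (u : Fin 3 → ℂ) : ℂ :=
  tripleGammas p q
    [q ^ (1 - α + β : ℤ) * u 0, q ^ (1 - α + γ : ℤ) * u 0,
      q ^ (1 - β + α : ℤ) * u 1, q ^ (1 - β + γ : ℤ) * u 1,
      q ^ (1 - γ + α : ℤ) * u 2, q ^ (1 - γ + β : ℤ) * u 2]

/-! ### The formula in edge coordinates -/

/-- The edge coordinates `L₀, …, L₅`. -/
def edge (q : ℂ) (α β γ : ℕ) (u : Fin 3 → ℂ) : Fin 6 → ℂ :=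
  ![q ^ (3 * β : ℤ) * u 0 / u 1, q ^ (-3 * γ : ℤ) * u 2 / u 0, q ^ (3 * γ : ℤ) * u 1 / u 2,
    q ^ (-3 * α : ℤ) * u 0 / u 1, q ^ (3 * α : ℤ) * u 2 / u 0, q ^ (-3 * β : ℤ) * u 1 / u 2]

/-- Cube roots of the edge coordinates, for chosen cube roots `t i` of `u i`. -/
def edgeRoot (q : ℂ) (α β γ : ℕ) (t : Fin 3 → ℂ) : Fin 6 → ℂ :=
  ![q ^ (β : ℤ) * t 0 / t 1, q ^ (-γ : ℤ) * t 2 / t 0, q ^ (γ : ℤ) * t 1 / t 2,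
    q ^ (-α : ℤ) * t 0 / t 1, q ^ (α : ℤ) * t 2 / t 0, q ^ (-β : ℤ) * t 1 / t 2]

theorem edgeRoot_pow (q : ℂ) (α β γ : ℕ) (t : Fin 3 → ℂ) (i : Fin 6) :
    edgeRoot q α β γ t i ^ 3 = edge q α β γ (fun j => t j ^ 3) i := by
  have h (n : ℤ) : (q ^ n) ^ 3 = q ^ (3 * n) := by
    rw [← zpow_natCast, ← zpow_mul, mul_comm]; rfl
  fin_cases i <;> simp [edgeRoot, edge, div_pow, mul_pow, ← h]

/-- Numerator of the factor without `u₁, u₂, u₃`, in terms of `l i = L_i ^ (1/3)`. -/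
def edgeConstNum (p q ρ : ℂ) (l : Fin 6 → ℂ) : ℂ :=
  tripleGammas p q
    [q * (l 0 * l 2 * l 4) * ρ, q * (l 0 * l 4 * l 5) * ρ,
      q * (l 0 * l 1 * l 2) * ρ, q * (l 2 * l 3 * l 4) * ρ]

/-- Denominator of the factor without `u₁, u₂, u₃`, in terms of `l i = L_i ^ (1/3)`. -/
def edgeConstDen (p q ρ : ℂ) (l : Fin 6 → ℂ) : ℂ :=
  tripleGammas p q [q * ρ, q * (l 0 / l 3) * ρ, q * (l 4 / l 1) * ρ, q * (l 2 / l 5) * ρ]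

/-- Numerator of the factor with `u₁, u₂, u₃`, in terms of `l i = L_i ^ (1/3)`. -/
def edgeParamNum (p q : ℂ) (l : Fin 6 → ℂ) : ℂ :=
  tripleGammas p q
    [q * (l 0 * l 2 * l 3), q * (l 0 * l 3 * l 5), q * (l 2 * l 4 * l 5),
      q * (l 1 * l 2 * l 5), q * (l 0 * l 1 * l 4), q * (l 1 * l 3 * l 4)]

/-- Denominator of the factor with `u₁, u₂, u₃`, in terms of `l i = L_i ^ (1/3)`. -/
def edgeParamDen (p q : ℂ) (l : Fin 6 → ℂ) : ℂ :=
  tripleGammas p q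
    [q * (l 0 / l 4), q * (l 3 / l 1), q * (l 5 / l 3),
      q * (l 2 / l 0), q * (l 4 / l 2), q * (l 1 / l 5)]

end

end EllipticHexagon

/-! The symmetries hold tiling by tiling. A permutation of the axes preserves label exponents, and
the central reflection of the hexagon turns the exponent `e` of a lozenge of type `k` into `A_k -
e`, so with the transformed parameters every label is inverted. The weight, written as `oddTheta` at
the square root of the label, changes sign under inversion and under a change of sign of the root.
As every tiling has `αβ + βγ + γα` lozenges, these signs give the common factor in (3), and they
cancel for the first involution. The two kinds of transformations commute, and the resulting action
of `S₃ × ℤ/2` is faithful.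

For the product formula, tilings become families of nonintersecting lattice paths that cross the
edges parallel to the first axis; an edge that no path crosses is the short diagonal of a lozenge of
type `0`. With the product of all possible type `0` weights factored out, `Z` is a determinant of
one-path sums (`partitionFunction_eq_det`). In place of a sign-reversing involution, the last
lozenges of the paths are removed one path at a time, and the determinant is expanded linearly in
the corresponding row. The forbidden moves contribute determinants with two equal rows or a zero
row.

The determinant is evaluated by Dodgson condensation (`det_condensation`), whose minors are path
determinants of the same family, starting from the closed form for a single path
(`pathSum_eq_closedDet`). The two three-term relations involved, `condensation_identity` and
`path_identity`, are cases of the Weierstrass addition formula `oddTheta_addition`. That formula is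
a Plücker relation once `oddTheta p (x * y) * oddTheta p (x / y)` has the form `F x * G y - G x * F
y`. This form follows from the Jacobi triple product by sorting a double series by parity.

The candidate value `closedDet` is written with potentials, that is, iterated multiplicative
antidifferences of the theta factors. Products over boxes then telescope, and the remaining checks
are identities between monomials. Division by theta values requires generic parameters. The final
identity has no denominators, so it extends to all parameters by continuity along a curve with only
countably many nongeneric points (`partitionFunction_mul_box`). Finally, `tripleGamma_box` turns
products of theta functions over boxes into quotients of triple gamma functions. -/

namespace EllipticHexagon

/-! ### Infinite products of linear factors -/

/-- The product `∏ (1 - c i * x)`, an entire function of `x` if `c` is absolutely summable. -/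
noncomputable def linProd {ι : Type*} (c : ι → ℂ) (x : ℂ) : ℂ := ∏' i, (1 - c i * x)

section linProd

variable {ι κ : Type*} {c : ι → ℂ}

theorem multipliable_linProd (hc : Summable fun i => ‖c i‖) (x : ℂ) :
    Multipliable fun i => 1 - c i * x := by
  have : Summable fun i => ‖-(c i * x)‖ := by
    simpa only [norm_neg, norm_mul] using hc.mul_right ‖x‖
  simpa only [← sub_eq_add_neg] using multipliable_one_add_of_summable this

theorem linProd_ne_zero (hc : Summable fun i => ‖c i‖) {x : ℂ} (hx : ∀ i, 1 - c i * x ≠ 0) :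
    linProd c x ≠ 0 := by
  have : Summable fun i => ‖-(c i * x)‖ := by
    simpa only [norm_neg, norm_mul] using hc.mul_right ‖x‖
  have h := tprod_one_add_ne_zero_of_summable (f := fun i => -(c i * x))
    (by simpa only [← sub_eq_add_neg] using hx) this
  simpa only [linProd, sub_eq_add_neg] using h

/-- On the unit ball around `x` the terms are bounded by `‖c i‖ * (‖x‖ + 1)`, so the Weierstrass
test gives uniform convergence of the partial products. -/
theorem continuous_linProd (hc : Summable fun i => ‖c i‖) : Continuous (linProd c) := by
  rw [continuous_iff_continuousAt]
  intro x
  have h := Summable.hasProdUniformlyOn_one_add (f := fun i (y : ℂ) => -(c i * y))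
    (isCompact_closedBall x 1) (hc.mul_right (‖x‖ + 1))
    (Eventually.of_forall fun i y hy => by
      rw [norm_neg, norm_mul]
      gcongr
      have := norm_le_norm_add_norm_sub' y x
      rw [Metric.mem_closedBall, dist_eq_norm] at hy
      linarith)
    (fun i => by fun_prop)
  rw [hasProdUniformlyOn_iff_tendstoUniformlyOn] at h
  have h2 := h.continuousOn (Frequently.of_forall fun s => by fun_prop)
  have h3 := h2.continuousAt (Metric.closedBall_mem_nhds x one_pos)
  simp only [← sub_eq_add_neg] at h3
  exact h3

/-- The second part of the index set reproduces `c` up to the factor `q`, hence the same product at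
`q * x`. The difference equations for `poch`, `doublePoch` and `triplePoch` are instances. -/
theorem linProd_eq_mul (hc : Summable fun i => ‖c i‖) (e : κ ⊕ ι ≃ ι) (q : ℂ)
    (hq : ∀ i, c (e (.inr i)) = q * c i) (x : ℂ) :
    linProd c x = linProd (fun k => c (e (.inl k))) x * linProd c (q * x) := by
  have h1 : Multipliable fun k : κ => 1 - c (e (.inl k)) * x :=
    multipliable_linProd (hc.comp_injective (e.injective.comp Sum.inl_injective)) x
  have h2 : Multipliable fun i : ι => 1 - c (e (.inr i)) * x := by
    have := multipliable_linProd hc (q * x)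
    simpa only [hq, mul_assoc, mul_left_comm q] using this
  calc linProd c x = ∏' i, (1 - c (e i) * x) := (e.tprod_eq fun i => 1 - c i * x).symm
    _ = _ := Multipliable.tprod_sum h1 h2
    _ = _ := by simp only [hq, linProd, mul_assoc, mul_left_comm q]

/-- The natural numbers as zero and the successors. -/
def unitSumNatEquiv : Unit ⊕ ℕ ≃ ℕ where
  toFun := Sum.elim (fun _ => 0) Nat.succ
  invFun n := n.casesOn (.inl ()) .inr
  left_inv := by rintro (⟨⟩ | n) <;> rfl
  right_inv := by rintro (_ | n) <;> rfl

end linProd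

/-! ### The theta function -/

/-- The product `∏_{k ≥ 0} (1 - p ^ k * x)`. -/
noncomputable def poch (p x : ℂ) : ℂ := linProd (fun k : ℕ => p ^ k) x

section theta

variable {p : ℂ}

theorem summable_norm_pow (hp : ‖p‖ < 1) : Summable fun k : ℕ => ‖p ^ k‖ := by
  simpa only [norm_pow] using summable_geometric_of_lt_one (norm_nonneg p) hp

theorem continuous_poch (hp : ‖p‖ < 1) : Continuous (poch p) :=
  continuous_linProd (summable_norm_pow hp)

theorem poch_eq_mul (hp : ‖p‖ < 1) (x : ℂ) : poch p x = (1 - x) * poch p (p * x) := by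
  have h := linProd_eq_mul (summable_norm_pow hp) unitSumNatEquiv p (fun i => pow_succ' p i) x
  simpa [linProd, poch, unitSumNatEquiv] using h

theorem theta_eq_poch (hp : ‖p‖ < 1) (x : ℂ) : theta p x = poch p x * poch p (p / x) := by
  rw [theta, Multipliable.tprod_mul (multipliable_linProd (summable_norm_pow hp) x)]
  · simp only [poch, linProd, pow_succ, mul_div_assoc]
  · simpa only [pow_succ, mul_div_assoc] using
      multipliable_linProd (summable_norm_pow hp) (p / x)

/-- With the first factor of one Pochhammer product on each side split off, only `1 - x⁻¹ = -x⁻¹ *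
(1 - x)` has to be compared. -/
theorem theta_inv (hp : ‖p‖ < 1) {x : ℂ} (hx : x ≠ 0) : theta p x⁻¹ = -x⁻¹ * theta p x := by
  rw [theta_eq_poch hp, theta_eq_poch hp, poch_eq_mul hp x, poch_eq_mul hp x⁻¹, div_inv_eq_mul,
    ← div_eq_mul_inv]
  field_simp
  ring

theorem continuousOn_theta (hp : ‖p‖ < 1) : ContinuousOn (theta p) {0}ᶜ := by
  have h : theta p = fun x => poch p x * poch p (p / x) := funext (theta_eq_poch hp)
  rw [h]
  refine (continuous_poch hp).continuousOn.mul ((continuous_poch hp).comp_continuousOn ?_)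
  exact continuousOn_const.div continuousOn_id fun x hx => hx

/-- Zeros come from linear factors, hence lie in two sequences of powers of `p`. Countability is
what the density argument for generic parameters uses. -/
theorem countable_theta_eq_zero (hp : ‖p‖ < 1) : {x : ℂ | theta p x = 0}.Countable := by
  refine ((Set.countable_range fun k : ℕ => (p ^ k)⁻¹).union
    (Set.countable_range fun k : ℕ => p ^ (k + 1))).mono fun x hx => ?_
  by_contra h
  simp only [Set.mem_union, Set.mem_range, not_or, not_exists] at h
  rw [Set.mem_ofPred_eq, theta_eq_poch hp] at hx
  rcases mul_eq_zero.1 hx with h1 | h1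
  · refine linProd_ne_zero (summable_norm_pow hp) (fun k hk => h.1 k ?_) h1
    exact (eq_inv_of_mul_eq_one_right (sub_eq_zero.1 hk).symm).symm
  · refine linProd_ne_zero (summable_norm_pow hp) (fun k hk => h.2 k ?_) h1
    have hx0 : x ≠ 0 := by rintro rfl; simp at hk
    rw [pow_succ]
    field_simp at hk
    linear_combination -hk

end theta

end EllipticHexagon

namespace EllipticHexagon

/-! ### The Jacobi triple product -/

section triple

variable {p : ℂ}

theorem triangular_succ (n : ℤ) : (n + 1) * (n + 1 - 1) / 2 = n * (n - 1) / 2 + n := by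
  rw [show (n + 1) * (n + 1 - 1) = n * (n - 1) + n * 2 by ring,
    Int.add_mul_ediv_right _ _ two_ne_zero]

/-- The term `p ^ (n (n - 1) / 2) x ^ n` of the theta series. -/
noncomputable def thetaTerm (p x : ℂ) (n : ℤ) : ℂ := p ^ (n * (n - 1) / 2) * x ^ n

/-- The two-sided theta series `∑ p ^ (n (n - 1) / 2) x ^ n`. -/
noncomputable def thetaSeries (p x : ℂ) : ℂ := ∑' n : ℤ, thetaTerm p x n

/-- The ratio test in both directions: consecutive quotients are `p ^ n * x` and `p ^ (n + 1) / x`,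
which tend to zero. -/
theorem summable_thetaSeries (hp : ‖p‖ < 1) (hp0 : p ≠ 0) {x : ℂ} (hx : x ≠ 0) :
    Summable (thetaTerm p x) := by
  have hlim : ∀ c : ℂ, Tendsto (fun n : ℕ => ‖p ^ n * c‖) atTop (𝓝 0) := fun c => by
    simpa using ((tendsto_pow_atTop_nhds_zero_of_norm_lt_one hp).mul_const c).norm
  refine Summable.of_nat_of_neg ?_ ?_
  · refine summable_of_ratio_test_tendsto_lt_one one_pos (Eventually.of_forall fun n =>
      mul_ne_zero (zpow_ne_zero _ hp0) (zpow_ne_zero _ hx)) ((hlim x).congr fun n => ?_)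
    rw [← norm_div, thetaTerm, thetaTerm]
    congr 1
    push_cast
    rw [triangular_succ, zpow_add₀ hp0, zpow_add₀ hx, zpow_natCast, zpow_one]
    field_simp [zpow_ne_zero (n * (n - 1) / 2 : ℤ) hp0, zpow_ne_zero (n : ℤ) hx]
  · refine summable_of_ratio_test_tendsto_lt_one one_pos (Eventually.of_forall fun n =>
      mul_ne_zero (zpow_ne_zero _ hp0) (zpow_ne_zero _ hx)) ((hlim (p * x⁻¹)).congr fun n => ?_)
    rw [← norm_div, thetaTerm, thetaTerm]
    congr 1
    have h := triangular_succ (-((n : ℤ) + 1))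
    rw [show -((n : ℤ) + 1) + 1 = -n by ring] at h
    push_cast
    rw [h, zpow_add₀ hp0, show -(n : ℤ) = -(n + 1) + 1 by ring, zpow_add₀ hx, zpow_one,
      zpow_neg p, zpow_add₀ hp0, zpow_natCast, zpow_one]
    field_simp [zpow_ne_zero (-(n + 1 : ℤ)) hx,
      zpow_ne_zero ((-(n + 1) * (-(n + 1) - 1) / 2 : ℤ)) hp0]

/-- The finite product `(p; p)_m`. -/
noncomputable def pochFin (p : ℂ) (m : ℕ) : ℂ := ∏ k ∈ Finset.range m, (1 - p ^ (k + 1))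

theorem one_sub_pow_ne_zero (hp : ‖p‖ < 1) (k : ℕ) : 1 - p ^ (k + 1) ≠ 0 := by
  intro h
  have h1 : ‖p ^ (k + 1)‖ = 1 := by rw [← sub_eq_zero.1 h, norm_one]
  rw [norm_pow] at h1
  exact (pow_lt_one₀ (norm_nonneg p) hp k.succ_ne_zero).ne h1

theorem pochFin_ne_zero (hp : ‖p‖ < 1) (m : ℕ) : pochFin p m ≠ 0 :=
  Finset.prod_ne_zero_iff.2 fun k _ => one_sub_pow_ne_zero hp k

theorem poch_self_ne_zero (hp : ‖p‖ < 1) : poch p p ≠ 0 :=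
  linProd_ne_zero (summable_norm_pow hp) fun k => by
    simpa only [pow_succ] using one_sub_pow_ne_zero hp k

theorem tendsto_pochFin (hp : ‖p‖ < 1) : Tendsto (pochFin p) atTop (𝓝 (poch p p)) := by
  have h := (multipliable_linProd (summable_norm_pow hp) p).hasProd.tendsto_prod_nat
  simp only [← pow_succ] at h
  simpa only [poch, linProd, ← pow_succ, pochFin] using! h

/-- `1 / (p; p)_m`, extended by zero to negative `m`. -/
noncomputable def recipPoch (p : ℂ) (m : ℤ) : ℂ := if 0 ≤ m then (pochFin p m.toNat)⁻¹ else 0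

/-- The extension by zero makes the recursion valid for every integer: at `m = 0` the factor `1 - p
^ 0` vanishes. Hence no boundary cases arise for the Laurent coefficients. -/
theorem recipPoch_sub_one (hp : ‖p‖ < 1) (m : ℤ) :
    recipPoch p (m - 1) = (1 - p ^ m) * recipPoch p m := by
  rcases lt_trichotomy m 0 with h | rfl | h
  · rw [recipPoch, recipPoch, if_neg (by omega), if_neg (by omega), mul_zero]
  · simp [recipPoch]
  · obtain ⟨k, rfl⟩ : ∃ k : ℕ, m = k + 1 := ⟨(m - 1).toNat, by omega⟩
    have h1 := pochFin_ne_zero hp k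
    have h2 := one_sub_pow_ne_zero hp k
    rw [recipPoch, recipPoch, if_pos (by omega), if_pos (by omega), add_sub_cancel_right,
      show ((k : ℤ) + 1).toNat = k + 1 by omega, Int.toNat_natCast,
      show pochFin p (k + 1) = pochFin p k * (1 - p ^ (k + 1)) from Finset.prod_range_succ _ _,
      show p ^ ((k : ℤ) + 1) = p ^ (k + 1) by exact_mod_cast zpow_natCast p (k + 1)]
    field_simp

theorem tendsto_recipPoch (hp : ‖p‖ < 1) :
    Tendsto (recipPoch p) atTop (𝓝 (poch p p)⁻¹) := by
  have h : Tendsto (fun m : ℤ => (pochFin p m.toNat)⁻¹) atTop (𝓝 (poch p p)⁻¹) := by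
    refine ((tendsto_pochFin hp).inv₀ (poch_self_ne_zero hp)).comp ?_
    exact tendsto_atTop_atTop.2 fun b => ⟨b, fun a ha => by omega⟩
  refine h.congr' ?_
  filter_upwards [eventually_ge_atTop 0] with m hm
  rw [recipPoch, if_pos hm]

/-- The Laurent coefficients of `∏_{k < N} (1 - p ^ k x) (1 - p ^ (k + 1) / x)`. -/
noncomputable def tripleCoeff (p : ℂ) (N : ℕ) (n : ℤ) : ℂ :=
  pochFin p (2 * N) * recipPoch p (N + n) * recipPoch p (N - n) *
    ((-1) ^ n * p ^ (n * (n - 1) / 2))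

/-- This is coefficient comparison for multiplication by `(1 - p ^ N x) (1 - p ^ (N + 1) / x) = 1 +
p ^ (2N + 1) - p ^ N x - p ^ (N + 1) / x`. -/
theorem tripleCoeff_succ (hp : ‖p‖ < 1) (hp0 : p ≠ 0) (N : ℕ) (n : ℤ) :
    tripleCoeff p (N + 1) n = tripleCoeff p N n * (1 + p ^ (2 * N + 1)) -
      tripleCoeff p N (n - 1) * p ^ N - tripleCoeff p N (n + 1) * p ^ (N + 1) := by
  have e1 := recipPoch_sub_one hp (N + 1 + n)
  have e2 := recipPoch_sub_one hp (N + 1 - n)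
  have e3 := recipPoch_sub_one hp (N + n)
  have e4 := recipPoch_sub_one hp (N - n)
  rw [show (N : ℤ) + 1 + n - 1 = N + n by ring] at e1
  rw [show (N : ℤ) + 1 - n - 1 = N - n by ring] at e2
  have t1 := triangular_succ n
  have t2 := triangular_succ (n - 1)
  rw [sub_add_cancel] at t2
  have hP : pochFin p (2 * (N + 1)) =
      pochFin p (2 * N) * (1 - p ^ (2 * N + 1)) * (1 - p ^ (2 * N + 2)) := by
    rw [show 2 * (N + 1) = 2 * N + 1 + 1 by ring]
    simp only [pochFin, Finset.prod_range_succ]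
  simp only [tripleCoeff]
  generalize n * (n - 1) / 2 = u at *
  generalize (n + 1) * (n + 1 - 1) / 2 = v at *
  generalize (n - 1) * (n - 1 - 1) / 2 = w at *
  subst t1 t2
  push_cast
  rw [show (N : ℤ) + (n - 1) = N + n - 1 by ring, show (N : ℤ) - (n - 1) = N + 1 - n by ring,
    show (N : ℤ) + (n + 1) = N + 1 + n by ring, show (N : ℤ) - (n + 1) = N - n - 1 by ring,
    e3, e4, e1, e2, hP, zpow_add₀ (by norm_num : (-1 : ℂ) ≠ 0),
    zpow_sub₀ (by norm_num : (-1 : ℂ) ≠ 0)]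
  simp only [zpow_add₀ hp0, zpow_sub₀ hp0, zpow_natCast, zpow_one]
  have := zpow_ne_zero n hp0
  field_simp
  ring

theorem hasSum_tripleCoeff (hp : ‖p‖ < 1) (hp0 : p ≠ 0) {x : ℂ} (hx : x ≠ 0) (N : ℕ) :
    HasSum (fun n : ℤ => tripleCoeff p N n * x ^ n)
      (∏ k ∈ Finset.range N, ((1 - p ^ k * x) * (1 - p ^ (k + 1) / x))) := by
  induction N with
  | zero =>
    have h : ∀ n : ℤ, n ≠ 0 → tripleCoeff p 0 n * x ^ n = 0 := by
      intro n hn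
      have : recipPoch p n = 0 ∨ recipPoch p (-n) = 0 := by
        rcases lt_or_gt_of_ne hn with h | h
        · exact .inl (if_neg (by omega))
        · exact .inr (if_neg (by omega))
      rcases this with h | h <;> simp [tripleCoeff, h]
    simpa [tripleCoeff, recipPoch, pochFin] using hasSum_single 0 h
  | succ N ih =>
    have h1 := ((Equiv.subRight (1 : ℤ)).hasSum_iff.2 ih).mul_right (x * p ^ N)
    have h2 := ((Equiv.addRight (1 : ℤ)).hasSum_iff.2 ih).mul_right (x⁻¹ * p ^ (N + 1))
    have h := ((ih.mul_right (1 + p ^ (2 * N + 1))).sub h1).sub h2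
    have e : ∏ k ∈ Finset.range (N + 1), ((1 - p ^ k * x) * (1 - p ^ (k + 1) / x)) = _ :=
      Finset.prod_range_succ _ _
    generalize ∏ k ∈ Finset.range N, ((1 - p ^ k * x) * (1 - p ^ (k + 1) / x)) = z at *
    rw [e, show z * ((1 - p ^ N * x) * (1 - p ^ (N + 1) / x)) = z * (1 + p ^ (2 * N + 1)) -
      z * (x * p ^ N) - z * (x⁻¹ * p ^ (N + 1)) by field_simp; ring]
    convert! h using 2 with n
    simp only [Function.comp, Equiv.subRight_apply, Equiv.coe_addRight]
    rw [tripleCoeff_succ hp hp0, zpow_add₀ hx, zpow_sub₀ hx, zpow_one]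
    field_simp

/-- The Jacobi triple product, as the limit `N → ∞` of its finite form. The Pochhammer factors of
the coefficients are bounded uniformly in `N` and `n`, so dominated convergence applies with a
multiple of the theta series as bound. -/
theorem theta_eq_thetaSeries (hp : ‖p‖ < 1) (hp0 : p ≠ 0) {x : ℂ} (hx : x ≠ 0) :
    theta p x = (poch p p)⁻¹ * thetaSeries p (-x) := by
  have hm : Multipliable fun k : ℕ => (1 - p ^ k * x) * (1 - p ^ (k + 1) / x) := by
    refine (multipliable_linProd (summable_norm_pow hp) x).mul ?_
    simpa only [pow_succ, mul_div_assoc] using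
      multipliable_linProd (summable_norm_pow hp) (p / x)
  obtain ⟨C, hC⟩ : ∃ C, ∀ m, ‖pochFin p m‖ ≤ C := by
    obtain ⟨C, hC⟩ := (Metric.isBounded_range_of_tendsto _ (tendsto_pochFin hp)).exists_norm_le
    exact ⟨C, fun m => hC _ ⟨m, rfl⟩⟩
  obtain ⟨D, hD⟩ : ∃ D, ∀ m, ‖recipPoch p m‖ ≤ D := by
    have h : Tendsto (fun m : ℕ => recipPoch p m) atTop (𝓝 (poch p p)⁻¹) :=
      (tendsto_recipPoch hp).comp tendsto_natCast_atTop_atTop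
    obtain ⟨D, hD⟩ := (Metric.isBounded_range_of_tendsto _ h).exists_norm_le
    refine ⟨D, fun m => ?_⟩
    rcases le_or_gt 0 m with h0 | h0
    · lift m to ℕ using h0
      exact hD _ ⟨m, rfl⟩
    · rw [recipPoch, if_neg (by omega), norm_zero]
      exact (norm_nonneg _).trans (hD _ ⟨0, rfl⟩)
  have hC0 : 0 ≤ C := (norm_nonneg _).trans (hC 0)
  have hD0 : 0 ≤ D := (norm_nonneg _).trans (hD 0)
  have hT (N : ℕ) (n : ℤ) : tripleCoeff p N n * x ^ n =
      pochFin p (2 * N) * recipPoch p (N + n) * recipPoch p (N - n) *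
        thetaTerm p (-x) n := by
    rw [thetaTerm, ← neg_one_mul x, mul_zpow, tripleCoeff]
    ring
  have key := tendsto_tsum_of_dominated_convergence (𝓕 := atTop)
    (f := fun (N : ℕ) (n : ℤ) => tripleCoeff p N n * x ^ n)
    (g := fun n => (poch p p)⁻¹ * thetaTerm p (-x) n)
    (bound := fun n => C * D * D * ‖thetaTerm p (-x) n‖)
    ((summable_thetaSeries hp hp0 (neg_ne_zero.2 hx)).norm.mul_left _)
    (fun n => by
      -- The limit is rewritten to match the three factors of the coefficient, which tend to `poch p
      -- p` once and to its inverse twice.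
      have e : (poch p p)⁻¹ * thetaTerm p (-x) n =
          poch p p * (poch p p)⁻¹ * (poch p p)⁻¹ * thetaTerm p (-x) n := by
        rw [mul_inv_cancel₀ (poch_self_ne_zero hp), one_mul]
      rw [e]
      have hN : ∀ c : ℤ, Tendsto (fun N : ℕ => (N : ℤ) + c) atTop atTop := fun c =>
        tendsto_atTop_add_const_right _ c tendsto_natCast_atTop_atTop
      simp only [hT]
      exact ((((tendsto_pochFin hp).comp (tendsto_id.const_mul_atTop' two_pos)).mul
        ((tendsto_recipPoch hp).comp (hN n))).mul
        ((tendsto_recipPoch hp).comp (hN (-n)))).mul_const _)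
    (Eventually.of_forall fun N n => by
      rw [hT, norm_mul, norm_mul, norm_mul]
      have := hC (2 * N)
      have := hD (N + n)
      have := hD (N - n)
      gcongr)
  have h2 := hm.hasProd.tendsto_prod_nat
  have h3 : (fun N : ℕ => ∑' n : ℤ, tripleCoeff p N n * x ^ n) = fun N =>
      ∏ k ∈ Finset.range N, ((1 - p ^ k * x) * (1 - p ^ (k + 1) / x)) :=
    funext fun N => (hasSum_tripleCoeff hp hp0 hx N).tsum_eq
  rw [h3] at key
  rw [theta, tendsto_nhds_unique h2 key, tsum_mul_left, thetaSeries]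

/-! ### The addition formula -/

theorem thetaSeries_mul (hp0 : p ≠ 0) {x : ℂ} (hx : x ≠ 0) :
    thetaSeries p (p * x) = x⁻¹ * thetaSeries p x := by
  rw [thetaSeries, thetaSeries, ← tsum_mul_left, ← (Equiv.addRight (1 : ℤ)).tsum_eq
    fun n => x⁻¹ * thetaTerm p x n]
  refine tsum_congr fun n => ?_
  rw [Equiv.coe_addRight, thetaTerm, thetaTerm, triangular_succ, zpow_add₀ hp0, zpow_add₀ hx, mul_zpow, zpow_one]
  field_simp

/-- Pairs of integers, sorted by the parity of their sum. -/
noncomputable def parityEquiv : (ℤ × ℤ) ⊕ (ℤ × ℤ) ≃ ℤ × ℤ :=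
  Equiv.ofBijective
    (Sum.elim (fun a => (a.1 + a.2, a.1 - a.2)) fun a => (a.1 + a.2 + 1, a.1 - a.2)) <| by
    constructor
    · rintro (⟨k, l⟩ | ⟨k, l⟩) (⟨m, n⟩ | ⟨m, n⟩) h <;>
      · simp only [Sum.elim_inl, Sum.elim_inr, Prod.mk.injEq, Sum.inl.injEq, Sum.inr.injEq,
          reduceCtorEq] at h ⊢
        omega
    · rintro ⟨m, n⟩
      by_cases h : (m + n) % 2 = 0
      · exact ⟨.inl ((m + n) / 2, (m - n) / 2), by
          simp only [Sum.elim_inl, Prod.mk.injEq]; omega⟩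
      · exact ⟨.inr ((m + n) / 2, (m - n) / 2), by
          simp only [Sum.elim_inr, Prod.mk.injEq]; omega⟩

theorem parityEquiv_inl (k l : ℤ) : parityEquiv (.inl (k, l)) = (k + l, k - l) := rfl

theorem parityEquiv_inr (k l : ℤ) : parityEquiv (.inr (k, l)) = (k + l + 1, k - l) := rfl

theorem exists_triangular (n : ℤ) : ∃ t, n * (n - 1) = 2 * t ∧ n * (n - 1) / 2 = t := by
  obtain ⟨t, ht⟩ := Int.even_mul_pred_self n
  exact ⟨t, by omega, by omega⟩

theorem neg_mul_zpow_mul_neg_div_zpow {x y : ℂ} (hx : x ≠ 0) (hy : y ≠ 0) (k l : ℤ) :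
    (-(x * y)) ^ (k + l) * (-(x / y)) ^ (k - l) = (x ^ 2) ^ k * (y ^ 2) ^ l := by
  have h1 : (-(x * y)) * (-(x / y)) = x ^ 2 := by field_simp
  have h2 : (-(x * y)) / (-(x / y)) = y ^ 2 := by field_simp
  rw [← h1, ← h2, zpow_add₀ (neg_ne_zero.2 (mul_ne_zero hx hy)),
    zpow_sub₀ (neg_ne_zero.2 (div_ne_zero hx hy)), mul_zpow, div_zpow]
  ring

/-- The substitution `m = k + l`, `n = k - l` diagonalizes the quadratic exponent: the two
triangular numbers add up to `k (k - 1) + l (l - 1) + l`, so `k` and `l` separate with nome `p ^ 2`.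
-/
theorem thetaSeries_term_even (hp0 : p ≠ 0) {x y : ℂ} (hx : x ≠ 0) (hy : y ≠ 0) (k l : ℤ) :
    thetaTerm p (-(x * y)) (k + l) * thetaTerm p (-(x / y)) (k - l) =
      thetaTerm (p ^ 2) (x ^ 2) k * thetaTerm (p ^ 2) (p * y ^ 2) l := by
  simp only [thetaTerm]
  obtain ⟨a, ha, ha'⟩ := exists_triangular (k + l)
  obtain ⟨b, hb, hb'⟩ := exists_triangular (k - l)
  obtain ⟨c, hc, hc'⟩ := exists_triangular k
  obtain ⟨d, hd, hd'⟩ := exists_triangular l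
  have hab : a + b = 2 * c + 2 * d + l := by
    refine mul_left_cancel₀ (two_ne_zero' ℤ) ?_
    linear_combination -ha - hb + 2 * hc + 2 * hd
  have h1 := congrArg (fun n => p ^ n) hab
  simp only [zpow_add₀ hp0, zpow_mul, zpow_ofNat] at h1
  rw [ha', hb', hc', hd', mul_zpow p]
  have h2 := neg_mul_zpow_mul_neg_div_zpow hx hy k l
  generalize (-(x * y)) ^ (k + l) = A at *
  generalize (-(x / y)) ^ (k - l) = B at *
  linear_combination p ^ a * p ^ b * h2 + (x ^ 2) ^ k * (y ^ 2) ^ l * h1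

theorem thetaSeries_term_odd (hp0 : p ≠ 0) {x y : ℂ} (hx : x ≠ 0) (hy : y ≠ 0) (k l : ℤ) :
    thetaTerm p (-(x * y)) (k + l + 1) * thetaTerm p (-(x / y)) (k - l) =
      -(x * y) * (thetaTerm (p ^ 2) (p * x ^ 2) k * thetaTerm (p ^ 2) (p ^ 2 * y ^ 2) l) := by
  simp only [thetaTerm]
  obtain ⟨a, ha, ha'⟩ := exists_triangular (k + l + 1)
  obtain ⟨b, hb, hb'⟩ := exists_triangular (k - l)
  obtain ⟨c, hc, hc'⟩ := exists_triangular k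
  obtain ⟨d, hd, hd'⟩ := exists_triangular l
  have hab : a + b = 2 * c + 2 * d + k + 2 * l := by
    refine mul_left_cancel₀ (two_ne_zero' ℤ) ?_
    linear_combination -ha - hb + 2 * hc + 2 * hd
  have h1 := congrArg (fun n => p ^ n) hab
  simp only [zpow_add₀ hp0, zpow_mul, zpow_ofNat] at h1
  rw [ha', hb', hc', hd', mul_zpow p, mul_zpow (p ^ 2),
    zpow_add₀ (neg_ne_zero.2 (mul_ne_zero hx hy)) (k + l), zpow_one]
  have h2 := neg_mul_zpow_mul_neg_div_zpow hx hy k l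
  generalize (-(x * y)) ^ (k + l) = A at *
  generalize (-(x / y)) ^ (k - l) = B at *
  linear_combination -(x * y) * p ^ a * p ^ b * h2 - x * y * (x ^ 2) ^ k * (y ^ 2) ^ l * h1

/-- The double series is summed over the two parity classes of `m + n`; in each class the variables
separate. A shift by `thetaSeries_mul` makes the same two functions appear in both classes. -/
theorem thetaSeries_mul_thetaSeries (hp : ‖p‖ < 1) (hp0 : p ≠ 0) {x y : ℂ} (hx : x ≠ 0)
    (hy : y ≠ 0) : thetaSeries p (-(x * y)) * thetaSeries p (-(x / y)) =
      thetaSeries (p ^ 2) (x ^ 2) * thetaSeries (p ^ 2) (p * y ^ 2) -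
        x / y * (thetaSeries (p ^ 2) (p * x ^ 2) * thetaSeries (p ^ 2) (y ^ 2)) := by
  have hp2 : ‖p ^ 2‖ < 1 := by rw [norm_pow]; exact pow_lt_one₀ (norm_nonneg p) hp two_ne_zero
  have hp20 : p ^ 2 ≠ 0 := pow_ne_zero 2 hp0
  have hS {z : ℂ} (hz : z ≠ 0) := (summable_thetaSeries hp hp0 hz).norm
  have hS2 {z : ℂ} (hz : z ≠ 0) := (summable_thetaSeries hp2 hp20 hz).norm
  have hxy : -(x * y) ≠ 0 := neg_ne_zero.2 (mul_ne_zero hx hy)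
  have hxy' : -(x / y) ≠ 0 := neg_ne_zero.2 (div_ne_zero hx hy)
  have hx2 := pow_ne_zero 2 hx
  have hy2 := pow_ne_zero 2 hy
  have hpx : p * x ^ 2 ≠ 0 := mul_ne_zero hp0 hx2
  have hpy : p * y ^ 2 ≠ 0 := mul_ne_zero hp0 hy2
  have hppy : p ^ 2 * y ^ 2 ≠ 0 := mul_ne_zero hp20 hy2
  obtain ⟨f, hf⟩ : ∃ f : ℤ × ℤ → ℂ, f =
    fun z => thetaTerm p (-(x * y)) z.1 * thetaTerm p (-(x / y)) z.2 := ⟨_, rfl⟩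
  have hs : Summable f := by
    rw [hf]
    exact summable_mul_of_summable_norm (hS hxy) (hS hxy')
  have hs' := parityEquiv.summable_iff.2 hs
  have h1 : thetaSeries p (-(x * y)) * thetaSeries p (-(x / y)) = ∑' z, f z := by
    rw [hf]
    exact tsum_mul_tsum_of_summable_norm (hS hxy) (hS hxy')
  have h2 : ∑' z, f z = ∑' z, f (parityEquiv (.inl z)) + ∑' z, f (parityEquiv (.inr z)) :=
    (parityEquiv.tsum_eq f).symm.trans (Summable.tsum_sum (hs'.comp_injective Sum.inl_injective)
      (hs'.comp_injective Sum.inr_injective))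
  have h3 : ∑' z, f (parityEquiv (.inl z)) =
      thetaSeries (p ^ 2) (x ^ 2) * thetaSeries (p ^ 2) (p * y ^ 2) := by
    refine Eq.trans (tsum_congr fun z => ?_)
      (tsum_mul_tsum_of_summable_norm (hS2 hx2) (hS2 hpy)).symm
    rw [hf, parityEquiv_inl]
    exact thetaSeries_term_even hp0 hx hy z.1 z.2
  have h4 : ∑' z, f (parityEquiv (.inr z)) = -(x * y) *
      (thetaSeries (p ^ 2) (p * x ^ 2) * thetaSeries (p ^ 2) (p ^ 2 * y ^ 2)) := by
    refine Eq.trans (tsum_congr fun z => ?_) (tsum_mul_left.trans (congrArg _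
      (tsum_mul_tsum_of_summable_norm (hS2 hpx) (hS2 hppy)).symm))
    rw [hf, parityEquiv_inr]
    exact thetaSeries_term_odd hp0 hx hy z.1 z.2
  rw [h1, h2, h3, h4, thetaSeries_mul hp20 hy2]
  field_simp
  ring

end triple

/-- The odd function `w⁻¹ * θ_p(w ^ 2)`. -/
noncomputable def oddTheta (p w : ℂ) : ℂ := w⁻¹ * theta p (w ^ 2)

section oddTheta

variable {p : ℂ}

theorem oddTheta_inv (hp : ‖p‖ < 1) {w : ℂ} (hw : w ≠ 0) : oddTheta p w⁻¹ = -oddTheta p w := by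
  rw [oddTheta, oddTheta, inv_pow, theta_inv hp (pow_ne_zero 2 hw)]
  field_simp

theorem oddTheta_neg (w : ℂ) : oddTheta p (-w) = -oddTheta p w := by
  rw [oddTheta, oddTheta, neg_sq, inv_neg, neg_mul]

theorem oddTheta_one (hp : ‖p‖ < 1) : oddTheta p 1 = 0 := by
  rw [oddTheta, theta_eq_poch hp, one_pow, poch_eq_mul hp]
  simp

/-- Only the shape of the right side, a 2 × 2 minor, matters for the addition formula. -/
theorem exists_oddTheta_mul (hp : ‖p‖ < 1) : ∃ F G : ℂ → ℂ, ∀ x y : ℂ, x ≠ 0 → y ≠ 0 →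
    oddTheta p (x * y) * oddTheta p (x / y) = F x * G y - G x * F y := by
  rcases eq_or_ne p 0 with rfl | hp0
  · refine ⟨fun x => x ^ 2 + (x ^ 2)⁻¹, fun _ => 1, fun x y hx hy => ?_⟩
    have h (z : ℂ) : theta 0 z = 1 - z := by
      rw [theta, tprod_eq_mulSingle 0 (fun k hk => by simp [hk])]
      simp
    simp only [oddTheta, h]
    field_simp
    ring
  · refine ⟨fun x => (poch p p)⁻¹ * (x ^ 2)⁻¹ * thetaSeries (p ^ 2) ((x ^ 2) ^ 2),
      fun x => (poch p p)⁻¹ * thetaSeries (p ^ 2) (p * (x ^ 2) ^ 2), fun x y hx hy => ?_⟩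
    have h := thetaSeries_mul_thetaSeries hp hp0 (pow_ne_zero 2 hx) (pow_ne_zero 2 hy)
    have hx2 := pow_ne_zero 2 hx
    have hy2 := pow_ne_zero 2 hy
    simp only [oddTheta, mul_pow x y, div_pow x y]
    rw [theta_eq_thetaSeries hp hp0 (mul_ne_zero hx2 hy2),
      theta_eq_thetaSeries hp hp0 (div_ne_zero hx2 hy2)]
    have hA : (x * y)⁻¹ * ((poch p p)⁻¹ * thetaSeries p (-(x ^ 2 * y ^ 2))) *
        ((x / y)⁻¹ * ((poch p p)⁻¹ * thetaSeries p (-(x ^ 2 / y ^ 2)))) =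
        (x ^ 2)⁻¹ * (poch p p)⁻¹ ^ 2 *
          (thetaSeries p (-(x ^ 2 * y ^ 2)) * thetaSeries p (-(x ^ 2 / y ^ 2))) := by
      field_simp
    rw [hA, h]
    field_simp

/-- The addition formula (Weierstrass, Riemann). -/
theorem oddTheta_addition (hp : ‖p‖ < 1) {x a b c : ℂ} (hx : x ≠ 0) (ha : a ≠ 0) (hb : b ≠ 0)
    (hc : c ≠ 0) :
    oddTheta p (x * a) * oddTheta p (x / a) * (oddTheta p (b * c) * oddTheta p (b / c)) +
      oddTheta p (x * b) * oddTheta p (x / b) * (oddTheta p (c * a) * oddTheta p (c / a)) +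
      oddTheta p (x * c) * oddTheta p (x / c) * (oddTheta p (a * b) * oddTheta p (a / b)) = 0 := by
  -- Each product becomes a minor of the 2 × 4 matrix of values of `F` and `G` at `x, a, b, c`; the
  -- sum is the Plücker relation between these minors.
  obtain ⟨F, G, h⟩ := exists_oddTheta_mul hp
  rw [h x a hx ha, h x b hx hb, h x c hx hc, h b c hb hc, h c a hc ha, h a b ha hb]
  ring

end oddTheta

end EllipticHexagon

namespace EllipticHexagon

/-! ### The triple gamma function -/

/-- Pairs of natural numbers, split according to whether the second one vanishes. -/
def splitSnd : ℕ ⊕ ℕ × ℕ ≃ ℕ × ℕ where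
  toFun := Sum.elim (fun i => (i, 0)) fun n => (n.1, n.2 + 1)
  invFun n := n.2.casesOn (.inl n.1) fun j => .inr (n.1, j)
  left_inv := by rintro (i | ⟨i, j⟩) <;> rfl
  right_inv := by rintro ⟨i, _ | j⟩ <;> rfl

/-- Triples of natural numbers, split according to whether the third one vanishes. -/
def splitThd : ℕ × ℕ ⊕ ℕ × ℕ × ℕ ≃ ℕ × ℕ × ℕ where
  toFun := Sum.elim (fun n => (n.1, n.2, 0)) fun n => (n.1, n.2.1, n.2.2 + 1)
  invFun n := n.2.2.casesOn (.inl (n.1, n.2.1)) fun k => .inr (n.1, n.2.1, k)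
  left_inv := by rintro (⟨i, j⟩ | ⟨i, j, k⟩) <;> rfl
  right_inv := by rintro ⟨i, j, _ | k⟩ <;> rfl

/-- The product `∏_{i, j ≥ 0} (1 - p ^ i q ^ j x)`. -/
noncomputable def doublePoch (p q x : ℂ) : ℂ :=
  linProd (fun n : ℕ × ℕ => p ^ n.1 * q ^ n.2) x

/-- The product `∏_{i, j, k ≥ 0} (1 - p ^ i q ^ j q ^ k x)`. -/
noncomputable def triplePoch (p q x : ℂ) : ℂ :=
  linProd (fun n : ℕ × ℕ × ℕ => p ^ n.1 * q ^ n.2.1 * q ^ n.2.2) x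

section gamma

variable {p q : ℂ}

theorem summable_double (hp : ‖p‖ < 1) (hq : ‖q‖ < 1) :
    Summable fun n : ℕ × ℕ => ‖p ^ n.1 * q ^ n.2‖ :=
  (summable_norm_pow hp).mul_norm (summable_norm_pow hq)

theorem summable_triple (hp : ‖p‖ < 1) (hq : ‖q‖ < 1) :
    Summable fun n : ℕ × ℕ × ℕ => ‖p ^ n.1 * q ^ n.2.1 * q ^ n.2.2‖ := by
  simpa only [mul_assoc] using (summable_norm_pow hp).mul_norm (summable_double hq hq)

theorem doublePoch_eq_mul (hp : ‖p‖ < 1) (hq : ‖q‖ < 1) (x : ℂ) :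
    doublePoch p q x = poch p x * doublePoch p q (q * x) := by
  have h := linProd_eq_mul (summable_double hp hq) splitSnd q (fun i => by
    change p ^ i.1 * q ^ (i.2 + 1) = _
    ring) x
  rw [doublePoch, h, poch]
  congr 2
  funext k
  simp [splitSnd]

theorem triplePoch_eq_mul (hp : ‖p‖ < 1) (hq : ‖q‖ < 1) (x : ℂ) :
    triplePoch p q x = doublePoch p q x * triplePoch p q (q * x) := by
  have h := linProd_eq_mul (summable_triple hp hq) splitThd q (fun i => by
    change p ^ i.1 * q ^ i.2.1 * q ^ (i.2.2 + 1) = _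
    ring) x
  rw [triplePoch, h, doublePoch]
  congr 2
  funext k
  simp [splitThd]

theorem doublePoch_eq_prod (hp : ‖p‖ < 1) (hq : ‖q‖ < 1) (n : ℕ) (x : ℂ) :
    doublePoch p q x = (∏ k ∈ Finset.range n, poch p (q ^ k * x)) * doublePoch p q (q ^ n * x) := by
  induction n with
  | zero => simp
  | succ n ih =>
    rw [ih, doublePoch_eq_mul hp hq (q ^ n * x), Finset.prod_range_succ, pow_succ']
    ring_nf

theorem triplePoch_eq_prod (hp : ‖p‖ < 1) (hq : ‖q‖ < 1) (m : ℕ) (x : ℂ) :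
    triplePoch p q x =
      (∏ j ∈ Finset.range m, doublePoch p q (q ^ j * x)) * triplePoch p q (q ^ m * x) := by
  induction m with
  | zero => simp
  | succ m ih =>
    rw [ih, triplePoch_eq_mul hp hq (q ^ m * x), Finset.prod_range_succ, pow_succ']
    ring_nf

/-- A shift by `q` divides `triplePoch` by `doublePoch`, and a shift of that divides it by `poch`.
Two telescoping products leave the double product. -/
theorem triplePoch_box (hp : ‖p‖ < 1) (hq : ‖q‖ < 1) (m n : ℕ) (x : ℂ) :
    triplePoch p q x * triplePoch p q (q ^ (m + n) * x) =
      triplePoch p q (q ^ m * x) * triplePoch p q (q ^ n * x) *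
        ∏ j ∈ Finset.range m, ∏ k ∈ Finset.range n, poch p (q ^ (j + k) * x) := by
  rw [triplePoch_eq_prod hp hq m x, triplePoch_eq_prod hp hq m (q ^ n * x)]
  have h : ∀ j ∈ Finset.range m, doublePoch p q (q ^ j * x) =
      (∏ k ∈ Finset.range n, poch p (q ^ (j + k) * x)) * doublePoch p q (q ^ j * (q ^ n * x)) := by
    intro j _
    rw [doublePoch_eq_prod hp hq n, show q ^ n * (q ^ j * x) = q ^ j * (q ^ n * x) by ring]
    congr 1
    exact Finset.prod_congr rfl fun k _ => by rw [show q ^ k * (q ^ j * x) = q ^ (j + k) * x by ring]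
  rw [Finset.prod_congr rfl h, Finset.prod_mul_distrib,
    show q ^ m * (q ^ n * x) = q ^ (m + n) * x by ring]
  ring

theorem tripleGamma_eq (hp : ‖p‖ < 1) (hq : ‖q‖ < 1) (x : ℂ) :
    tripleGamma p q q x = triplePoch p q (p * q ^ 2 / x) * triplePoch p q x := by
  have h (n : ℕ × ℕ × ℕ) : p ^ (n.1 + 1) * q ^ (n.2.1 + 1) * q ^ (n.2.2 + 1) / x =
      p ^ n.1 * q ^ n.2.1 * q ^ n.2.2 * (p * q ^ 2 / x) := by ring
  simp only [tripleGamma, h]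
  exact Multipliable.tprod_mul (multipliable_linProd (summable_triple hp hq) _)
    (multipliable_linProd (summable_triple hp hq) _)

theorem continuousOn_tripleGamma (hp : ‖p‖ < 1) (hq : ‖q‖ < 1) :
    ContinuousOn (tripleGamma p q q) {0}ᶜ := by
  have hc : Continuous (triplePoch p q) := continuous_linProd (summable_triple hp hq)
  rw [funext (tripleGamma_eq hp hq)]
  exact (hc.comp_continuousOn (continuousOn_const.div continuousOn_id fun x hx => hx)).mul
    hc.continuousOn

/-- The mixed second difference of the triple gamma function is a product of theta functions. -/
theorem tripleGamma_box (hp : ‖p‖ < 1) (hq : ‖q‖ < 1) (hq0 : q ≠ 0) (m n : ℕ) {x : ℂ}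
    (hx : x ≠ 0) :
    tripleGamma p q q x * tripleGamma p q q (q ^ (m + n) * x) =
      tripleGamma p q q (q ^ m * x) * tripleGamma p q q (q ^ n * x) *
        ∏ j ∈ Finset.range m, ∏ k ∈ Finset.range n, theta p (q ^ (j + k) * x) := by
  have h1 := triplePoch_box hp hq m n x
  have h2 := triplePoch_box hp hq m n (p * q ^ 2 / (q ^ (m + n) * x))
  have e (k l : ℕ) (hkl : l + k = m + n) :
      q ^ k * (p * q ^ 2 / (q ^ (m + n) * x)) = p * q ^ 2 / (q ^ l * x) := by
    rw [← hkl, pow_add]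
    field_simp
  rw [e m n (by omega), e n m (by omega), e (m + n) 0 (by omega), pow_zero, one_mul] at h2
  -- Reversing both ranges replaces `j + k` by `m + n - 2 - (j + k)`. The factor `q ^ 2` in the
  -- reflected argument compensates exactly the `-2`.
  have h3 : ∏ j ∈ Finset.range m, ∏ k ∈ Finset.range n,
      poch p (q ^ (j + k) * (p * q ^ 2 / (q ^ (m + n) * x))) =
      ∏ j ∈ Finset.range m, ∏ k ∈ Finset.range n, poch p (p / (q ^ (j + k) * x)) := by
    rw [← Finset.prod_range_reflect]
    refine Finset.prod_congr rfl fun j hj => ?_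
    rw [← Finset.prod_range_reflect]
    refine Finset.prod_congr rfl fun k hk => ?_
    rw [Finset.mem_range] at hj hk
    obtain ⟨a, rfl⟩ : ∃ a, m = j + a + 1 := ⟨m - j - 1, by omega⟩
    obtain ⟨b, rfl⟩ : ∃ b, n = k + b + 1 := ⟨n - k - 1, by omega⟩
    congr 1
    rw [show j + a + 1 - 1 - j = a by omega, show k + b + 1 - 1 - k = b by omega]
    field_simp
    ring
  rw [h3] at h2
  simp only [tripleGamma_eq hp hq, theta_eq_poch hp, Finset.prod_mul_distrib]
  linear_combination triplePoch p q (p * q ^ 2 / x) * triplePoch p q (p * q ^ 2 / (q ^ (m + n) * x))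
    * h1 + triplePoch p q (q ^ m * x) * triplePoch p q (q ^ n * x) *
    (∏ j ∈ Finset.range m, ∏ k ∈ Finset.range n, poch p (q ^ (j + k) * x)) * h2

end gamma

end EllipticHexagon

namespace EllipticHexagon

/-! ### Unit triangles and lozenges in terms of the edges parallel to the first axis -/

/-- The unit triangle on one side of the edge from `v` to `v - e₀`. -/
def upTriangle (v : ℤ × ℤ) : Finset (ℤ × ℤ) := triangle v 1 2

/-- The unit triangle on the other side of the edge from `v` to `v - e₀`. -/
def downTriangle (v : ℤ × ℤ) : Finset (ℤ × ℤ) := triangle v 2 1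

/-- The edge of the upper triangle of a lozenge. -/
def upEdge (l : Lozenge) : ℤ × ℤ :=
  ![(l.2.1, l.2.2), (l.2.1, l.2.2 - 1), (l.2.1 + 1, l.2.2)] l.1

/-- The edge of the lower triangle of a lozenge. -/
def downEdge (l : Lozenge) : ℤ × ℤ :=
  ![(l.2.1, l.2.2), (l.2.1 + 1, l.2.2), (l.2.1 + 1, l.2.2 + 1)] l.1

theorem triangle_eq_up (l : Lozenge) :
    triangle l.2 (l.1 + 1) (l.1 + 2) = upTriangle (upEdge l) := by
  obtain ⟨k, b, c⟩ := l
  ext ⟨x, y⟩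
  fin_cases k <;> simp [triangle, upTriangle, upEdge, step] <;> omega

theorem triangle_eq_down (l : Lozenge) :
    triangle l.2 (l.1 + 2) (l.1 + 1) = downTriangle (downEdge l) := by
  obtain ⟨k, b, c⟩ := l
  ext ⟨x, y⟩
  fin_cases k <;> simp [triangle, downTriangle, downEdge, step] <;> omega

theorem lozengeTriangles_eq (l : Lozenge) :
    lozengeTriangles l = {upTriangle (upEdge l), downTriangle (downEdge l)} := by
  rw [lozengeTriangles, triangle_eq_up, triangle_eq_down]

theorem isUnitTriangle_up (v : ℤ × ℤ) : IsUnitTriangle (upTriangle v) :=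
  ⟨v, 1, 2, by decide, rfl⟩

theorem isUnitTriangle_down (v : ℤ × ℤ) : IsUnitTriangle (downTriangle v) :=
  ⟨v, 2, 1, by decide, rfl⟩

theorem isUnitTriangle_iff (t : Finset (ℤ × ℤ)) :
    IsUnitTriangle t ↔ (∃ v, t = upTriangle v) ∨ ∃ v, t = downTriangle v := by
  constructor
  · rintro ⟨v, i, j, hij, rfl⟩
    have h : ∀ i j : Fin 3, i ≠ j →
        (∃ k, i = k + 1 ∧ j = k + 2) ∨ ∃ k, i = k + 2 ∧ j = k + 1 := by decide
    rcases h i j hij with ⟨k, rfl, rfl⟩ | ⟨k, rfl, rfl⟩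
    · exact .inl ⟨_, triangle_eq_up (k, v)⟩
    · exact .inr ⟨_, triangle_eq_down (k, v)⟩
  · rintro (⟨v, rfl⟩ | ⟨v, rfl⟩)
    · exact isUnitTriangle_up v
    · exact isUnitTriangle_down v

/-- The sum of the vertices determines `v`, and its residue modulo 3 determines the orientation of
the triangle. -/
theorem sum_upTriangle (v : ℤ × ℤ) :
    ∑ x ∈ upTriangle v, x = (3 * v.1 - 1, 3 * v.2 + 1) := by
  obtain ⟨b, c⟩ := v
  simp only [upTriangle, triangle, step]
  rw [Finset.sum_insert, Finset.sum_insert, Finset.sum_singleton] <;> simp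
  constructor <;> ring

theorem sum_downTriangle (v : ℤ × ℤ) :
    ∑ x ∈ downTriangle v, x = (3 * v.1 - 2, 3 * v.2 - 1) := by
  obtain ⟨b, c⟩ := v
  simp only [downTriangle, triangle, step]
  rw [Finset.sum_insert, Finset.sum_insert, Finset.sum_singleton] <;> simp
  constructor <;> ring

theorem upTriangle_injective : Function.Injective upTriangle := fun v w h => by
  have := (sum_upTriangle v).symm.trans (h ▸ sum_upTriangle w)
  rw [Prod.mk.injEq] at this
  ext <;> omega

theorem downTriangle_injective : Function.Injective downTriangle := fun v w h => by
  have := (sum_downTriangle v).symm.trans (h ▸ sum_downTriangle w)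
  rw [Prod.mk.injEq] at this
  ext <;> omega

theorem upTriangle_ne_downTriangle (v w : ℤ × ℤ) : upTriangle v ≠ downTriangle w := fun h => by
  have := (sum_upTriangle v).symm.trans (h ▸ sum_downTriangle w)
  rw [Prod.mk.injEq] at this
  omega

/-- The edges of the hexagon parallel to the first axis. -/
noncomputable def hexagonEdges (a : Fin 3 → ℕ) : Finset (ℤ × ℤ) :=
  (Finset.Icc (1 - (a 2 : ℤ)) (a 0) ×ˢ Finset.Icc (-(a 2 : ℤ)) (a 1)).filter
    fun v => -(a 0 : ℤ) ≤ v.2 - v.1 ∧ v.2 - v.1 + 1 ≤ a 1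

theorem mem_hexagonEdges (a : Fin 3 → ℕ) (b c : ℤ) : (b, c) ∈ hexagonEdges a ↔
    (1 - (a 2 : ℤ) ≤ b ∧ b ≤ a 0) ∧ (-(a 2 : ℤ) ≤ c ∧ c ≤ a 1) ∧
      -(a 0 : ℤ) ≤ c - b ∧ c - b + 1 ≤ a 1 := by
  simp [hexagonEdges, and_assoc]

/-- The edges whose upper triangle lies in the hexagon. -/
noncomputable def upEdges (a : Fin 3 → ℕ) : Finset (ℤ × ℤ) := (hexagonEdges a).filter fun v => v.2 < a 1

/-- The edges whose lower triangle lies in the hexagon. -/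
noncomputable def downEdges (a : Fin 3 → ℕ) : Finset (ℤ × ℤ) :=
  (hexagonEdges a).filter fun v => -(a 2 : ℤ) < v.2

theorem upTriangle_subset_iff (a : Fin 3 → ℕ) (v : ℤ × ℤ) :
    upTriangle v ⊆ hexagon a ↔ v ∈ upEdges a := by
  obtain ⟨b, c⟩ := v
  simp only [upTriangle, triangle, step, Finset.insert_subset_iff, Finset.singleton_subset_iff,
    hexagon, upEdges, Finset.mem_filter, Finset.mem_product, Finset.mem_Icc, mem_hexagonEdges,
    Matrix.cons_val, Prod.mk_add_mk]
  omega

theorem downTriangle_subset_iff (a : Fin 3 → ℕ) (v : ℤ × ℤ) :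
    downTriangle v ⊆ hexagon a ↔ v ∈ downEdges a := by
  obtain ⟨b, c⟩ := v
  simp only [downTriangle, triangle, step, Finset.insert_subset_iff, Finset.singleton_subset_iff,
    hexagon, downEdges, Finset.mem_filter, Finset.mem_product, Finset.mem_Icc, mem_hexagonEdges,
    Matrix.cons_val, Prod.mk_add_mk]
  omega

/-- A set of lozenges covers each upper triangle with edge in `U` and each lower triangle with
edge in `D` exactly once, and no other triangles. -/
def IsCover (U D : Finset (ℤ × ℤ)) (T : Finset Lozenge) : Prop :=
  (∀ l ∈ T, upEdge l ∈ U ∧ downEdge l ∈ D) ∧ (∀ v ∈ U, ∃! l, l ∈ T ∧ upEdge l = v) ∧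
    ∀ v ∈ D, ∃! l, l ∈ T ∧ downEdge l = v

/-- A lozenge contains exactly one triangle of each orientation, so tilings are perfect matchings
between upper and lower triangles, each indexed by its horizontal edge. -/
theorem isTiling_iff (a : Fin 3 → ℕ) (T : Finset Lozenge) :
    IsTiling a T ↔ IsCover (upEdges a) (downEdges a) T := by
  have hu (v : ℤ × ℤ) (l : Lozenge) : upTriangle v ∈ lozengeTriangles l ↔ upEdge l = v := by
    simp [lozengeTriangles_eq, upTriangle_ne_downTriangle, upTriangle_injective.eq_iff,
      eq_comm (a := v)]
  have hd (v : ℤ × ℤ) (l : Lozenge) : downTriangle v ∈ lozengeTriangles l ↔ downEdge l = v := by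
    simp [lozengeTriangles_eq, (upTriangle_ne_downTriangle _ _).symm,
      downTriangle_injective.eq_iff, eq_comm (a := v)]
  simp only [IsTiling, IsCover]
  refine and_congr ?_ ⟨fun h => ⟨fun v hv => ?_, fun v hv => ?_⟩, fun h t ht hta => ?_⟩
  · simp [lozengeTriangles_eq, upTriangle_subset_iff, downTriangle_subset_iff]
  · simpa only [hu] using h _ (isUnitTriangle_up v) ((upTriangle_subset_iff a v).2 hv)
  · simpa only [hd] using h _ (isUnitTriangle_down v) ((downTriangle_subset_iff a v).2 hv)
  · rcases (isUnitTriangle_iff t).1 ht with ⟨v, rfl⟩ | ⟨v, rfl⟩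
    · simpa only [hu] using h.1 v ((upTriangle_subset_iff a v).1 hta)
    · simpa only [hd] using h.2 v ((downTriangle_subset_iff a v).1 hta)

theorem IsCover.card_eq {U D : Finset (ℤ × ℤ)} {T : Finset Lozenge} (h : IsCover U D T) :
    T.card = U.card := by
  refine Finset.card_bij (fun l _ => upEdge l) (fun l hl => (h.1 l hl).1) ?_ ?_
  · intro l hl m hm hlm
    exact (h.2.1 _ (h.1 m hm).1).unique ⟨hl, hlm⟩ ⟨hm, rfl⟩
  · intro v hv
    obtain ⟨l, hl, -⟩ := h.2.1 v hv
    exact ⟨l, hl.1, hl.2⟩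

/-- The hexagon is cut into three parallelograms, with one upper triangle for each unit cell. The
count is the number of lozenges of any tiling, which governs the sign in the reflection formula. -/
theorem card_upEdges (a : Fin 3 → ℕ) :
    (upEdges a).card = a 0 * a 1 + a 1 * a 2 + a 2 * a 0 := by
  have h : upEdges a = (((Finset.range (a 0) ×ˢ Finset.range (a 1)).image
      fun n : ℕ × ℕ => ((n.1 + 1 : ℤ), (n.2 : ℤ))) ∪
      ((Finset.range (a 1) ×ˢ Finset.range (a 2)).image
        fun n : ℕ × ℕ => (-(n.2 : ℤ), (n.1 - n.2 : ℤ)))) ∪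
      ((Finset.range (a 2) ×ˢ Finset.range (a 0)).image
        fun n : ℕ × ℕ => ((n.2 - n.1 : ℤ), (-1 - n.1 : ℤ))) := by
    ext ⟨b, c⟩
    simp only [upEdges, Finset.mem_filter, mem_hexagonEdges, Finset.mem_union, Finset.mem_image,
      Finset.mem_product, Finset.mem_range, Prod.exists, Prod.mk.injEq]
    constructor
    · intro h
      by_cases h1 : 1 ≤ b ∧ 0 ≤ c
      · exact .inl (.inl ⟨(b - 1).toNat, c.toNat, by omega⟩)
      by_cases h2 : b ≤ 0 ∧ b ≤ c
      · exact .inl (.inr ⟨(c - b).toNat, (-b).toNat, by omega⟩)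
      · exact .inr ⟨(-1 - c).toNat, (b - c - 1).toNat, by omega⟩
    · rintro ((⟨i, j, h⟩ | ⟨i, j, h⟩) | ⟨i, j, h⟩) <;> omega
  rw [h, Finset.card_union_of_disjoint, Finset.card_union_of_disjoint, Finset.card_image_of_injective,
    Finset.card_image_of_injective, Finset.card_image_of_injective]
  · simp only [Finset.card_product, Finset.card_range]
  all_goals first
    | (rintro ⟨i, j⟩ ⟨k, l⟩ h
       simp only [Prod.mk.injEq] at h ⊢
       omega)
    | (rw [Finset.disjoint_left]
       rintro ⟨b, c⟩ h1 h2
       simp only [Finset.mem_union, Finset.mem_image, Finset.mem_product, Finset.mem_range,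
         Prod.exists, Prod.mk.injEq] at h1 h2
       obtain ⟨i, j, hij⟩ := h2
       rcases h1 with ⟨k, l, hkl⟩ | ⟨k, l, hkl⟩ <;> omega)

theorem card_of_mem_tilings {a : Fin 3 → ℕ} {T : Finset Lozenge} (h : T ∈ tilings a) :
    T.card = a 0 * a 1 + a 1 * a 2 + a 2 * a 0 := by
  rw [((isTiling_iff a T).1 ((mem_tilings_iff a T).1 h)).card_eq, card_upEdges]

end EllipticHexagon

namespace EllipticHexagon

/-! ### Symmetries of the partition function -/

/-- A symmetry of the lattice that maps one hexagon to another carries tilings to tilings. -/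
theorem sum_tilings_eq {a a' : Fin 3 → ℕ} (M : Equiv.Perm (ℤ × ℤ)) (Φ : Equiv.Perm Lozenge)
    (hM : ∀ t, IsUnitTriangle (t.map M.toEmbedding) ↔ IsUnitTriangle t)
    (hΦ : ∀ l t, t.map M.toEmbedding ∈ lozengeTriangles (Φ l) ↔ t ∈ lozengeTriangles l)
    (ha : ∀ v, M v ∈ hexagon a' ↔ v ∈ hexagon a) {f f' : Finset Lozenge → ℂ}
    (hf : ∀ T ∈ tilings a, f' (T.map Φ.toEmbedding) = f T) :
    ∑ T ∈ tilings a', f' T = ∑ T ∈ tilings a, f T := by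
  have hsub (t : Finset (ℤ × ℤ)) : t.map M.toEmbedding ⊆ hexagon a' ↔ t ⊆ hexagon a := by
    simp only [Finset.subset_iff, Finset.forall_mem_map, Equiv.coe_toEmbedding, ha]
  have hsurj : Function.Surjective fun t : Finset (ℤ × ℤ) => t.map M.toEmbedding :=
    M.finsetCongr.surjective
  have hT (T : Finset Lozenge) : T.map Φ.toEmbedding ∈ tilings a' ↔ T ∈ tilings a := by
    rw [mem_tilings_iff, mem_tilings_iff, IsTiling, IsTiling]
    refine and_congr ?_ ?_
    · rw [Finset.forall_mem_map]
      refine forall₂_congr fun l _ => ?_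
      rw [hsurj.forall]
      simp only [Equiv.coe_toEmbedding, hΦ, hsub]
    · rw [hsurj.forall]
      refine forall_congr' fun t => ?_
      rw [hM, hsub]
      refine imp_congr_right fun _ => imp_congr_right fun _ => ?_
      refine (Φ.existsUnique_congr fun {l} => ?_).symm
      rw [hΦ]
      simp
  refine (Finset.sum_equiv Φ.finsetCongr (fun T => (hT T).symm) fun T h => ?_).symm
  exact (hf T h).symm

/-! ### Permutations of the three axes acting on the lattice. -/

theorem sum_step_perm (σ : Equiv.Perm (Fin 3)) : step (σ 0) + step (σ 1) + step (σ 2) = 0 := by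
  have h := Equiv.sum_comp σ step
  rw [Fin.sum_univ_three, Fin.sum_univ_three] at h
  exact h

/-- The linear map of the lattice that permutes the three unit coordinate vectors. -/
def permutePointFun (σ : Equiv.Perm (Fin 3)) (v : ℤ × ℤ) : ℤ × ℤ :=
  v.1 • step (σ 0) + v.2 • step (σ 1)

theorem permutePointFun_step (σ : Equiv.Perm (Fin 3)) (i : Fin 3) :
    permutePointFun σ (step i) = step (σ i) := by
  have h := sum_step_perm σ
  fin_cases i
  · simp [permutePointFun, step]
  · simp [permutePointFun, step]
  · change (-1 : ℤ) • step (σ 0) + (-1 : ℤ) • step (σ 1) = step (σ 2)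
    rw [eq_neg_of_add_eq_zero_right h]
    module

theorem permutePointFun_add (σ : Equiv.Perm (Fin 3)) (v w : ℤ × ℤ) :
    permutePointFun σ (v + w) = permutePointFun σ v + permutePointFun σ w := by
  simp only [permutePointFun, Prod.fst_add, Prod.snd_add]
  module

theorem permutePointFun_smul (σ : Equiv.Perm (Fin 3)) (n : ℤ) (v : ℤ × ℤ) :
    permutePointFun σ (n • v) = n • permutePointFun σ v := by
  simp only [permutePointFun, Prod.smul_fst, Prod.smul_snd, smul_eq_mul]
  module

theorem permutePointFun_inv (σ τ : Equiv.Perm (Fin 3)) (h : ∀ i, σ (τ i) = i) (v : ℤ × ℤ) :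
    permutePointFun σ (permutePointFun τ v) = v := by
  rw [permutePointFun.eq_1 τ, permutePointFun_add, permutePointFun_smul, permutePointFun_smul,
    permutePointFun_step, permutePointFun_step, h, h]
  ext <;> simp [step]

/-- The lattice symmetry that permutes the three unit coordinate vectors. -/
def permutePoint (σ : Equiv.Perm (Fin 3)) : Equiv.Perm (ℤ × ℤ) where
  toFun := permutePointFun σ
  invFun := permutePointFun σ⁻¹
  left_inv := permutePointFun_inv σ⁻¹ σ (by simp)
  right_inv := permutePointFun_inv σ σ⁻¹ (by simp)

theorem map_triangle_permute (σ : Equiv.Perm (Fin 3)) (v : ℤ × ℤ) (i j : Fin 3) :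
    (triangle v i j).map (permutePoint σ).toEmbedding =
      triangle (permutePoint σ v) (σ i) (σ j) := by
  have h (v : ℤ × ℤ) : permutePoint σ v = permutePointFun σ v := rfl
  simp [triangle, h, permutePointFun_add, permutePointFun_step]

theorem mem_hexagon_iff_sum (a : Fin 3 → ℕ) (v : ℤ × ℤ) :
    v ∈ hexagon a ↔ ∃ x : Fin 3 → ℤ, (∀ i, 0 ≤ x i ∧ x i ≤ a i) ∧ v = ∑ i, x i • step i := by
  rw [mem_hexagon_iff]
  constructor
  · rintro ⟨x, y, z, hx, hy, hz, rfl⟩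
    refine ⟨![x, y, z], fun i => by fin_cases i <;> simpa, ?_⟩
    simp [Fin.sum_univ_three, step, sub_eq_add_neg, -zsmul_eq_mul]
  · rintro ⟨x, hx, rfl⟩
    refine ⟨x 0, x 1, x 2, hx 0, hx 1, hx 2, ?_⟩
    simp [Fin.sum_univ_three, step, sub_eq_add_neg, -zsmul_eq_mul]

theorem permutePoint_mem_hexagon (σ : Equiv.Perm (Fin 3)) (a : Fin 3 → ℕ) {v : ℤ × ℤ}
    (hv : v ∈ hexagon (a ∘ σ)) : permutePoint σ v ∈ hexagon a := by
  obtain ⟨x, hx, rfl⟩ := (mem_hexagon_iff_sum _ v).1 hv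
  refine (mem_hexagon_iff_sum _ _).2 ⟨x ∘ σ.symm, fun i => by simpa using hx (σ.symm i), ?_⟩
  rw [← Equiv.sum_comp σ fun i => (x ∘ σ.symm) i • step i]
  change permutePointFun σ _ = _
  simp only [Fin.sum_univ_three, permutePointFun_add, permutePointFun_smul, permutePointFun_step,
    Function.comp_apply, Equiv.symm_apply_apply]

theorem isUnitTriangle_map_permute (σ : Equiv.Perm (Fin 3)) {t : Finset (ℤ × ℤ)}
    (ht : IsUnitTriangle t) : IsUnitTriangle (t.map (permutePoint σ).toEmbedding) := by
  obtain ⟨v, i, j, hij, rfl⟩ := ht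
  exact ⟨_, _, _, σ.injective.ne hij, map_triangle_permute σ v i j⟩

theorem permutePoint_inv_apply (σ : Equiv.Perm (Fin 3)) (v : ℤ × ℤ) :
    permutePoint σ⁻¹ (permutePoint σ v) = v :=
  permutePointFun_inv σ⁻¹ σ (by simp) v

/-- The exponent is the sum of the coordinates of the center minus three times the coordinate normal
to the lozenge, an expression equivariant under permutations of the axes. -/
theorem labelExponent_permute (σ : Equiv.Perm (Fin 3)) (k : Fin 3) (v : ℤ × ℤ) :
    labelExponent (σ k, permutePoint σ v) = labelExponent (k, v) := by
  obtain ⟨b, c⟩ := v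
  have hinj := σ.injective
  change labelExponent (σ k, b • step (σ 0) + c • step (σ 1)) = _
  have key : ∀ i j k' : Fin 3, i ≠ j → ∀ m : Fin 3, (m = 0 → k' = i) → (m = 1 → k' = j) →
      (m = 2 → k' ≠ i ∧ k' ≠ j) →
      labelExponent (k', b • step i + c • step j) = labelExponent (m, (b, c)) := by
    intro i j k' hij m h0 h1 h2
    fin_cases m
    · obtain rfl := h0 rfl
      fin_cases k' <;> fin_cases j <;>
        first | exact (hij rfl).elim | (simp [labelExponent, step] <;> ring)
    · obtain rfl := h1 rfl
      fin_cases k' <;> fin_cases i <;>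
        first | exact (hij rfl).elim | (simp [labelExponent, step] <;> ring)
    · obtain ⟨hi, hj⟩ := h2 rfl
      fin_cases k' <;> fin_cases i <;> fin_cases j <;>
        first
        | exact (hij rfl).elim
        | exact (hi rfl).elim
        | exact (hj rfl).elim
        | (simp [labelExponent, step] <;> ring)
  refine key _ _ _ (hinj.ne (by decide)) k (by rintro rfl; rfl) (by rintro rfl; rfl) ?_
  rintro rfl
  exact ⟨hinj.ne (by decide), hinj.ne (by decide)⟩

theorem partitionFunction_permute (p s : ℂ) (a : Fin 3 → ℕ) (w : Fin 3 → ℂ)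
    (σ : Equiv.Perm (Fin 3)) :
    partitionFunction p s (a ∘ σ) (w ∘ σ) = partitionFunction p s a w := by
  refine (sum_tilings_eq (permutePoint σ) (Equiv.prodCongr σ (permutePoint σ)) (fun t => ?_)
    (fun l t => ?_) (fun v => ?_) fun T _ => ?_).symm
  · refine ⟨fun h => ?_, isUnitTriangle_map_permute σ⟩
    have := isUnitTriangle_map_permute σ⁻¹ h
    rw [Finset.map_map] at this
    convert this
    ext x
    simp [permutePoint_inv_apply]
  · obtain ⟨k, v⟩ := l
    have hσ : ∀ (σ : Equiv.Perm (Fin 3)) (k : Fin 3),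
        (σ (k + 1) = σ k + 1 ∧ σ (k + 2) = σ k + 2) ∨
          (σ (k + 1) = σ k + 2 ∧ σ (k + 2) = σ k + 1) := by decide
    have h : lozengeTriangles (σ k, permutePoint σ v) =
        (lozengeTriangles (k, v)).map (permutePoint σ).finsetCongr.toEmbedding := by
      simp only [lozengeTriangles, Finset.map_insert, Finset.map_singleton,
        Equiv.coe_toEmbedding, Equiv.finsetCongr_apply, map_triangle_permute]
      rcases hσ σ k with h | h <;> rw [h.1, h.2]
      exact Finset.pair_comm _ _
    change _ ∈ lozengeTriangles (σ k, permutePoint σ v) ↔ _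
    rw [h]
    exact Finset.mem_map' (permutePoint σ).finsetCongr.toEmbedding
  · refine ⟨fun h => ?_, permutePoint_mem_hexagon σ a⟩
    have := permutePoint_mem_hexagon σ⁻¹ (a ∘ σ) (v := permutePoint σ v)
      (by simpa [Function.comp_assoc] using h)
    rwa [permutePoint_inv_apply] at this
  · rw [Finset.prod_map]
    refine Finset.prod_congr rfl fun l _ => ?_
    obtain ⟨k, v⟩ := l
    change lozengeWeight p s w (σ k, permutePoint σ v) = _
    simp only [lozengeWeight, labelExponent_permute, Function.comp_apply]

/-- The central reflection of the hexagon. -/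
def reflectPoint (a : Fin 3 → ℕ) : Equiv.Perm (ℤ × ℤ) :=
  Equiv.subLeft ((a 0 - a 2 : ℤ), (a 1 - a 2 : ℤ))

/-- The action of the central reflection on lozenges. -/
def reflectLozenge (a : Fin 3 → ℕ) : Equiv.Perm Lozenge :=
  Function.Involutive.toPerm (fun l => (l.1, reflectPoint a l.2 + step l.1)) fun l => by
    refine Prod.ext rfl ?_
    simp only [reflectPoint, Equiv.subLeft_apply]
    abel

theorem map_triangle_reflect (a : Fin 3 → ℕ) (v : ℤ × ℤ) (i j k : Fin 3)
    (h : step i + step j + step k = 0) : (triangle v i j).map (reflectPoint a).toEmbedding =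
      triangle (reflectPoint a v + step k) j i := by
  have e1 : reflectPoint a v + step k = reflectPoint a (v + step i + step j) := by
    simp only [reflectPoint, Equiv.subLeft_apply]
    rw [eq_neg_of_add_eq_zero_right h]
    abel
  have e2 : reflectPoint a v + step k + step j = reflectPoint a (v + step i) := by
    rw [e1]; simp only [reflectPoint, Equiv.subLeft_apply]; abel
  have e3 : reflectPoint a v + step k + step j + step i = reflectPoint a v := by
    rw [e2]; simp only [reflectPoint, Equiv.subLeft_apply]; abel
  rw [triangle, triangle, e3, e2, e1]
  ext x
  simp only [Finset.map_insert, Finset.map_singleton, Equiv.coe_toEmbedding, Finset.mem_insert,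
    Finset.mem_singleton]
  tauto

/-- The reflection sends a center `x` to `(α, β, γ) - x`. The exponent is linear in the center, and
`reflectExponent` is its value at `(α, β, γ)`. -/
theorem labelExponent_reflect (a : Fin 3 → ℕ) (l : Lozenge) :
    labelExponent (reflectLozenge a l) = reflectExponent a l.1 - labelExponent l := by
  obtain ⟨k, b, c⟩ := l
  change labelExponent (k, reflectPoint a (b, c) + step k) = _
  fin_cases k <;>
    simp [labelExponent, reflectExponent, reflectPoint, step, Fin.sum_univ_three] <;> ring

theorem sum_tilings_reflect (a : Fin 3 → ℕ) {f f' : Finset Lozenge → ℂ}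
    (hf : ∀ T ∈ tilings a, f' (T.map (reflectLozenge a).toEmbedding) = f T) :
    ∑ T ∈ tilings a, f' T = ∑ T ∈ tilings a, f T := by
  have hinv (t : Finset (ℤ × ℤ)) :
      (t.map (reflectPoint a).toEmbedding).map (reflectPoint a).toEmbedding = t := by
    rw [Finset.map_map]
    ext x
    simp [reflectPoint]
  have hstep : ∀ i j : Fin 3, i ≠ j → ∃ k, step i + step j + step k = 0 := by decide
  have hU {t : Finset (ℤ × ℤ)} (ht : IsUnitTriangle t) :
      IsUnitTriangle (t.map (reflectPoint a).toEmbedding) := by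
    obtain ⟨v, i, j, hij, rfl⟩ := ht
    obtain ⟨k, hk⟩ := hstep i j hij
    exact ⟨_, _, _, hij.symm, map_triangle_reflect a v i j k hk⟩
  refine sum_tilings_eq (reflectPoint a) (reflectLozenge a) (fun t => ?_) (fun l t => ?_)
    (fun v => ?_) hf
  · exact ⟨fun h => by simpa only [hinv] using hU h, hU⟩
  · obtain ⟨k, v⟩ := l
    have h : lozengeTriangles (reflectLozenge a (k, v)) =
        (lozengeTriangles (k, v)).map (reflectPoint a).finsetCongr.toEmbedding := by
      have h1 : ∀ k : Fin 3, step (k + 1) + step (k + 2) + step k = 0 := by decide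
      have h2 : ∀ k : Fin 3, step (k + 2) + step (k + 1) + step k = 0 := by decide
      simp only [lozengeTriangles, Finset.map_insert, Finset.map_singleton,
        Equiv.coe_toEmbedding, Equiv.finsetCongr_apply, map_triangle_reflect a v _ _ k (h1 k),
        map_triangle_reflect a v _ _ k (h2 k)]
      exact Finset.pair_comm _ _
    rw [h]
    exact Finset.mem_map' (reflectPoint a).finsetCongr.toEmbedding
  · obtain ⟨b, c⟩ := v
    simp only [reflectPoint, Equiv.subLeft_apply, hexagon, Finset.mem_filter, Finset.mem_product,
      Finset.mem_Icc, Prod.mk_sub_mk]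
    omega

/-! ### Effect of the symmetries on the weights and on the partition function. -/

theorem lozengeWeight_eq (p s : ℂ) (w : Fin 3 → ℂ) (l : Lozenge) :
    lozengeWeight p s w l = oddTheta p (s ^ labelExponent l * w l.1) := rfl

/-- The new label root of the reflected lozenge is the inverse of the old one, so each lozenge
contributes one sign by `oddTheta_inv`. -/
theorem partitionFunction_reflect {p s : ℂ} (hp : ‖p‖ < 1) (hs : s ≠ 0) (a : Fin 3 → ℕ)
    {w : Fin 3 → ℂ} (hw : ∀ i, w i ≠ 0) :
    partitionFunction p s a (fun i => (s ^ reflectExponent a i * w i)⁻¹) =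
      (-1) ^ (a 0 * a 1 + a 1 * a 2 + a 2 * a 0) * partitionFunction p s a w := by
  rw [partitionFunction, partitionFunction, Finset.mul_sum]
  refine sum_tilings_reflect a fun T hT => ?_
  rw [Finset.prod_map, ← card_of_mem_tilings hT, ← Finset.prod_const, ← Finset.prod_mul_distrib]
  refine Finset.prod_congr rfl fun l _ => ?_
  rw [lozengeWeight_eq, lozengeWeight_eq, neg_one_mul,
    ← oddTheta_inv hp (mul_ne_zero (zpow_ne_zero _ hs) (hw _)), Equiv.coe_toEmbedding,
    labelExponent_reflect]
  change oddTheta p (s ^ (reflectExponent a l.1 - _) * (s ^ reflectExponent a l.1 * w l.1)⁻¹) = _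
  have := zpow_ne_zero (reflectExponent a l.1) hs
  rw [zpow_sub₀ hs]
  congr 1
  field_simp

theorem partitionFunction_neg (p s : ℂ) (a : Fin 3 → ℕ) (w : Fin 3 → ℂ) :
    partitionFunction p s a (fun i => -w i) =
      (-1) ^ (a 0 * a 1 + a 1 * a 2 + a 2 * a 0) * partitionFunction p s a w := by
  rw [partitionFunction, partitionFunction, Finset.mul_sum]
  refine Finset.sum_congr rfl fun T hT => ?_
  rw [← card_of_mem_tilings hT, ← Finset.prod_const, ← Finset.prod_mul_distrib]
  refine Finset.prod_congr rfl fun l _ => ?_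
  rw [lozengeWeight_eq, lozengeWeight_eq, mul_neg, oddTheta_neg, neg_one_mul]

theorem Z_permute (p s : ℂ) (σ : Equiv.Perm (Fin 3)) (x : Params) :
    (permute σ x).Z p s = x.Z p s :=
  partitionFunction_permute p s x.side x.root σ

theorem Z_reflect {p s : ℂ} (hp : ‖p‖ < 1) (hs : s ≠ 0) (x : Params) :
    (reflect s hs x).Z p s = x.Z p s := by
  change partitionFunction p s x.side (fun i => -(s ^ reflectExponent x.side i * x.root i)⁻¹) = _
  rw [partitionFunction_neg, partitionFunction_reflect hp hs _ x.root_ne_zero, ← mul_assoc,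
    ← mul_pow]
  simp [Params.Z]

theorem Z_of_mem_symmetryGroup {p s : ℂ} (hp : ‖p‖ < 1) (hs : s ≠ 0) {g : Equiv.Perm Params}
    (hg : g ∈ symmetryGroup s hs) (x : Params) : (g x).Z p s = x.Z p s := by
  induction hg using Subgroup.closure_induction generalizing x with
  | mem g h =>
    rcases h with ⟨σ, rfl⟩ | rfl
    · exact Z_permute p s σ x
    · exact Z_reflect hp hs x
  | one => rfl
  | mul g h _ _ hg hh => rw [Equiv.Perm.mul_apply, hg, hh]
  | inv g _ hg => rw [← hg (g⁻¹ x), ← Equiv.Perm.mul_apply, mul_inv_cancel, Equiv.Perm.one_apply]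

end EllipticHexagon

namespace EllipticHexagon

/-! ### The symmetry group -/

/-- The homomorphism from a dihedral group given by a rotation and a reflection. -/
def dihedralLift {G : Type*} [Group G] {n : ℕ} [NeZero n] (a b : G) (ha : a ^ n = 1)
    (hb : b * b = 1) (hab : a * b = b * a⁻¹) : DihedralGroup n →* G :=
  have hz (i j : ZMod n) : a ^ (i + j).val = a ^ i.val * a ^ j.val := by
    rw [ZMod.val_add, ← pow_add, pow_eq_pow_mod (i.val + j.val) ha]
  have hs (i j : ZMod n) : a ^ (j - i).val = (a ^ i.val)⁻¹ * a ^ j.val := by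
    rw [eq_inv_mul_iff_mul_eq, ← hz, add_sub_cancel]
  have hc (i : ZMod n) : a ^ i.val * b = b * (a ^ i.val)⁻¹ := by
    rw [← inv_pow]
    exact ((show SemiconjBy b a⁻¹ a from hab.symm).pow_right i.val).eq.symm
  MonoidHom.mk'
    (fun x => match x with
      | .r i => a ^ i.val
      | .sr i => b * a ^ i.val) <| by
    rintro (i | i) (j | j)
    · exact hz i j
    · change b * a ^ (j - i).val = a ^ i.val * (b * a ^ j.val)
      rw [hs, ← mul_assoc, ← mul_assoc, hc]
    · change b * a ^ (i + j).val = b * a ^ i.val * a ^ j.val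
      rw [hz, mul_assoc]
    · change a ^ (j - i).val = b * a ^ i.val * (b * a ^ j.val)
      rw [hs, mul_assoc, ← mul_assoc _ b, hc, mul_assoc, ← mul_assoc, hb, one_mul]

/-- The Coxeter group of type `G₂` is the dihedral group of order twelve. -/
theorem nonempty_coxeterG₂_equiv_dihedral :
    Nonempty (CoxeterMatrix.G₂.Group ≃* DihedralGroup 6) := by
  let cs := CoxeterMatrix.G₂.toCoxeterSystem
  -- Adjacent reflections are chosen as generators because their product is the rotation `r 1`, of
  -- order 6.
  have hl : CoxeterMatrix.G₂.IsLiftable ![(.sr 0 : DihedralGroup 6), .sr 1] := by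
    intro i j
    fin_cases i <;> fin_cases j <;> decide
  have h6 : (cs.simple 0 * cs.simple 1) ^ 6 = 1 := cs.simple_mul_simple_pow 0 1
  have h0 := cs.simple_mul_simple_self 0
  have h1 := cs.simple_mul_simple_self 1
  let φ : CoxeterMatrix.G₂.Group →* DihedralGroup 6 := cs.lift ⟨_, hl⟩
  have hφ (i : Fin 2) : φ (cs.simple i) = ![(.sr 0 : DihedralGroup 6), .sr 1] i :=
    cs.lift_apply_simple hl i
  let ψ : DihedralGroup 6 →* CoxeterMatrix.G₂.Group :=
    dihedralLift (cs.simple 0 * cs.simple 1) (cs.simple 0) h6 h0 <| by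
      rw [mul_inv_rev, cs.inv_simple, cs.inv_simple, mul_assoc]
  have hr (i : ZMod 6) : ψ (.r i) = (cs.simple 0 * cs.simple 1) ^ i.val := rfl
  have hsr (i : ZMod 6) : ψ (.sr i) = cs.simple 0 * (cs.simple 0 * cs.simple 1) ^ i.val := rfl
  refine ⟨MonoidHom.toMulEquiv φ ψ (cs.ext_simple fun i => ?_) (MonoidHom.ext fun x => ?_)⟩
  · rw [MonoidHom.comp_apply, hφ]
    fin_cases i
    · change ψ (.sr 0) = cs.simple 0
      rw [hsr, ZMod.val_zero, pow_zero, mul_one]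
    · change ψ (.sr 1) = cs.simple 1
      rw [hsr, show (1 : ZMod 6).val = 1 from rfl, pow_one, ← mul_assoc, h0, one_mul]
  · have e1 : ∀ i : ZMod 6, ((.sr 0 : DihedralGroup 6) * .sr 1) ^ i.val = .r i := by decide
    rw [MonoidHom.comp_apply]
    rcases x with i | i
    · rw [hr, map_pow, map_mul, hφ, hφ]
      exact e1 i
    · rw [hsr, map_mul, map_pow, map_mul, hφ, hφ]
      change .sr 0 * ((.sr 0 : DihedralGroup 6) * .sr 1) ^ i.val = .sr i
      rw [e1, DihedralGroup.sr_mul_r, zero_add]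

/-- The dihedral group of order twelve is `S₃ × ℤ / 2`. -/
theorem nonempty_dihedral_equiv_prod :
    Nonempty (DihedralGroup 6 ≃* Equiv.Perm (Fin 3) × Multiplicative (ZMod 2)) := by
  let ψ : DihedralGroup 6 →* Equiv.Perm (Fin 3) × Multiplicative (ZMod 2) :=
    -- A 3-cycle paired with the nontrivial element of `ℤ/2` has order 6, and the transposition
    -- inverts it.
    dihedralLift (finRotate 3, .ofAdd 1) (Equiv.swap 0 1, 1) (by decide) (by decide) (by decide)
  have hi : Function.Injective ψ := by
    rw [injective_iff_map_eq_one]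
    rintro (i | i)
    · change (finRotate 3, Multiplicative.ofAdd (1 : ZMod 2)) ^ i.val = 1 → _
      revert i
      decide
    · change (Equiv.swap 0 1, 1) * (finRotate 3, Multiplicative.ofAdd (1 : ZMod 2)) ^ i.val = 1 → _
      revert i
      decide
  refine ⟨MulEquiv.ofBijective ψ ((Fintype.bijective_iff_injective_and_card ψ).2 ⟨hi, ?_⟩)⟩
  rw [DihedralGroup.card, Fintype.card_prod, Fintype.card_perm, Fintype.card_fin,
    Fintype.card_multiplicative, ZMod.card]
  rfl

/-- The left action of `S₃` on parameters. -/
def permuteHom : Equiv.Perm (Fin 3) →* Equiv.Perm Params :=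
  -- Precomposition is a right action, hence the inverse.
  MonoidHom.mk' (fun σ => permute σ⁻¹) fun σ τ => by
    ext x i <;> simp [permute]

theorem reflect_mul_self (s : ℂ) (hs : s ≠ 0) : reflect s hs * reflect s hs = 1 :=
  Equiv.ext fun x => (reflect s hs).left_inv x

/-- The action of the group of order two on parameters. -/
noncomputable def reflectHom (s : ℂ) (hs : s ≠ 0) :
    Multiplicative (ZMod 2) →* Equiv.Perm Params :=
  MonoidHom.mk' (fun ε => if ε = 1 then 1 else reflect s hs) fun ε δ => by
    have h : ∀ ε δ : Multiplicative (ZMod 2), (ε = 1 ∧ ε * δ = δ) ∨ (δ = 1 ∧ ε * δ = ε) ∨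
        (ε ≠ 1 ∧ δ ≠ 1 ∧ ε * δ = 1) := by decide
    rcases h ε δ with ⟨rfl, h⟩ | ⟨rfl, h⟩ | ⟨h1, h2, h⟩
    · simp
    · simp
    · simp [h, h1, h2, reflect_mul_self]

theorem reflectExponent_comp (a : Fin 3 → ℕ) (σ : Equiv.Perm (Fin 3)) (i : Fin 3) :
    reflectExponent (a ∘ σ) i = reflectExponent a (σ i) := by
  simp only [reflectExponent, Function.comp_apply, Equiv.sum_comp σ fun j => (a j : ℤ)]

theorem commute_permute_reflect (s : ℂ) (hs : s ≠ 0) (σ : Equiv.Perm (Fin 3)) :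
    Commute (permute σ) (reflect s hs) := by
  refine Equiv.ext fun x => Params.ext rfl (funext fun i => ?_)
  change -(s ^ reflectExponent x.side (σ i) * x.root (σ i))⁻¹ =
    -(s ^ reflectExponent (x.side ∘ σ) i * x.root (σ i))⁻¹
  rw [reflectExponent_comp]

/-- The action of `S₃ × ℤ / 2` on parameters. -/
noncomputable def symmetryHom (s : ℂ) (hs : s ≠ 0) :
    Equiv.Perm (Fin 3) × Multiplicative (ZMod 2) →* Equiv.Perm Params :=
  MonoidHom.noncommCoprod permuteHom (reflectHom s hs) fun σ ε => by
    change Commute (permute σ⁻¹) (if ε = 1 then 1 else reflect s hs)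
    split_ifs
    · exact Commute.one_right _
    · exact commute_permute_reflect s hs σ⁻¹

theorem symmetryHom_apply (s : ℂ) (hs : s ≠ 0) (σ : Equiv.Perm (Fin 3))
    (ε : Multiplicative (ZMod 2)) :
    symmetryHom s hs (σ, ε) = permute σ⁻¹ * if ε = 1 then 1 else reflect s hs := rfl

theorem range_symmetryHom (s : ℂ) (hs : s ≠ 0) :
    (symmetryHom s hs).range = symmetryGroup s hs := by
  refine le_antisymm ?_ ((Subgroup.closure_le _).2 ?_)
  · rintro _ ⟨⟨σ, ε⟩, rfl⟩
    rw [symmetryHom_apply]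
    refine mul_mem (Subgroup.subset_closure (.inl ⟨σ⁻¹, rfl⟩)) ?_
    split_ifs
    · exact one_mem _
    · exact Subgroup.subset_closure (.inr rfl)
  · rintro _ (⟨σ, rfl⟩ | rfl)
    · exact ⟨(σ⁻¹, 1), by rw [symmetryHom_apply, if_pos rfl, inv_inv, mul_one]⟩
    · refine ⟨(1, .ofAdd 1), ?_⟩
      rw [symmetryHom_apply, if_neg (by decide)]
      rfl

/-- Two test points suffice. Distinct sides `0, 1, 2` detect the permutation, since the involution
fixes the sides; with all sides `0` and all roots `1`, the involution changes the roots to `-1`. -/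
theorem symmetryHom_injective (s : ℂ) (hs : s ≠ 0) : Function.Injective (symmetryHom s hs) := by
  rw [injective_iff_map_eq_one]
  rintro ⟨σ, ε⟩ h
  rw [symmetryHom_apply] at h
  have hσ : σ⁻¹ = 1 := by
    have h1 := congrArg Params.side (Equiv.congr_fun h ⟨Fin.val, fun _ => 1, by simp⟩)
    have h2 : ∀ x : Params, ((permute σ⁻¹ * if ε = 1 then 1 else reflect s hs) x).side =
        x.side ∘ (σ⁻¹ : Equiv.Perm (Fin 3)) := fun x => by split_ifs <;> rfl
    rw [h2] at h1
    exact Equiv.ext fun i => Fin.val_injective (congrFun h1 i)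
  have hε : ε = 1 := by
    by_contra hε
    have h1 := congrFun (congrArg Params.root
      (Equiv.congr_fun h ⟨fun _ => 0, fun _ => 1, by simp⟩)) 0
    rw [hσ, if_neg hε] at h1
    change -(s ^ reflectExponent (fun _ => 0) 0 * 1)⁻¹ = (1 : ℂ) at h1
    norm_num [reflectExponent] at h1
  rw [hε, inv_eq_one.1 hσ]
  rfl

theorem nonempty_symmetryGroup_equiv (s : ℂ) (hs : s ≠ 0) :
    Nonempty (symmetryGroup s hs ≃* Equiv.Perm (Fin 3) × Multiplicative (ZMod 2)) :=
  ⟨((MonoidHom.ofInjective (symmetryHom_injective s hs)).trans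
    (MulEquiv.subgroupCongr (range_symmetryHom s hs))).symm⟩

end EllipticHexagon

namespace EllipticHexagon

/-! ### Weighted sums over covers -/

/-- The lozenge of type `k` whose upper triangle has the edge `v`. -/
def lozengeOfUp (v : ℤ × ℤ) (k : Fin 3) : Lozenge :=
  (k, ![(v.1, v.2), (v.1, v.2 + 1), (v.1 - 1, v.2)] k)

/-- The lozenge of type `k` whose lower triangle has the edge `v`. -/
def lozengeOfDown (v : ℤ × ℤ) (k : Fin 3) : Lozenge :=
  (k, ![(v.1, v.2), (v.1 - 1, v.2), (v.1 - 1, v.2 - 1)] k)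

theorem upEdge_eq_iff (l : Lozenge) (v : ℤ × ℤ) : upEdge l = v ↔ l = lozengeOfUp v l.1 := by
  obtain ⟨k, b, c⟩ := l
  obtain ⟨x, y⟩ := v
  fin_cases k <;> simp [upEdge, lozengeOfUp] <;> omega

theorem downEdge_eq_iff (l : Lozenge) (v : ℤ × ℤ) : downEdge l = v ↔ l = lozengeOfDown v l.1 := by
  obtain ⟨k, b, c⟩ := l
  obtain ⟨x, y⟩ := v
  fin_cases k <;> simp [downEdge, lozengeOfDown] <;> omega

open Classical in
/-- The finite set of all covers. -/
noncomputable def covers (U D : Finset (ℤ × ℤ)) : Finset (Finset Lozenge) :=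
  ((U ×ˢ Finset.univ).image fun x => lozengeOfUp x.1 x.2).powerset.filter (IsCover U D)

theorem mem_covers {U D : Finset (ℤ × ℤ)} {T : Finset Lozenge} :
    T ∈ covers U D ↔ IsCover U D T := by
  simp only [covers, Finset.mem_filter, Finset.mem_powerset, and_iff_right_iff_imp]
  intro h l hl
  simp only [Finset.mem_image, Finset.mem_product, Finset.mem_univ, and_true]
  exact ⟨(upEdge l, l.1), (h.1 l hl).1, ((upEdge_eq_iff l _).1 rfl).symm⟩

/-- The bijection behind all expansions of cover sums: covers that contain `l` correspond to covers
of the region without the two triangles of `l`. -/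
theorem isCover_erase_iff {U D : Finset (ℤ × ℤ)} {T : Finset Lozenge} {l : Lozenge}
    (hu : upEdge l ∈ U) (hd : downEdge l ∈ D) :
    IsCover (U.erase (upEdge l)) (D.erase (downEdge l)) T ↔
      l ∉ T ∧ IsCover U D (insert l T) := by
  simp only [IsCover, Finset.mem_erase]
  constructor
  · rintro ⟨h1, h2, h3⟩
    refine ⟨fun hl => (h1 l hl).1.1 rfl, ?_, fun v hv => ?_, fun v hv => ?_⟩
    · simp only [Finset.mem_insert]
      rintro m (rfl | hm)
      · exact ⟨hu, hd⟩
      · exact ⟨(h1 m hm).1.2, (h1 m hm).2.2⟩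
    · rcases eq_or_ne v (upEdge l) with rfl | hne
      · refine ⟨l, ⟨Finset.mem_insert_self _ _, rfl⟩, ?_⟩
        rintro m ⟨hm, hml⟩
        rcases Finset.mem_insert.1 hm with rfl | hm
        · rfl
        · exact absurd hml (h1 m hm).1.1
      · obtain ⟨m, ⟨hm, hmv⟩, huniq⟩ := h2 v ⟨hne, hv⟩
        refine ⟨m, ⟨Finset.mem_insert_of_mem hm, hmv⟩, ?_⟩
        rintro n ⟨hn, hnv⟩
        rcases Finset.mem_insert.1 hn with rfl | hn
        · exact absurd hnv.symm hne
        · exact huniq n ⟨hn, hnv⟩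
    · rcases eq_or_ne v (downEdge l) with rfl | hne
      · refine ⟨l, ⟨Finset.mem_insert_self _ _, rfl⟩, ?_⟩
        rintro m ⟨hm, hml⟩
        rcases Finset.mem_insert.1 hm with rfl | hm
        · rfl
        · exact absurd hml (h1 m hm).2.1
      · obtain ⟨m, ⟨hm, hmv⟩, huniq⟩ := h3 v ⟨hne, hv⟩
        refine ⟨m, ⟨Finset.mem_insert_of_mem hm, hmv⟩, ?_⟩
        rintro n ⟨hn, hnv⟩
        rcases Finset.mem_insert.1 hn with rfl | hn
        · exact absurd hnv.symm hne
        · exact huniq n ⟨hn, hnv⟩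
  · rintro ⟨hl, h1, h2, h3⟩
    have hne {m : Lozenge} (hm : m ∈ T) : m ≠ l := by rintro rfl; exact hl hm
    refine ⟨fun m hm => ?_, fun v hv => ?_, fun v hv => ?_⟩
    · have hm' := Finset.mem_insert_of_mem (b := l) hm
      refine ⟨⟨fun h => hne hm ?_, (h1 m hm').1⟩, fun h => hne hm ?_, (h1 m hm').2⟩
      · exact (h2 _ hu).unique ⟨hm', h⟩ ⟨Finset.mem_insert_self _ _, rfl⟩
      · exact (h3 _ hd).unique ⟨hm', h⟩ ⟨Finset.mem_insert_self _ _, rfl⟩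
    · obtain ⟨m, ⟨hm, hmv⟩, huniq⟩ := h2 v hv.2
      refine ⟨m, ⟨?_, hmv⟩, fun n hn => huniq n ⟨Finset.mem_insert_of_mem hn.1, hn.2⟩⟩
      rcases Finset.mem_insert.1 hm with rfl | hm
      · exact absurd hmv.symm hv.1
      · exact hm
    · obtain ⟨m, ⟨hm, hmv⟩, huniq⟩ := h3 v hv.2
      refine ⟨m, ⟨?_, hmv⟩, fun n hn => huniq n ⟨Finset.mem_insert_of_mem hn.1, hn.2⟩⟩
      rcases Finset.mem_insert.1 hm with rfl | hm
      · exact absurd hmv.symm hv.1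
      · exact hm

/-- The sum over all covers of the products of the weights. -/
noncomputable def coverSum (ω : Lozenge → ℂ) (U D : Finset (ℤ × ℤ)) : ℂ :=
  ∑ T ∈ covers U D, ∏ l ∈ T, ω l

theorem coverSum_empty (ω : Lozenge → ℂ) : coverSum ω ∅ ∅ = 1 := by
  have h : covers ∅ ∅ = {∅} := by
    ext T
    rw [mem_covers, Finset.mem_singleton]
    constructor
    · intro h
      exact Finset.card_eq_zero.1 (by simpa using h.card_eq)
    · rintro rfl
      simp [IsCover]
  simp [coverSum, h]

/-- Here `f` lists the three lozenges that contain a chosen triangle; the covers are sorted by the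
one that is used. -/
theorem coverSum_eq_sum (ω : Lozenge → ℂ) (U D : Finset (ℤ × ℤ)) (f : Fin 3 → Lozenge)
    (hf : ∀ T, IsCover U D T → ∃! k, f k ∈ T) :
    coverSum ω U D = ∑ k, if upEdge (f k) ∈ U ∧ downEdge (f k) ∈ D then
      ω (f k) * coverSum ω (U.erase (upEdge (f k))) (D.erase (downEdge (f k))) else 0 := by
  have h1 : coverSum ω U D =
      ∑ T ∈ covers U D, ∑ k, if f k ∈ T then ∏ l ∈ T, ω l else 0 := by
    refine Finset.sum_congr rfl fun T hT => ?_
    obtain ⟨k, hk, hu⟩ := hf T (mem_covers.1 hT)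
    rw [Finset.sum_eq_single_of_mem k (Finset.mem_univ k) fun j _ hj =>
      if_neg fun h => hj (hu j h), if_pos hk]
  rw [h1, Finset.sum_comm]
  refine Finset.sum_congr rfl fun k _ => ?_
  generalize f k = l
  rw [← Finset.sum_filter]
  split_ifs with h
  · rw [coverSum, Finset.mul_sum]
    refine (Finset.sum_bij (fun T _ => insert l T) ?_ ?_ ?_ ?_).symm
    · intro T hT
      have := (isCover_erase_iff h.1 h.2).1 (mem_covers.1 hT)
      exact Finset.mem_filter.2 ⟨mem_covers.2 this.2, Finset.mem_insert_self _ _⟩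
    · intro T hT T' hT' hTT
      have h1 := ((isCover_erase_iff h.1 h.2).1 (mem_covers.1 hT)).1
      have h2 := ((isCover_erase_iff h.1 h.2).1 (mem_covers.1 hT')).1
      rw [← Finset.erase_insert h1, hTT, Finset.erase_insert h2]
    · intro T hT
      obtain ⟨hT, hl⟩ := Finset.mem_filter.1 hT
      refine ⟨T.erase l, mem_covers.2 ((isCover_erase_iff h.1 h.2).2
        ⟨Finset.notMem_erase _ _, ?_⟩), Finset.insert_erase hl⟩
      rw [Finset.insert_erase hl]
      exact mem_covers.1 hT
    · intro T hT
      exact (Finset.prod_insert ((isCover_erase_iff h.1 h.2).1 (mem_covers.1 hT)).1).symm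
  · refine Finset.sum_eq_zero fun T hT => ?_
    obtain ⟨hT, hl⟩ := Finset.mem_filter.1 hT
    exact absurd ((mem_covers.1 hT).1 l hl) h

/-- With the upper triangle at the same edge gone, type `0` is impossible. The two remaining types
are the two possible last steps of a path ending at this edge. -/
theorem coverSum_of_mem_down (ω : Lozenge → ℂ) {U D : Finset (ℤ × ℤ)} {b c : ℤ}
    (hD : (b, c) ∈ D) (hU : (b, c) ∉ U) :
    coverSum ω U D =
      (if (b - 1, c - 1) ∈ U then
        ω (1, (b - 1, c)) * coverSum ω (U.erase (b - 1, c - 1)) (D.erase (b, c)) else 0) +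
      if (b, c - 1) ∈ U then
        ω (2, (b - 1, c - 1)) * coverSum ω (U.erase (b, c - 1)) (D.erase (b, c)) else 0 := by
  have h := coverSum_eq_sum ω U D (lozengeOfDown (b, c)) fun T hT => by
    obtain ⟨l, ⟨hl, hlb⟩, hu⟩ := hT.2.2 _ hD
    refine ⟨l.1, by
      change lozengeOfDown (b, c) l.1 ∈ T
      rwa [← (downEdge_eq_iff l (b, c)).1 hlb], fun k hk => ?_⟩
    rw [← hu (lozengeOfDown (b, c) k) ⟨hk, (downEdge_eq_iff _ _).2 rfl⟩]
    rfl
  rw [h, Fin.sum_univ_three]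
  simp [lozengeOfDown, upEdge, downEdge, hD, hU]

/-- Both lower neighbors on the next line are gone, so the lozenge of type `0` is forced. -/
theorem coverSum_of_mem_up (ω : Lozenge → ℂ) {U D : Finset (ℤ × ℤ)} {b c : ℤ}
    (hU : (b, c) ∈ U) (hD : (b, c) ∈ D) (h1 : (b, c + 1) ∉ D) (h2 : (b + 1, c + 1) ∉ D) :
    coverSum ω U D = ω (0, (b, c)) * coverSum ω (U.erase (b, c)) (D.erase (b, c)) := by
  have h := coverSum_eq_sum ω U D (lozengeOfUp (b, c)) fun T hT => by
    obtain ⟨l, ⟨hl, hlb⟩, hu⟩ := hT.2.1 _ hU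
    refine ⟨l.1, by
      change lozengeOfUp (b, c) l.1 ∈ T
      rwa [← (upEdge_eq_iff l (b, c)).1 hlb], fun k hk => ?_⟩
    rw [← hu (lozengeOfUp (b, c) k) ⟨hk, (upEdge_eq_iff _ _).2 rfl⟩]
    rfl
  rw [h, Fin.sum_univ_three]
  simp [lozengeOfUp, upEdge, downEdge, hD, hU, h1, h2]

theorem coverSum_sdiff (ω : Lozenge → ℂ) {U D H : Finset (ℤ × ℤ)} (hU : H ⊆ U) (hD : H ⊆ D)
    (h1 : ∀ v ∈ H, (v.1, v.2 + 1) ∉ D) (h2 : ∀ v ∈ H, (v.1 + 1, v.2 + 1) ∉ D) :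
    coverSum ω U D = (∏ v ∈ H, ω (0, v)) * coverSum ω (U \ H) (D \ H) := by
  induction H using Finset.induction_on with
  | empty => simp
  | insert v H hv ih =>
    simp only [Finset.insert_subset_iff, Finset.forall_mem_insert] at hU hD h1 h2
    rw [ih hU.2 hD.2 h1.2 h2.2, coverSum_of_mem_up ω (b := v.1) (c := v.2)
      (Finset.mem_sdiff.2 ⟨hU.1, hv⟩) (Finset.mem_sdiff.2 ⟨hD.1, hv⟩)
      (fun h => h1.1 (Finset.mem_sdiff.1 h).1) (fun h => h2.1 (Finset.mem_sdiff.1 h).1),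
      Finset.prod_insert hv, Finset.sdiff_insert, Finset.sdiff_insert]
    ring

theorem partitionFunction_eq_coverSum (p s : ℂ) (a : Fin 3 → ℕ) (w : Fin 3 → ℂ) :
    partitionFunction p s a w = coverSum (lozengeWeight p s w) (upEdges a) (downEdges a) := by
  rw [partitionFunction, coverSum]
  congr 1
  ext T
  rw [mem_tilings_iff, isTiling_iff, mem_covers]

/-! ### Nonintersecting paths -/

/-- The weighted number of paths that start at `(b₀, c₀)` and reach `(b, c₀ + n)` after `n` steps;
the weights are divided by the weights of the lozenges of type `0` that a path replaces. -/
noncomputable def pathSum (ω : Lozenge → ℂ) (b₀ c₀ : ℤ) : ℕ → ℤ → ℂ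
  | 0, b => if b = b₀ then 1 else 0
  | n + 1, b => ω (1, (b - 1, c₀ + n + 1)) * (pathSum ω b₀ c₀ n (b - 1) / ω (0, (b - 1, c₀ + n))) +
      ω (2, (b - 1, c₀ + n)) * (pathSum ω b₀ c₀ n b / ω (0, (b, c₀ + n)))

/-- Each step changes the first coordinate by `0` or `1`. -/
theorem pathSum_eq_zero (ω : Lozenge → ℂ) (b₀ c₀ : ℤ) (n : ℕ) (b : ℤ)
    (h : b < b₀ ∨ b₀ + n < b) : pathSum ω b₀ c₀ n b = 0 := by
  induction n generalizing b with
  | zero => exact if_neg (by omega)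
  | succ n ih =>
    rw [pathSum, ih b (by omega), ih (b - 1) (by omega)]
    simp

section

variable (a : Fin 3 → ℕ) (n k : ℕ) (x : Fin (a 0) → ℤ)

/-- The upper triangles that remain when the paths with index less than `k` have been shortened
to length `n - 1`, and the others to length `n`. -/
noncomputable def remainingUp : Finset (ℤ × ℤ) := (hexagonEdges a).filter fun v =>
  v.2 + 1 < n - a 2 ∨ v.2 + 1 = n - a 2 ∧ ∀ i : Fin (a 0), (i : ℕ) < k → x i ≠ v.1

/-- The lower triangles that remain when the paths with index less than `k` have been shortened
to length `n - 1`, and the others to length `n`. -/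
noncomputable def remainingDown : Finset (ℤ × ℤ) := (hexagonEdges a).filter fun v =>
  -(a 2 : ℤ) < v.2 ∧ (v.2 < n - a 2 ∨ v.2 = n - a 2 ∧ ∃ i : Fin (a 0), k ≤ i ∧ x i = v.1)

end

/-- The rows of the determinant that describes an intermediate configuration. -/
noncomputable def pathMatrix (ω : Lozenge → ℂ) (a : Fin 3 → ℕ) (n k : ℕ) (x : Fin (a 0) → ℤ) :
    Matrix (Fin (a 0)) (Fin (a 0)) ℂ :=
  Matrix.of fun i j => if (i : ℕ) < k then
    pathSum ω (1 - a 2 + j) (-a 2) n (x i) / ω (0, (x i, -a 2 + n)) else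
    pathSum ω (1 - a 2 + j) (-a 2) (n + 1) (x i)

/-- The product of the weights of the lozenges of type `0` centered on the first `n` lines. -/
noncomputable def lineProd (ω : Lozenge → ℂ) (a : Fin 3 → ℕ) (n : ℕ) : ℂ :=
  ∏ v ∈ (hexagonEdges a).filter fun v => v.2 < (n : ℤ) - a 2, ω (0, v)

theorem strictMono_update_sub_one {m : ℕ} {x : Fin m → ℤ} (hx : StrictMono x) (k : Fin m)
    (hk : ∀ i < k, x i ≠ x k - 1) : StrictMono (Function.update x k (x k - 1)) := by
  intro i j hij
  rcases eq_or_ne i k with rfl | hi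
  · rw [Function.update_self, Function.update_of_ne hij.ne']
    have := hx hij
    omega
  · rw [Function.update_of_ne hi]
    rcases eq_or_ne j k with rfl | hj
    · rw [Function.update_self]
      have := hx hij
      have := hk i hij
      omega
    · rw [Function.update_of_ne hj]
      exact hx hij

/-- The `m` values must fill the interval. This fixes the paths on the first line of the hexagon,
which has exactly `a 0` edges. -/
theorem eq_of_strictMono {m : ℕ} {x : Fin m → ℤ} (hx : StrictMono x) {b : ℤ}
    (h : ∀ i, b ≤ x i ∧ x i < b + m) (i : Fin m) : x i = b + i := by
  have hlow : ∀ (k : ℕ) (hk : k < m), b + k ≤ x ⟨k, hk⟩ := by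
    intro k
    induction k with
    | zero => intro hk; simpa using (h ⟨0, hk⟩).1
    | succ k ih =>
      intro hk
      have h1 := ih (by omega)
      have h2 := hx (show (⟨k, by omega⟩ : Fin m) < ⟨k + 1, hk⟩ from Nat.lt_succ_self k)
      push_cast
      omega
  have hup : ∀ (d k : ℕ) (hk : k < m), k + d + 1 = m → x ⟨k, hk⟩ ≤ b + k := by
    intro d
    induction d with
    | zero => intro k hk hd; have := (h ⟨k, hk⟩).2; omega
    | succ d ih =>
      intro k hk hd
      have h1 := ih (k + 1) (by omega) (by omega)
      have h2 := hx (show (⟨k, hk⟩ : Fin m) < ⟨k + 1, by omega⟩ from Nat.lt_succ_self k)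
      push_cast at h1
      omega
  exact le_antisymm (hup (m - i - 1) i i.2 (by omega)) (hlow i i.2)

/-- All paths have been shortened: only lozenges of type `0` remain on the last line. -/
theorem coverSum_remaining_all {ω : Lozenge → ℂ} (hω : ∀ v, ω (0, v) ≠ 0) {a : Fin 3 → ℕ} (n : ℕ)
    (x : Fin (a 0) → ℤ) (hx : StrictMono x)
    (hmem : ∀ i, (x i, (n : ℤ) - a 2) ∈ hexagonEdges a)
    (ih : coverSum ω (remainingUp a n 0 x) (remainingDown a n 0 x) = lineProd ω a n *
      (Matrix.of fun i j : Fin (a 0) => pathSum ω (1 - a 2 + j) (-a 2) n (x i)).det) :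
    coverSum ω (remainingUp a (n + 1) (a 0) x) (remainingDown a (n + 1) (a 0) x) =
      lineProd ω a (n + 1) * (pathMatrix ω a n (a 0) x).det := by
  simp only [mem_hexagonEdges] at hmem
  -- On the first line the lower triangles lie outside the hexagon, so no type `0` lozenge may occur
  -- there; indeed every edge of that line is the start of a path.
  have h0 : n = 0 → ∀ b, (b, (n : ℤ) - a 2) ∈ hexagonEdges a → ∃ i, x i = b := by
    rintro rfl b hb
    rw [mem_hexagonEdges] at hb
    have h := eq_of_strictMono hx (b := 1 - a 2) fun i => by have := hmem i; omega
    refine ⟨⟨(b - 1 + a 2).toNat, by omega⟩, ?_⟩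
    rw [h]
    simp only
    omega
  -- The edges of the last line that no path crosses; their type `0` lozenges are forced.
  obtain ⟨H, hH⟩ : ∃ H, H = (hexagonEdges a).filter fun v => v.2 = (n : ℤ) - a 2 ∧
    ∀ i, x i ≠ v.1 := ⟨_, rfl⟩
  have hneg : ∀ v ∈ H, -(a 2 : ℤ) < v.2 := by
    rintro ⟨b, c⟩ hv
    simp only [hH, Finset.mem_filter] at hv
    obtain ⟨hv, rfl, hne⟩ := hv
    rcases Nat.eq_zero_or_pos n with h | h
    · obtain ⟨i, hi⟩ := h0 h b hv
      exact absurd hi (hne i)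
    · simp only
      omega
  have hUH : remainingUp a n 0 x = remainingUp a (n + 1) (a 0) x \ H := by
    ext ⟨b, c⟩
    have hB : (∀ i : Fin (a 0), (i : ℕ) < a 0 → x i ≠ b) ↔ ∀ i, x i ≠ b :=
      forall_congr' fun i => imp_iff_right i.2
    simp only [hH, remainingUp, Finset.mem_sdiff, Finset.mem_filter, hB, not_lt_zero,
      IsEmpty.forall_iff, implies_true, and_true]
    push_cast
    generalize ((b, c) ∈ hexagonEdges a) = E
    generalize (∀ i, x i ≠ b) = P
    grind
  have hDH : remainingDown a n 0 x = remainingDown a (n + 1) (a 0) x \ H := by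
    ext ⟨b, c⟩
    have hB : ¬∃ i : Fin (a 0), a 0 ≤ (i : ℕ) ∧ x i = b := by
      rintro ⟨i, hi, -⟩
      exact absurd i.2 (not_lt.2 hi)
    have hC : (∀ i, x i ≠ b) ↔ ¬∃ i, x i = b := by simp
    simp only [hH, remainingDown, Finset.mem_sdiff, Finset.mem_filter, hB, hC, zero_le, true_and]
    push_cast
    generalize ((b, c) ∈ hexagonEdges a) = E
    generalize (∃ i, x i = b) = P
    grind
  have hline : lineProd ω a (n + 1) =
      lineProd ω a n * ((∏ v ∈ H, ω (0, v)) * ∏ i, ω (0, (x i, -a 2 + n))) := by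
    have hX : ∏ i, ω (0, (x i, -a 2 + n)) =
        ∏ v ∈ Finset.univ.image fun i => (x i, (n : ℤ) - a 2), ω (0, v) := by
      rw [Finset.prod_image fun i _ j _ hij => hx.injective (Prod.mk.inj hij).1]
      simp only [neg_add_eq_sub]
    rw [hX, ← Finset.prod_union, lineProd, lineProd, ← Finset.prod_union]
    · congr 1
      ext ⟨b, c⟩
      simp only [hH, Finset.mem_union, Finset.mem_filter, Finset.mem_image, Finset.mem_univ,
        true_and, Prod.mk.injEq]
      push_cast
      constructor
      · rintro ⟨h1, h2⟩
        rcases lt_or_eq_of_le (show c ≤ n - a 2 by omega) with h | h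
        · exact .inl ⟨h1, h⟩
        · by_cases hb : ∃ i, x i = b
          · exact .inr (.inr (hb.imp fun i hi => ⟨hi, h.symm⟩))
          · exact .inr (.inl ⟨h1, h, fun i hi => hb ⟨i, hi⟩⟩)
      · rintro (⟨h1, h2⟩ | ⟨h1, h2, -⟩ | ⟨i, rfl, rfl⟩)
        · exact ⟨h1, by omega⟩
        · exact ⟨h1, by omega⟩
        · exact ⟨(mem_hexagonEdges _ _ _).2 (hmem i), by omega⟩
    · rw [Finset.disjoint_left]
      rintro ⟨b, c⟩ h1 h2
      simp only [hH, Finset.mem_union, Finset.mem_filter, Finset.mem_image, Finset.mem_univ,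
        true_and, Prod.mk.injEq] at h1 h2
      rcases h2 with ⟨-, h2, -⟩ | ⟨i, -, h2⟩ <;> omega
    · rw [Finset.disjoint_left]
      rintro ⟨b, c⟩ h1 h2
      simp only [hH, Finset.mem_filter, Finset.mem_image, Finset.mem_univ, true_and,
        Prod.mk.injEq] at h1 h2
      obtain ⟨i, hi, -⟩ := h2
      exact h1.2.2 i hi
  have hdet : (pathMatrix ω a n (a 0) x).det = (∏ i, (ω (0, (x i, -a 2 + n)))⁻¹) *
      (Matrix.of fun i j : Fin (a 0) => pathSum ω (1 - a 2 + j) (-a 2) n (x i)).det := by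
    rw [← Matrix.det_mul_column]
    congr 1
    ext i j
    simp only [pathMatrix, Matrix.of_apply, i.2, if_true]
    exact div_eq_inv_mul _ _
  have hprod : (∏ i, ω (0, (x i, -a 2 + n))) * ∏ i, (ω (0, (x i, -a 2 + n)))⁻¹ = 1 := by
    rw [← Finset.prod_mul_distrib]
    exact Finset.prod_eq_one fun i _ => mul_inv_cancel₀ (hω _)
  rw [coverSum_sdiff ω (H := H), ← hUH, ← hDH, ih, hline, hdet]
  · linear_combination -(∏ v ∈ H, ω (0, v)) * lineProd ω a n * (Matrix.of fun i j : Fin (a 0) =>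
      pathSum ω (1 - a 2 + j) (-a 2) n (x i)).det * hprod
  · rintro ⟨b, c⟩ hv
    simp only [hH, remainingUp, Finset.mem_filter] at hv ⊢
    exact ⟨hv.1, .inr ⟨by push_cast; omega, fun i _ => hv.2.2 i⟩⟩
  · rintro ⟨b, c⟩ hv
    have h1 := hneg _ hv
    simp only [hH, remainingDown, Finset.mem_filter] at hv ⊢
    exact ⟨hv.1, h1, .inl (by push_cast; omega)⟩
  all_goals
    rintro ⟨b, c⟩ hv hv'
    simp only [hH, remainingDown, Finset.mem_filter] at hv hv'
    rcases hv'.2.2 with h | ⟨-, i, hi, -⟩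
    · push_cast at h; omega
    · exact absurd i.2 (not_lt.2 hi)

/-- Removing the last lozenge of path `k` expands the cover sum into two terms. The recursion for
`pathSum` splits row `k` of the matrix in the same way, and the terms match by linearity of the
determinant in that row. -/
theorem coverSum_remaining_step {ω : Lozenge → ℂ} {a : Fin 3 → ℕ} (n : ℕ) (x : Fin (a 0) → ℤ)
    (hx : StrictMono x) (k : Fin (a 0))
    (hmem : ∀ i, (x i, (n : ℤ) + (if (i : ℕ) < k then 0 else 1) - a 2) ∈ hexagonEdges a)
    (ih : ∀ y : Fin (a 0) → ℤ, StrictMono y →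
      (∀ i, (y i, (n : ℤ) + (if (i : ℕ) < k + 1 then 0 else 1) - a 2) ∈ hexagonEdges a) →
      coverSum ω (remainingUp a (n + 1) (k + 1) y) (remainingDown a (n + 1) (k + 1) y) =
        lineProd ω a (n + 1) * (pathMatrix ω a n (k + 1) y).det) :
    coverSum ω (remainingUp a (n + 1) k x) (remainingDown a (n + 1) k x) =
      lineProd ω a (n + 1) * (pathMatrix ω a n k x).det := by
  have hk := hmem k
  rw [if_neg (lt_irrefl _), mem_hexagonEdges] at hk
  -- One term for each possible previous position `b` of path `k`; a forbidden move must give a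
  -- vanishing determinant.
  have key (b : ℤ) (hb : b = x k ∨ b = x k - 1) :
      (if (b, (n : ℤ) - a 2) ∈ remainingUp a (n + 1) k x then
        coverSum ω ((remainingUp a (n + 1) k x).erase (b, (n : ℤ) - a 2))
          ((remainingDown a (n + 1) k x).erase (x k, (n : ℤ) + 1 - a 2)) else 0) =
      lineProd ω a (n + 1) * ((pathMatrix ω a n k x).updateRow k fun j =>
        pathSum ω (1 - a 2 + j) (-a 2) n b / ω (0, (b, -a 2 + n))).det := by
    have hM : pathMatrix ω a n (k + 1) (Function.update x k b) =
        (pathMatrix ω a n k x).updateRow k fun j =>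
          pathSum ω (1 - a 2 + j) (-a 2) n b / ω (0, (b, -a 2 + n)) := by
      ext i j
      rcases eq_or_ne i k with rfl | hi
      · simp [pathMatrix]
      · have hi' : (i : ℕ) ≠ k := fun h => hi (Fin.ext h)
        have hlt : (i : ℕ) < k + 1 ↔ (i : ℕ) < k := by omega
        rw [Matrix.updateRow_ne hi]
        simp only [pathMatrix, Matrix.of_apply, Function.update_of_ne hi, hlt]
    split_ifs with h
    · simp only [remainingUp, Finset.mem_filter] at h
      have hne : ∀ i < k, x i ≠ b := fun i hi => by
        rcases h.2 with h | h
        · push_cast at h; omega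
        · exact h.2 i hi
      have hy : StrictMono (Function.update x k b) := by
        rcases hb with rfl | rfl
        · rwa [Function.update_eq_self]
        · exact strictMono_update_sub_one hx k hne
      rw [← hM, ← ih _ hy]
      · congr 1
        · ext ⟨b', c⟩
          simp only [remainingUp, Finset.mem_erase, Finset.mem_filter, ne_eq, Prod.mk.injEq]
          push_cast
          have hA : (∀ i : Fin (a 0), (i : ℕ) < k + 1 → Function.update x k b i ≠ b') ↔
              b ≠ b' ∧ ∀ i : Fin (a 0), (i : ℕ) < k → x i ≠ b' := by
            constructor
            · intro hi
              refine ⟨by simpa using hi k (Nat.lt_succ_self _), fun i hik => ?_⟩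
              have := hi i (by omega)
              rwa [Function.update_of_ne (by rintro rfl; omega)] at this
            · rintro ⟨h1, h2⟩ i hi
              rcases eq_or_ne i k with rfl | hik
              · rwa [Function.update_self]
              · rw [Function.update_of_ne hik]
                exact h2 i (by have : (i : ℕ) ≠ k := fun h => hik (Fin.ext h)
                               omega)
          have hA' := hA
          simp only [ne_eq] at hA'
          rw [hA', eq_comm (a := b)]
          generalize ((b', c) ∈ hexagonEdges a) = E
          generalize (∀ i : Fin (a 0), (i : ℕ) < k → ¬x i = b') = P
          grind
        · ext ⟨b', c⟩
          simp only [remainingDown, Finset.mem_erase, Finset.mem_filter, ne_eq, Prod.mk.injEq]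
          push_cast
          have hA : (∃ i : Fin (a 0), (k : ℕ) ≤ i ∧ x i = b') ↔
              x k = b' ∨ ∃ i : Fin (a 0), (k : ℕ) + 1 ≤ i ∧ Function.update x k b i = b' := by
            constructor
            · rintro ⟨i, hi, hib⟩
              rcases eq_or_ne i k with rfl | hik
              · exact .inl hib
              · have : (i : ℕ) ≠ k := fun h => hik (Fin.ext h)
                exact .inr ⟨i, by omega, by rwa [Function.update_of_ne hik]⟩
            · rintro (h | ⟨i, hi, hib⟩)
              · exact ⟨k, le_rfl, h⟩
              · rw [Function.update_of_ne (by rintro rfl; omega)] at hib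
                exact ⟨i, by omega, hib⟩
          have hB : (∃ i : Fin (a 0), (k : ℕ) + 1 ≤ i ∧ Function.update x k b i = b') →
              ¬x k = b' := by
            rintro ⟨i, hi, hib⟩ hkb
            rw [Function.update_of_ne (by rintro rfl; omega)] at hib
            have := hx (show k < i from Fin.lt_def.2 (by omega))
            omega
          rw [hA, eq_comm (a := b')]
          by_cases hE : (b', c) ∈ hexagonEdges a <;>
            by_cases hP : ∃ i : Fin (a 0), (k : ℕ) + 1 ≤ i ∧ Function.update x k b i = b' <;>
            simp only [hE, hP, forall_const, true_and, false_and, and_true, and_false,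
              or_false, or_true] at hB ⊢ <;> omega
      · intro i
        rcases eq_or_ne i k with rfl | hi
        · rw [Function.update_self, if_pos (Nat.lt_succ_self _), add_zero]
          exact h.1
        · have hi' : (i : ℕ) ≠ k := fun h => hi (Fin.ext h)
          have hlt : (i : ℕ) < k + 1 ↔ (i : ℕ) < k := by omega
          rw [Function.update_of_ne hi]
          simp only [hlt]
          exact hmem i
    -- If `b` is occupied by an earlier path, two rows coincide. If `b` is outside the hexagon, it
    -- is out of reach of every starting point and row `k` vanishes.
    · by_cases hE : (b, (n : ℤ) - a 2) ∈ hexagonEdges a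
      · obtain ⟨i, hi, hib⟩ : ∃ i : Fin (a 0), (i : ℕ) < k ∧ x i = b := by
          by_contra hcon
          push Not at hcon
          exact h (Finset.mem_filter.2 ⟨hE, .inr ⟨by push_cast; ring, hcon⟩⟩)
        have hik : i ≠ k := by rintro rfl; omega
        rw [Matrix.det_zero_of_row_eq hik, mul_zero]
        rw [Matrix.updateRow_self, Matrix.updateRow_ne hik]
        ext j
        simp only [pathMatrix, Matrix.of_apply, if_pos hi, hib]
      · rw [Matrix.det_eq_zero_of_row_eq_zero k, mul_zero]
        intro j
        rw [Matrix.updateRow_self, pathSum_eq_zero, zero_div]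
        rw [mem_hexagonEdges] at hE
        have := j.2
        omega
  have hrow : pathMatrix ω a n k x = (pathMatrix ω a n k x).updateRow k
      (ω (1, (x k - 1, -a 2 + n + 1)) • (fun j : Fin (a 0) =>
          pathSum ω (1 - a 2 + j) (-a 2) n (x k - 1) / ω (0, (x k - 1, -a 2 + n))) +
        ω (2, (x k - 1, -a 2 + n)) • fun j : Fin (a 0) =>
          pathSum ω (1 - a 2 + j) (-a 2) n (x k) / ω (0, (x k, -a 2 + n))) := by
    ext i j
    rcases eq_or_ne i k with rfl | hi
    · simp [pathMatrix, pathSum]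
    · rw [Matrix.updateRow_ne hi]
  rw [hrow, Matrix.det_updateRow_add, Matrix.det_updateRow_smul, Matrix.det_updateRow_smul,
    coverSum_of_mem_down ω (b := x k) (c := (n : ℤ) + 1 - a 2)]
  · have e : (n : ℤ) + 1 - a 2 - 1 = n - a 2 := by ring
    have e1 : -(a 2 : ℤ) + n + 1 = n + 1 - a 2 := by ring
    have e2 : -(a 2 : ℤ) + n = n - a 2 := by ring
    have k1 := key (x k) (.inl rfl)
    have k2 := key (x k - 1) (.inr rfl)
    rw [e, e1, mul_add, mul_left_comm, mul_left_comm (lineProd ω a (n + 1)), ← k1, ← k2, mul_ite,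
      mul_ite, mul_zero, mul_zero, e2]
  · refine Finset.mem_filter.2 ⟨(mem_hexagonEdges _ _ _).2 hk, by simp only; omega,
      .inr ⟨by push_cast; ring, k, le_rfl, rfl⟩⟩
  · simp only [remainingUp, Finset.mem_filter]
    push_cast
    omega

/-- The Lindström–Gessel–Viennot formula for paths of length `n`. The outer induction is on the
number of lines, the inner one on the number `d` of paths not yet shortened. -/
theorem coverSum_remaining {ω : Lozenge → ℂ} (hω : ∀ v, ω (0, v) ≠ 0) {a : Fin 3 → ℕ} (n : ℕ)
    (x : Fin (a 0) → ℤ) (hx : StrictMono x)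
    (hmem : ∀ i, (x i, (n : ℤ) - a 2) ∈ hexagonEdges a) :
    coverSum ω (remainingUp a n 0 x) (remainingDown a n 0 x) = lineProd ω a n *
      (Matrix.of fun i j : Fin (a 0) => pathSum ω (1 - a 2 + j) (-a 2) n (x i)).det := by
  induction n generalizing x with
  | zero =>
    have h1 : remainingUp a 0 0 x = ∅ := by
      rw [remainingUp, Finset.filter_eq_empty_iff]
      rintro ⟨b, c⟩ hv
      rw [mem_hexagonEdges] at hv
      push_cast
      omega
    have h2 : remainingDown a 0 0 x = ∅ := by
      rw [remainingDown, Finset.filter_eq_empty_iff]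
      rintro ⟨b, c⟩ hv
      push_cast
      omega
    have h3 : lineProd ω a 0 = 1 := by
      rw [lineProd, Finset.filter_eq_empty_iff.2, Finset.prod_empty]
      rintro ⟨b, c⟩ hv
      rw [mem_hexagonEdges] at hv
      push_cast
      omega
    have h4 : (Matrix.of fun i j : Fin (a 0) => pathSum ω (1 - a 2 + j) (-a 2) 0 (x i)) = 1 := by
      simp only [mem_hexagonEdges] at hmem
      have h := eq_of_strictMono hx (b := 1 - a 2) fun i => by have := hmem i; omega
      ext i j
      simp [pathSum, h, Matrix.one_apply, Fin.ext_iff]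
    rw [h1, h2, h3, h4, coverSum_empty, Matrix.det_one, mul_one]
  | succ n ih =>
    have key : ∀ d k : ℕ, k + d = a 0 → ∀ y : Fin (a 0) → ℤ, StrictMono y →
        (∀ i, (y i, (n : ℤ) + (if (i : ℕ) < k then 0 else 1) - a 2) ∈ hexagonEdges a) →
        coverSum ω (remainingUp a (n + 1) k y) (remainingDown a (n + 1) k y) =
          lineProd ω a (n + 1) * (pathMatrix ω a n k y).det := by
      intro d
      induction d with
      | zero =>
        intro k hk y hy hmem
        obtain rfl : k = a 0 := hk
        simp only [Fin.is_lt, if_true, add_zero] at hmem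
        exact coverSum_remaining_all hω n y hy hmem (ih y hy hmem)
      | succ d ihd =>
        intro k hk y hy hmem
        exact coverSum_remaining_step n y hy ⟨k, by omega⟩ hmem (ihd (k + 1) (by omega))
    have h := key (a 0) 0 (zero_add _) x hx (by simpa using hmem)
    rw [h]
    congr 2

/-- The partition function as a determinant. -/
theorem partitionFunction_eq_det {p s : ℂ} {a : Fin 3 → ℕ} {w : Fin 3 → ℂ}
    (hω : ∀ v, lozengeWeight p s w (0, v) ≠ 0) :
    partitionFunction p s a w = (∏ v ∈ upEdges a, lozengeWeight p s w (0, v)) *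
      (Matrix.of fun i j : Fin (a 0) =>
        pathSum (lozengeWeight p s w) (1 - a 2 + j) (-a 2) (a 1 + a 2) (1 + i)).det := by
  have h := coverSum_remaining hω (a := a) (a 1 + a 2) (fun i => 1 + i)
    (fun i j hij => by simpa using hij) fun i => by
      have := i.2
      rw [mem_hexagonEdges]
      push_cast
      omega
  have e : ((a 1 + a 2 : ℕ) : ℤ) - a 2 = a 1 := by push_cast; ring
  rw [lineProd, e] at h
  rw [partitionFunction_eq_coverSum, upEdges, ← h]
  congr 1
  · ext ⟨b, c⟩
    simp only [remainingUp, Finset.mem_filter, e, not_lt_zero, IsEmpty.forall_iff,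
      implies_true, and_true]
    exact and_congr_right fun _ => by omega
  · ext ⟨b, c⟩
    simp only [remainingDown, downEdges, Finset.mem_filter, e]
    refine and_congr_right fun hv => ?_
    rw [mem_hexagonEdges] at hv
    refine ⟨fun h => ⟨h, ?_⟩, fun h => h.1⟩
    rcases lt_or_eq_of_le hv.2.1.2 with hc | hc
    · exact .inl hc
    · exact .inr ⟨hc, ⟨(b - 1).toNat, by omega⟩, Nat.zero_le _, by simp only; omega⟩

end EllipticHexagon

namespace EllipticHexagon

/-! ### Determinants: condensation -/

open Matrix in
/-- Jacobi's identity for complementary minors. -/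
theorem det_mul_det_adjugate_block {m n R : Type*} [Fintype m] [Fintype n] [DecidableEq m]
    [DecidableEq n] [CommRing R] (M : Matrix (m ⊕ n) (m ⊕ n) R) :
    M.det * M.adjugate.toBlocks₁₁.det = M.det ^ Fintype.card m * M.toBlocks₂₂.det := by
  -- `M` times its adjugate is scalar, so replacing the second block column of the adjugate by that
  -- of the identity makes the product block triangular.
  have h : M * fromBlocks M.adjugate.toBlocks₁₁ 0 M.adjugate.toBlocks₂₁ 1 =
      fromBlocks (M.det • (1 : Matrix m m R)) M.toBlocks₁₂ 0 M.toBlocks₂₂ := by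
    have h1 : fromBlocks M.toBlocks₁₁ M.toBlocks₁₂ M.toBlocks₂₁ M.toBlocks₂₂ *
        fromBlocks M.adjugate.toBlocks₁₁ M.adjugate.toBlocks₁₂ M.adjugate.toBlocks₂₁
          M.adjugate.toBlocks₂₂ = fromBlocks (M.det • 1) 0 0 (M.det • 1) := by
      rw [fromBlocks_toBlocks, fromBlocks_toBlocks, mul_adjugate, ← fromBlocks_one,
        fromBlocks_smul, smul_zero, smul_zero]
    rw [fromBlocks_multiply, fromBlocks_inj] at h1
    nth_rw 1 [← fromBlocks_toBlocks M]
    rw [fromBlocks_multiply, h1.1, h1.2.2.1]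
    simp
  have h2 := congrArg det h
  rwa [det_mul, det_fromBlocks_zero₁₂, det_fromBlocks_zero₂₁, det_one, mul_one, det_smul, det_one,
    mul_one] at h2

/-- The indices `0` and `k + 1`, followed by the indices in between. -/
noncomputable def cornerEquiv (k : ℕ) : Fin 2 ⊕ Fin k ≃ Fin (k + 2) :=
  Equiv.ofBijective (Sum.elim ![0, Fin.last _] fun i => i.succ.castSucc) <| by
    rw [Fintype.bijective_iff_injective_and_card]
    refine ⟨Function.Injective.sumElim ?_ (fun i j h => by simpa using h) ?_, by simp [add_comm]⟩
    · intro i j h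
      fin_cases i <;> fin_cases j <;> simp_all [Fin.ext_iff]
    · intro i j h
      have := j.2
      fin_cases i <;> simp [Fin.ext_iff] at h
      omega

theorem det_condensation_of_ne_zero {R : Type*} [CommRing R] [IsDomain R] {k : ℕ}
    (M : Matrix (Fin (k + 2)) (Fin (k + 2)) R) (hM : M.det ≠ 0) :
    M.det * (M.submatrix (fun i : Fin k => i.succ.castSucc) fun i => i.succ.castSucc).det =
      (M.submatrix Fin.succ Fin.succ).det * (M.submatrix Fin.castSucc Fin.castSucc).det -
        (M.submatrix Fin.succ Fin.castSucc).det * (M.submatrix Fin.castSucc Fin.succ).det := by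
  have h := det_mul_det_adjugate_block (M.submatrix (cornerEquiv k) (cornerEquiv k))
  rw [Matrix.det_submatrix_equiv_self, Matrix.adjugate_submatrix_equiv_self, Fintype.card_fin,
    pow_two, mul_assoc] at h
  have h := mul_left_cancel₀ hM h
  have e22 : (M.submatrix (cornerEquiv k) (cornerEquiv k)).toBlocks₂₂ =
      M.submatrix (fun i : Fin k => i.succ.castSucc) fun i => i.succ.castSucc := rfl
  have hs : ((-1 : R) ^ (k + 1)) * (-1) ^ (k + 1) = 1 := by
    rw [← mul_pow]; simp
  rw [e22, Matrix.det_fin_two] at h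
  simp only [Matrix.toBlocks₁₁, Matrix.of_apply, Matrix.submatrix_apply, cornerEquiv,
    Equiv.ofBijective_apply, Sum.elim_inl, Matrix.cons_val_zero, Matrix.cons_val_one,
    Matrix.adjugate_fin_succ_eq_det_submatrix, Fin.val_zero, Fin.val_last, Fin.succAbove_zero,
    Fin.succAbove_last, pow_zero, one_mul, pow_add] at h
  rw [← h]
  linear_combination ((M.submatrix Fin.succ Fin.succ).det *
    (M.submatrix Fin.castSucc Fin.castSucc).det - (M.submatrix Fin.succ Fin.castSucc).det *
      (M.submatrix Fin.castSucc Fin.succ).det) * hs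

/-- Dodgson condensation. -/
theorem det_condensation {R : Type*} [CommRing R] {k : ℕ}
    (M : Matrix (Fin (k + 2)) (Fin (k + 2)) R) :
    M.det * (M.submatrix (fun i : Fin k => i.succ.castSucc) fun i => i.succ.castSucc).det =
      (M.submatrix Fin.succ Fin.succ).det * (M.submatrix Fin.castSucc Fin.castSucc).det -
        (M.submatrix Fin.succ Fin.castSucc).det * (M.submatrix Fin.castSucc Fin.succ).det := by
  -- The identity is specialized from the generic matrix, whose determinant is a nonzero element of
  -- a domain.
  let f : MvPolynomial (Fin (k + 2) × Fin (k + 2)) ℤ →+* R :=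
    MvPolynomial.eval₂Hom (Int.castRingHom R) fun i => M i.1 i.2
  have h := congrArg f (det_condensation_of_ne_zero
    (Matrix.mvPolynomialX (Fin (k + 2)) (Fin (k + 2)) ℤ) (Matrix.det_mvPolynomialX_ne_zero _ ℤ))
  have hf : f.mapMatrix (Matrix.mvPolynomialX (Fin (k + 2)) (Fin (k + 2)) ℤ) = M := by
    ext i j
    simp [f, Matrix.mvPolynomialX]
  simp only [map_mul, map_sub, RingHom.map_det, RingHom.mapMatrix_apply,
    ← Matrix.submatrix_map] at h hf
  rwa [hf] at h

/-! ### Antidifferences on `ℤ` -/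

theorem exists_int_recursion {X : Type*} [Nonempty X] (φ : ℤ → X ≃ X) :
    ∃ x : ℤ → X, ∀ e, x (e + 1) = φ e (x e) := by
  obtain ⟨x₀⟩ := ‹Nonempty X›
  let u (n : ℕ) : X := Nat.rec x₀ (fun k y => φ k y) n
  let d (n : ℕ) : X := Nat.rec x₀ (fun k y => (φ (-1 - k)).symm y) n
  refine ⟨fun e => if 0 ≤ e then u e.toNat else d (-e).toNat, fun e => ?_⟩
  rcases le_or_gt 0 e with h | h
  · obtain ⟨n, rfl⟩ := Int.eq_ofNat_of_zero_le h
    simp only [h, if_true, show (0 : ℤ) ≤ n + 1 by omega, show ((n : ℤ) + 1).toNat = n + 1 by omega,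
      Int.toNat_natCast]
    rfl
  · simp only
    obtain ⟨n, rfl⟩ : ∃ n : ℕ, e = -1 - n := ⟨(-1 - e).toNat, by omega⟩
    have h1 : (-(-1 - n : ℤ)).toNat = n + 1 := by omega
    have h2 : (if (0 : ℤ) ≤ -1 - n + 1 then u (-1 - n + 1 : ℤ).toNat
        else d (-(-1 - n + 1 : ℤ)).toNat) = d n := by
      rcases Nat.eq_zero_or_pos n with rfl | hn
      · simp [u, d]
      · rw [if_neg (by omega), show (-(-1 - n + 1 : ℤ)).toNat = n by omega]
    rw [h2, if_neg (not_le.2 h), h1]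
    exact ((φ (-1 - n)).apply_symm_apply (d n)).symm

/-- Solutions of `g (e + 1) = f e * g e`. -/
theorem exists_antidifference {f : ℤ → ℂ} (hf : ∀ e, f e ≠ 0) :
    ∃ g : ℤ → ℂ, (∀ e, g e ≠ 0) ∧ ∀ e, g (e + 1) = f e * g e := by
  obtain ⟨g, hg⟩ := exists_int_recursion fun e => Equiv.mulLeft (Units.mk0 (f e) (hf e))
  exact ⟨fun e => g e, fun e => (g e).ne_zero, fun e => by simp [hg]⟩

/-- A solution of `G (e + 2) * G e = f e * G (e + 1) ^ 2`. -/
structure BoxPotential (f : ℤ → ℂ) where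
  G : ℤ → ℂ
  ne_zero : ∀ e, G e ≠ 0
  eq_div : ∀ e, f e = G (e + 2) * G e / G (e + 1) ^ 2

theorem nonempty_boxPotential {f : ℤ → ℂ} (hf : ∀ e, f e ≠ 0) : Nonempty (BoxPotential f) := by
  obtain ⟨g, hg, h⟩ := exists_antidifference hf
  obtain ⟨G, hG, h'⟩ := exists_antidifference hg
  refine ⟨G, hG, fun e => ?_⟩
  rw [show e + 2 = e + 1 + 1 by ring, h' (e + 1), h e, h' e]
  have := hG e
  have := hg e
  field_simp

/-- A solution of `v (e + 1) * v (e - 2) * f (e + 1) = v e * v (e - 1)`. -/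
structure EdgePotential (f : ℤ → ℂ) where
  v : ℤ → ℂ
  ne_zero : ∀ e, v e ≠ 0
  eq_div : ∀ e, f e = v (e - 1) * v (e - 2) / (v e * v (e - 3))

/-- In terms of the backward shift `T`, the operator to invert is, up to sign, `(1 - T)(1 - T²) = (1
- T)²(1 + T)`. Its factors are inverted successively: `g` and `v` undo the differences, and `r (e +
1) * r e = g e` undoes `1 + T`. -/
theorem nonempty_edgePotential {f : ℤ → ℂ} (hf : ∀ e, f e ≠ 0) : Nonempty (EdgePotential f) := by
  obtain ⟨g, hg, h⟩ := exists_antidifference (f := fun e => (f (e + 3))⁻¹)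
    fun e => inv_ne_zero (hf _)
  obtain ⟨r, hr⟩ := exists_int_recursion fun e => Equiv.divLeft (Units.mk0 (g e) (hg e))
  have hr' (e : ℤ) : (r (e + 1) : ℂ) = g e / r e := by rw [hr]; simp
  obtain ⟨v, hv, h'⟩ := exists_antidifference (f := fun e => (r e : ℂ)) fun e => (r e).ne_zero
  refine ⟨v, hv, fun e => ?_⟩
  have h1 := hr' (e - 3 + 1)
  rw [hr' (e - 3), h (e - 3)] at h1
  ring_nf at h1
  have h2 := h' (e - 1)
  have h3 := h' (e - 3)
  ring_nf at h2 h3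
  ring_nf
  have := hf e
  have := hg (-3 + e)
  have := hv (-3 + e)
  have := hv (-1 + e)
  have := (r (-3 + e)).ne_zero
  rw [h2, h3, h1]
  field_simp

end EllipticHexagon

namespace EllipticHexagon

variable {p s : ℂ}

/-! ### The two instances of the addition formula -/

theorem oddTheta_zpow_neg (hp : ‖p‖ < 1) (hs : s ≠ 0) (e : ℤ) :
    oddTheta p (s ^ (-e)) = -oddTheta p (s ^ e) := by
  rw [zpow_neg, oddTheta_inv hp (zpow_ne_zero e hs)]

/-- The three-term relation to which Dodgson condensation reduces once common factors of the minors
are cancelled. -/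
theorem condensation_identity (hp : ‖p‖ < 1) (hs : s ≠ 0) {u : ℂ} (hu : u ≠ 0) (α β γ : ℤ) :
    oddTheta p (s ^ (α + β + γ - 1)) * oddTheta p (s ^ (α - 1)) *
        (oddTheta p (s ^ (β - α) * u) * oddTheta p (s ^ (γ - α) * u)) =
      oddTheta p (s ^ (α + β - 1)) * oddTheta p (s ^ (α + γ - 1)) *
        (oddTheta p (s ^ (β + γ - α) * u) * oddTheta p (s ^ (-α) * u)) -
      oddTheta p (s ^ β) * oddTheta p (s ^ γ) *
        (oddTheta p (s ^ (β + γ - 1) * u) * oddTheta p (s ^ (1 - 2 * α) * u)) := by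
  -- A square root of `s` is needed because the arguments of the addition formula are half sums and
  -- half differences of the exponents.
  obtain ⟨r, rfl⟩ := IsAlgClosed.exists_pow_nat_eq s zero_lt_two
  have hr : r ≠ 0 := fun h => hs (by simp [h])
  have hz (m n e : ℤ) (h : m + n = 2 * e) : r ^ m * r ^ n = (r ^ 2) ^ e := by
    rw [← zpow_natCast, ← zpow_mul, ← zpow_add₀ hr, h]; rfl
  have hd (m n e : ℤ) (h : m - n = 2 * e) : r ^ m / r ^ n = (r ^ 2) ^ e := by
    rw [← zpow_natCast, ← zpow_mul, ← zpow_sub₀ hr, h]; rfl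
  have h := oddTheta_addition hp (mul_ne_zero (zpow_ne_zero (β + γ - 2 * α) hr) hu)
    (zpow_ne_zero (β - γ) hr) (zpow_ne_zero (β + γ) hr) (zpow_ne_zero (β + γ + 2 * α - 2) hr)
  simp only [mul_right_comm _ u, mul_div_right_comm _ u] at h
  rw [hz _ _ (β - α) (by ring), hd _ _ (γ - α) (by ring), hz _ _ (α + β + γ - 1) (by ring),
    hd _ _ (-(α - 1)) (by ring), hz _ _ (β + γ - α) (by ring), hd _ _ (-α) (by ring),
    hz _ _ (α + β - 1) (by ring), hd _ _ (α + γ - 1) (by ring), hz _ _ (β + γ - 1) (by ring),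
    hd _ _ (1 - 2 * α) (by ring), hz _ _ β (by ring), hd _ _ (-γ) (by ring),
    oddTheta_zpow_neg hp hs, oddTheta_zpow_neg hp hs γ] at h
  linear_combination -h

/-- The three-term relation behind the recursion for a single path. Its terms come from the total
and from the two possible last steps. -/
theorem path_identity (hp : ‖p‖ < 1) (hs : s ≠ 0) {u₀ u₁ u₂ : ℂ}
    (h₀ : u₀ ≠ 0) (h₁ : u₁ ≠ 0) (h₂ : u₀ * u₁ * u₂ = 1 ∨ u₀ * u₁ * u₂ = -1) (β γ : ℤ) :
    oddTheta p (s ^ (β + γ)) * oddTheta p (s ^ (β - γ + 1) * u₀) * oddTheta p (s ^ (-(β + γ)) * u₁) *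
        oddTheta p (s ^ (β + γ - 1) * u₂) =
      oddTheta p (s ^ γ) * oddTheta p (s ^ (1 - γ) * u₀) * oddTheta p (s ^ (-2 * β - γ) * u₁) *
        oddTheta p (s ^ (γ - 1) * u₂) +
      oddTheta p (s ^ β) * oddTheta p (s ^ (β + 1) * u₀) * oddTheta p (s ^ (-β) * u₁) *
        oddTheta p (s ^ (2 * γ + β - 1) * u₂) := by
  -- `u₂` is eliminated through the product condition. Both signs are covered because `ε` is a
  -- common factor of all three terms.
  obtain ⟨ε, hε⟩ : ∃ ε : ℂ, ∀ e : ℤ, oddTheta p (s ^ e * u₂) =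
      ε * oddTheta p (s ^ (-e) * (u₀ * u₁)) := by
    have h (e : ℤ) : oddTheta p (s ^ e * (u₀ * u₁)⁻¹) = -oddTheta p (s ^ (-e) * (u₀ * u₁)) := by
      rw [← oddTheta_inv hp (mul_ne_zero (zpow_ne_zero _ hs) (mul_ne_zero h₀ h₁)), mul_inv _ (u₀ * u₁),
        zpow_neg, inv_inv]
    rcases h₂ with h₂ | h₂
    · refine ⟨-1, fun e => ?_⟩
      rw [← eq_inv_of_mul_eq_one_right h₂] at h
      rw [h, neg_one_mul]
    · refine ⟨1, fun e => ?_⟩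
      have h3 : -u₂ = (u₀ * u₁)⁻¹ := eq_inv_of_mul_eq_one_right (by rw [mul_neg, h₂, neg_neg])
      have h4 := h e
      rw [← h3, mul_neg, oddTheta_neg, neg_inj] at h4
      rw [h4, one_mul]
  obtain ⟨z, hz⟩ := IsAlgClosed.exists_pow_nat_eq (u₀ * s) zero_lt_two
  have hz0 : z ≠ 0 := fun h => mul_ne_zero h₀ hs (by rw [← hz, h]; simp)
  have h := oddTheta_addition hp
    (mul_ne_zero (mul_ne_zero hz0 h₁) (zpow_ne_zero (-(β + γ)) hs)) hz0
    (mul_ne_zero hz0 (zpow_ne_zero β hs)) (mul_ne_zero hz0 (zpow_ne_zero (-γ) hs))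
  have hβ := zpow_ne_zero β hs
  have hγ := zpow_ne_zero γ hs
  have e1 : z * u₁ * s ^ (-(β + γ)) * z = s ^ (-(β + γ - 1)) * (u₀ * u₁) := by
    rw [neg_sub, sub_eq_add_neg, zpow_add₀ hs 1, zpow_one]
    linear_combination u₁ * s ^ (-(β + γ)) * hz
  have e2 : z * u₁ * s ^ (-(β + γ)) / z = s ^ (-(β + γ)) * u₁ := by field_simp
  have e3 : z * s ^ β * (z * s ^ (-γ)) = s ^ (β - γ + 1) * u₀ := by
    rw [zpow_add₀ hs, sub_eq_add_neg, zpow_add₀ hs, zpow_one]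
    linear_combination s ^ β * s ^ (-γ) * hz
  have e4 : z * s ^ β / (z * s ^ (-γ)) = s ^ (β + γ) := by
    rw [zpow_add₀ hs, zpow_neg]; field_simp
  have e5 : z * u₁ * s ^ (-(β + γ)) * (z * s ^ β) = s ^ (-(γ - 1)) * (u₀ * u₁) := by
    rw [neg_sub, show 1 - γ = 1 + -(β + γ) + β by ring, zpow_add₀ hs, zpow_add₀ hs 1, zpow_one]
    linear_combination u₁ * s ^ (-(β + γ)) * s ^ β * hz
  have e6 : z * u₁ * s ^ (-(β + γ)) / (z * s ^ β) = s ^ (-2 * β - γ) * u₁ := by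
    rw [show -2 * β - γ = -(β + γ) - β by ring, zpow_sub₀ hs]; field_simp
  have e7 : z * s ^ (-γ) * z = s ^ (1 - γ) * u₀ := by
    rw [sub_eq_add_neg, zpow_add₀ hs, zpow_one]
    linear_combination s ^ (-γ) * hz
  have e8 : z * s ^ (-γ) / z = s ^ (-γ) := by field_simp
  have e9 : z * u₁ * s ^ (-(β + γ)) * (z * s ^ (-γ)) = s ^ (-(2 * γ + β - 1)) * (u₀ * u₁) := by
    rw [show -(2 * γ + β - 1) = 1 + -(β + γ) + -γ by ring, zpow_add₀ hs, zpow_add₀ hs 1, zpow_one]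
    linear_combination u₁ * s ^ (-(β + γ)) * s ^ (-γ) * hz
  have e10 : z * u₁ * s ^ (-(β + γ)) / (z * s ^ (-γ)) = s ^ (-β) * u₁ := by
    rw [show -β = -(β + γ) - -γ by ring, zpow_sub₀ hs]
    have := zpow_ne_zero (-γ) hs
    field_simp
  have e11 : z * (z * s ^ β) = s ^ (β + 1) * u₀ := by
    rw [zpow_add₀ hs, zpow_one]
    linear_combination s ^ β * hz
  have e12 : z / (z * s ^ β) = s ^ (-β) := by rw [zpow_neg]; field_simp
  rw [e1, e2, e3, e4, e5, e6, e7, e8, e9, e10, e11, e12, oddTheta_zpow_neg hp hs γ,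
    oddTheta_zpow_neg hp hs β] at h
  rw [hε, hε, hε]
  linear_combination ε * h

/-! ### The closed form of the path determinant -/

/-- The closed form of the path determinant, in terms of potentials. -/
noncomputable def closedDet {f₀ f₁ f₂ g : ℤ → ℂ} (V : EdgePotential f₀) (A : BoxPotential f₁)
    (B : BoxPotential f₂) (C : BoxPotential g) (δ₀ δ₁ δ₂ k β γ : ℤ) : ℂ :=
  C.G (1 + k + β + γ) * C.G (1 + γ) / (C.G (1 + γ + k) * C.G (1 + γ + β)) *
    (C.G (1 + k) * C.G (1 + β) / (C.G (1 + k + β) * C.G 1)) *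
  (A.G (δ₁ + 1 - β + k + γ) * A.G (δ₁ + 1 - β) / (A.G (δ₁ + 1 - β + k) * A.G (δ₁ + 1 - β + γ))) *
  (B.G (δ₂ + 1 - γ + k + β) * B.G (δ₂ + 1 - γ) / (B.G (δ₂ + 1 - γ + k) * B.G (δ₂ + 1 - γ + β))) *
  (V.v (δ₀ + β - k - 1) * V.v (δ₀ + β - k - 2) * V.v (δ₀ + γ - k - 1) * V.v (δ₀ + γ - k - 2) /
    (V.v (δ₀ + β + γ - k - 1) * V.v (δ₀ + β + γ - k - 2) * V.v (δ₀ - k - 1) * V.v (δ₀ - k - 2))) *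
  (V.v (δ₀ - 2 * k - 1) * V.v (δ₀ - 2 * k - 2) * V.v (δ₀ + β + γ - 2) * V.v (δ₀ + β + γ - 1) /
    (V.v (δ₀ + γ - 2 * k - 1) * V.v (δ₀ + β - 2 * k - 2) * V.v (δ₀ + γ - 2) * V.v (δ₀ + β - 1)))

section

variable {f₀ f₁ f₂ g : ℤ → ℂ} (V : EdgePotential f₀) (A : BoxPotential f₁)
    (B : BoxPotential f₂) (C : BoxPotential g) (δ₀ δ₁ δ₂ k β γ : ℤ)

theorem closedDet_ne_zero : closedDet V A B C δ₀ δ₁ δ₂ k β γ ≠ 0 := by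
  simp [closedDet, V.ne_zero, A.ne_zero, B.ne_zero, C.ne_zero]

theorem closedDet_zero : closedDet V A B C δ₀ δ₁ δ₂ 0 β γ = 1 := by
  have h0 := V.ne_zero
  have h1 := A.ne_zero
  have h2 := B.ne_zero
  have h3 := C.ne_zero
  simp only [closedDet]
  ring_nf
  field_simp [h0, h1, h2, h3]

/-- The ratio of two of the three products in the condensation identity, with all potentials
cancelled except those forming a few theta factors. -/
theorem closedDet_diagonal :
    closedDet V A B C (δ₀ - 2) (δ₁ + 1) (δ₂ + 1) (k + 1) β γ * closedDet V A B C δ₀ δ₁ δ₂ (k + 1) β γ *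
        (g (k + β + γ + 1) * g (k + 1) * (f₀ (δ₀ + β - k - 2) * f₀ (δ₀ + γ - k - 2))) =
      closedDet V A B C δ₀ δ₁ δ₂ (k + 2) β γ * closedDet V A B C (δ₀ - 2) (δ₁ + 1) (δ₂ + 1) k β γ *
        (g (k + β + 1) * g (k + γ + 1) * (f₀ (δ₀ + β + γ - k - 2) * f₀ (δ₀ - k - 2))) := by
  have h0 := V.ne_zero
  have h1 := A.ne_zero
  have h2 := B.ne_zero
  have h3 := C.ne_zero
  simp only [closedDet, V.eq_div, C.eq_div]
  ring_nf
  field_simp [h0, h1, h2, h3]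

/-- The mixed minors pair shifted starts with unshifted ends, or conversely. They are path
determinants of hexagons with `(β, γ)` replaced by `(β - 1, γ + 1)` and `(β + 1, γ - 1)`. -/
theorem closedDet_antidiagonal :
    closedDet V A B C (δ₀ - 1) (δ₁ - 1) (δ₂ + 2) (k + 1) (β - 1) (γ + 1) *
        closedDet V A B C (δ₀ - 1) (δ₁ + 2) (δ₂ - 1) (k + 1) (β + 1) (γ - 1) *
        (g (k + β + γ + 1) * g (k + 1) * (f₀ (δ₀ + β - k - 2) * f₀ (δ₀ + γ - k - 2))) =
      closedDet V A B C δ₀ δ₁ δ₂ (k + 2) β γ * closedDet V A B C (δ₀ - 2) (δ₁ + 1) (δ₂ + 1) k β γ *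
        (g β * g γ * (f₀ (δ₀ + β + γ - 1) * f₀ (δ₀ - 2 * k - 3))) := by
  have h0 := V.ne_zero
  have h1 := A.ne_zero
  have h2 := B.ne_zero
  have h3 := C.ne_zero
  simp only [closedDet, V.eq_div, C.eq_div]
  ring_nf
  field_simp [h0, h1, h2, h3]

theorem closedDet_step_one (d d₁ d₂ : ℤ) :
    closedDet V A B C (d + 2 - (γ - 1)) (d₁ - (γ - 1) - 1) (d₂ + 2 * (γ - 1) - 1) 1 β (γ - 1) *
        (g (β + γ) * f₀ (d + (β - γ + 1)) * f₁ (d₁ + -(β + γ)) * f₂ (d₂ + (β + γ - 1))) =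
      closedDet V A B C (d + 2 - γ) (d₁ - γ - 1) (d₂ + 2 * γ - 1) 1 β γ *
        (g γ * f₀ (d + (1 - γ)) * f₂ (d₂ + (γ - 1))) * f₀ (d + β - γ + 2) := by
  have h0 := V.ne_zero
  have h1 := A.ne_zero
  have h2 := B.ne_zero
  have h3 := C.ne_zero
  simp only [closedDet, V.eq_div, A.eq_div, B.eq_div, C.eq_div]
  ring_nf
  field_simp [h0, h1, h2, h3]

theorem closedDet_step_two (d d₁ d₂ : ℤ) :
    closedDet V A B C (d + 2 - γ) (d₁ - γ - 1) (d₂ + 2 * γ - 1) 1 (β - 1) γ *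
        (g (β + γ) * f₀ (d + (β - γ + 1)) * f₁ (d₁ + -(β + γ)) * f₂ (d₂ + (β + γ - 1))) =
      closedDet V A B C (d + 2 - γ) (d₁ - γ - 1) (d₂ + 2 * γ - 1) 1 β γ *
        (g β * f₀ (d + (β + 1)) * f₁ (d₁ + -β)) * f₀ (d + β - γ) := by
  have h0 := V.ne_zero
  have h1 := A.ne_zero
  have h2 := B.ne_zero
  have h3 := C.ne_zero
  simp only [closedDet, V.eq_div, A.eq_div, B.eq_div, C.eq_div]
  ring_nf
  field_simp [h0, h1, h2, h3]

theorem closedDet_one_zero_zero : closedDet V A B C δ₀ δ₁ δ₂ 1 0 0 = 1 := by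
  have h0 := V.ne_zero
  have h1 := A.ne_zero
  have h2 := B.ne_zero
  have h3 := C.ne_zero
  simp only [closedDet]
  ring_nf
  field_simp [h0, h1, h2, h3]

end

/-- The theta factors of the closed formula. -/
noncomputable def factor (p s : ℂ) (w : Fin 3 → ℂ) (k : Fin 3) (e : ℤ) : ℂ := oddTheta p (s ^ e * w k)

/-- The elliptic number `[e]`, with `[0]` replaced by `1`. -/
noncomputable def bracket (p s : ℂ) (e : ℤ) : ℂ := if e = 0 then 1 else oddTheta p (s ^ e)

theorem bracket_of_ne_zero {e : ℤ} (he : e ≠ 0) : bracket p s e = oddTheta p (s ^ e) := if_neg he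

theorem lozengeWeight_eq_factor (w : Fin 3 → ℂ) (k : Fin 3) (b c : ℤ) :
    lozengeWeight p s w (k, (b, c)) = factor p s w k (b + c + 1 - 3 * ![b, c, 0] k) := rfl

/-- The parameters are generic: no theta function vanishes except for the elliptic number `[0]`. -/
structure IsGeneric (p s : ℂ) (w : Fin 3 → ℂ) : Prop where
  elliptic_ne_zero : ∀ e : ℤ, e ≠ 0 → oddTheta p (s ^ e) ≠ 0
  factor_ne_zero : ∀ k e, factor p s w k e ≠ 0

theorem IsGeneric.bracket_ne_zero {w : Fin 3 → ℂ} (h : IsGeneric p s w) (e : ℤ) :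
    bracket p s e ≠ 0 := by
  rw [bracket]
  split_ifs with he
  exacts [one_ne_zero, h.elliptic_ne_zero e he]

section

variable {w : Fin 3 → ℂ} (V : EdgePotential (factor p s w 0)) (A : BoxPotential (factor p s w 1))
  (B : BoxPotential (factor p s w 2)) (C : BoxPotential (bracket p s))

/-- Induction on the length; here `γ` is the number of steps of type `1` and `n - γ` the number of
type `2`. The recursion becomes `path_identity` after clearing denominators. -/
theorem pathSum_eq_closedDet (hp : ‖p‖ < 1) (hs : s ≠ 0)
    (hw : w 0 * w 1 * w 2 = 1 ∨ w 0 * w 1 * w 2 = -1) (hg : IsGeneric p s w) (b c : ℤ) (n γ : ℕ)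
    (h : γ ≤ n) :
    pathSum (lozengeWeight p s w) b c n (b + γ) =
      closedDet V A B C (c - 2 * b + 2 - γ) (b - 2 * c - γ - 1) (b + c + 2 * γ - 1) 1 (n - γ) γ := by
  have hw0 : w 0 ≠ 0 := by rintro h; simp [h] at hw
  have hw1 : w 1 ≠ 0 := by rintro h; simp [h] at hw
  have hw2 : w 2 ≠ 0 := by rintro h; simp [h] at hw
  have hw' (m n k : ℤ) (h : m + n + k = 0) :
      s ^ m * w 0 * (s ^ n * w 1) * (s ^ k * w 2) = w 0 * w 1 * w 2 := by
    have : s ^ m * s ^ n * s ^ k = 1 := by rw [← zpow_add₀ hs, ← zpow_add₀ hs, h, zpow_zero]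
    linear_combination (w 0 * w 1 * w 2) * this
  induction n generalizing γ with
  | zero =>
    obtain rfl : γ = 0 := by omega
    simp [pathSum, closedDet_one_zero_zero]
  | succ n ih =>
    obtain ⟨β, hβ⟩ : ∃ β : ℤ, β = n + 1 - γ := ⟨_, rfl⟩
    have hid := path_identity hp hs (u₀ := s ^ (c - 2 * b) * w 0) (u₁ := s ^ (b - 2 * c) * w 1)
      (u₂ := s ^ (b + c) * w 2) (mul_ne_zero (zpow_ne_zero _ hs) hw0)
      (mul_ne_zero (zpow_ne_zero _ hs) hw1) (by rwa [hw' _ _ _ (by ring)]) β γ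
    simp only [← mul_assoc, ← zpow_add₀ hs] at hid
    have hf (k : Fin 3) (e : ℤ) : oddTheta p (s ^ e * w k) = factor p s w k e := rfl
    have hσ : (β : ℤ) + γ ≠ 0 := by omega
    rw [← bracket_of_ne_zero hσ] at hid
    simp only [hf, add_comm _ (c - 2 * b), add_comm _ (b - 2 * c), add_comm _ (b + c)] at hid
    have hden : bracket p s (β + γ) * factor p s w 0 (c - 2 * b + (β - γ + 1)) *
        factor p s w 1 (b - 2 * c + -(β + γ)) * factor p s w 2 (b + c + (β + γ - 1)) ≠ 0 := by
      simp [hg.factor_ne_zero, hg.bracket_ne_zero]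
    refine mul_right_cancel₀ hden ?_
    -- For `γ = 0` both sides vanish: the predecessor is out of reach, and the true theta value
    -- `[0]` is zero. This is why `oddTheta` and not `bracket` stands on the right.
    have t1 : pathSum (lozengeWeight p s w) b c n (b + γ - 1) /
          lozengeWeight p s w (0, (b + γ - 1, c + n)) *
        (bracket p s (β + γ) * factor p s w 0 (c - 2 * b + (β - γ + 1)) *
          factor p s w 1 (b - 2 * c + -(β + γ)) * factor p s w 2 (b + c + (β + γ - 1))) =
        closedDet V A B C (c - 2 * b + 2 - γ) (b - 2 * c - γ - 1) (b + c + 2 * γ - 1) 1 β γ *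
          (oddTheta p (s ^ (γ : ℤ)) * factor p s w 0 (c - 2 * b + (1 - γ)) *
            factor p s w 2 (b + c + (γ - 1))) := by
      rcases Nat.eq_zero_or_pos γ with rfl | hγ
      · rw [pathSum_eq_zero _ _ _ _ _ (by push_cast; omega)]
        simp [oddTheta_one hp]
      · have h1 := ih (γ - 1) (by omega)
        have h2 := closedDet_step_one V A B C β γ (c - 2 * b) (b - 2 * c) (b + c)
        have e0 : lozengeWeight p s w (0, (b + γ - 1, c + n)) =
            factor p s w 0 (c - 2 * b + β - γ + 2) := by
          rw [lozengeWeight_eq_factor]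
          congr 1
          simp
          omega
        push_cast [Nat.cast_sub hγ] at h1
        rw [show (n : ℤ) - (γ - 1) = β by omega, show b + ((γ : ℤ) - 1) = b + γ - 1 by ring] at h1
        rw [bracket_of_ne_zero (show (γ : ℤ) ≠ 0 by omega)] at h2
        rw [h1, e0, div_mul_eq_mul_div, h2, mul_div_assoc, div_self (hg.factor_ne_zero _ _), mul_one]
    have t2 : pathSum (lozengeWeight p s w) b c n (b + γ) /
          lozengeWeight p s w (0, (b + γ, c + n)) *
        (bracket p s (β + γ) * factor p s w 0 (c - 2 * b + (β - γ + 1)) *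
          factor p s w 1 (b - 2 * c + -(β + γ)) * factor p s w 2 (b + c + (β + γ - 1))) =
        closedDet V A B C (c - 2 * b + 2 - γ) (b - 2 * c - γ - 1) (b + c + 2 * γ - 1) 1 β γ *
          (oddTheta p (s ^ β) * factor p s w 0 (c - 2 * b + (β + 1)) *
            factor p s w 1 (b - 2 * c + -β)) := by
      rcases Nat.eq_or_lt_of_le h with rfl | hγ
      · rw [pathSum_eq_zero _ _ _ _ _ (by push_cast; omega), show β = 0 by push_cast at hβ; omega]
        simp [oddTheta_one hp]
      · have h1 := ih γ (by omega)
        have h2 := closedDet_step_two V A B C β γ (c - 2 * b) (b - 2 * c) (b + c)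
        have e0 : lozengeWeight p s w (0, (b + γ, c + n)) =
            factor p s w 0 (c - 2 * b + β - γ) := by
          rw [lozengeWeight_eq_factor]
          congr 1
          simp
          omega
        rw [show (n : ℤ) - γ = β - 1 by omega] at h1
        rw [bracket_of_ne_zero (show β ≠ 0 by omega)] at h2
        rw [h1, e0, div_mul_eq_mul_div, h2, mul_div_assoc, div_self (hg.factor_ne_zero _ _), mul_one]
    have e1 : lozengeWeight p s w (1, (b + γ - 1, c + n + 1)) =
        factor p s w 1 (b - 2 * c + (-2 * β - γ)) := by
      rw [lozengeWeight_eq_factor]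
      congr 1
      simp
      omega
    have e2 : lozengeWeight p s w (2, (b + γ - 1, c + n)) =
        factor p s w 2 (b + c + (2 * γ + β - 1)) := by
      rw [lozengeWeight_eq_factor]
      congr 1
      simp
      omega
    rw [pathSum, e1, e2, show ((n + 1 : ℕ) : ℤ) - γ = β by push_cast; omega]
    linear_combination factor p s w 1 (b - 2 * c + (-2 * β - γ)) * t1 +
      factor p s w 2 (b + c + (2 * γ + β - 1)) * t2 -
      closedDet V A B C (c - 2 * b + 2 - γ) (b - 2 * c - γ - 1) (b + c + 2 * γ - 1) 1 β γ * hid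

/-- The determinant formula, by condensation. -/
theorem det_pathSum_eq_closedDet (hp : ‖p‖ < 1) (hs : s ≠ 0)
    (hw : w 0 * w 1 * w 2 = 1 ∨ w 0 * w 1 * w 2 = -1) (hg : IsGeneric p s w) (k : ℕ) :
    ∀ (β γ : ℕ) (b c : ℤ), (Matrix.of fun i j : Fin k =>
        pathSum (lozengeWeight p s w) (1 - γ + b + j) (-γ + c) (β + γ) (1 + b + i)).det =
      closedDet V A B C (c - 2 * b) (b - 2 * c) (b + c) k β γ := by
  have hw0 : w 0 ≠ 0 := by rintro h; simp [h] at hw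
  induction k using Nat.twoStepInduction with
  | zero => intro β γ b c; simp [closedDet_zero]
  | one =>
    intro β γ b c
    have h := pathSum_eq_closedDet V A B C hp hs hw hg (1 - γ + b) (-γ + c) (β + γ) γ
      (Nat.le_add_left _ _)
    rw [Matrix.det_fin_one]
    simp only [Matrix.of_apply, Fin.val_zero, Nat.cast_zero, add_zero]
    rw [show 1 + b = 1 - γ + b + γ by ring, h]
    congr 1 <;> push_cast <;> ring
  | more k ih ih1 =>
    intro β γ b c
    have h := det_condensation (Matrix.of fun i j : Fin (k + 2) =>
        pathSum (lozengeWeight p s w) (1 - γ + b + j) (-γ + c) (β + γ) (1 + b + i))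
    have m1 := ih β γ (b + 1) c
    have m2 := ih1 β γ (b + 1) c
    have m3 := ih1 β γ b c
    rw [show c - 2 * (b + 1) = c - 2 * b - 2 by ring, show b + 1 - 2 * c = b - 2 * c + 1 by ring,
      show b + 1 + c = b + c + 1 by ring] at m1 m2
    have e1 : (Matrix.of fun i j : Fin (k + 2) => pathSum (lozengeWeight p s w)
          (1 - γ + b + j) (-γ + c) (β + γ) (1 + b + i)).submatrix
          (fun i : Fin k => i.succ.castSucc) (fun i => i.succ.castSucc) =
        Matrix.of fun i j : Fin k => pathSum (lozengeWeight p s w)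
          (1 - γ + (b + 1) + j) (-γ + c) (β + γ) (1 + (b + 1) + i) := by
      ext i j
      simp only [Matrix.submatrix_apply, Matrix.of_apply, Fin.val_succ, Fin.val_castSucc]
      congr 1 <;> push_cast <;> ring
    have e2 : (Matrix.of fun i j : Fin (k + 2) => pathSum (lozengeWeight p s w)
          (1 - γ + b + j) (-γ + c) (β + γ) (1 + b + i)).submatrix Fin.succ Fin.succ =
        Matrix.of fun i j : Fin (k + 1) => pathSum (lozengeWeight p s w)
          (1 - γ + (b + 1) + j) (-γ + c) (β + γ) (1 + (b + 1) + i) := by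
      ext i j
      simp only [Matrix.submatrix_apply, Matrix.of_apply, Fin.val_succ]
      congr 1 <;> push_cast <;> ring
    have e3 : (Matrix.of fun i j : Fin (k + 2) => pathSum (lozengeWeight p s w)
          (1 - γ + b + j) (-γ + c) (β + γ) (1 + b + i)).submatrix Fin.castSucc Fin.castSucc =
        Matrix.of fun i j : Fin (k + 1) => pathSum (lozengeWeight p s w)
          (1 - γ + b + j) (-γ + c) (β + γ) (1 + b + i) := rfl
    rw [e1, e2, e3, m1, m2, m3] at h
    set c₀ := c - 2 * b with hc₀
    set c₁ := b - 2 * c with hc₁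
    set c₂ := b + c with hc₂
    have hid := condensation_identity hp hs (mul_ne_zero (zpow_ne_zero c₀ hs) hw0) (k + 2) β γ
    have hf (e : ℤ) : oddTheta p (s ^ e * (s ^ c₀ * w 0)) = factor p s w 0 (c₀ + e) := by
      rw [← mul_assoc, ← zpow_add₀ hs, add_comm]
      rfl
    simp only [hf] at hid
    have h1 := closedDet_diagonal V A B C c₀ c₁ c₂ k β γ
    have h2 := closedDet_antidiagonal V A B C c₀ c₁ c₂ k β γ
    have hden : bracket p s (k + β + γ + 1) * bracket p s (k + 1) *
        (factor p s w 0 (c₀ + β - k - 2) * factor p s w 0 (c₀ + γ - k - 2)) ≠ 0 := by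
      simp [hg.factor_ne_zero, hg.bracket_ne_zero]
    have hid' : bracket p s (k + β + γ + 1) * bracket p s (k + 1) *
          (factor p s w 0 (c₀ + β - k - 2) * factor p s w 0 (c₀ + γ - k - 2)) =
        bracket p s (k + β + 1) * bracket p s (k + γ + 1) *
          (factor p s w 0 (c₀ + β + γ - k - 2) * factor p s w 0 (c₀ - k - 2)) -
        oddTheta p (s ^ (β : ℤ)) * oddTheta p (s ^ (γ : ℤ)) *
          (factor p s w 0 (c₀ + β + γ - 1) * factor p s w 0 (c₀ - 2 * k - 3)) := by
      rw [bracket_of_ne_zero (by omega), bracket_of_ne_zero (by omega),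
        bracket_of_ne_zero (by omega), bracket_of_ne_zero (by omega)]
      rwa [show (k + 2 + β + γ - 1 : ℤ) = k + β + γ + 1 by ring,
        show (k + 2 - 1 : ℤ) = k + 1 by ring, show c₀ + (β - (k + 2)) = c₀ + β - k - 2 by ring,
        show c₀ + (γ - (k + 2)) = c₀ + γ - k - 2 by ring,
        show (k + 2 + β - 1 : ℤ) = k + β + 1 by ring, show (k + 2 + γ - 1 : ℤ) = k + γ + 1 by ring,
        show c₀ + (β + γ - (k + 2)) = c₀ + β + γ - k - 2 by ring,
        show c₀ + -(k + 2 : ℤ) = c₀ - k - 2 by ring,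
        show c₀ + (β + γ - 1 : ℤ) = c₀ + β + γ - 1 by ring,
        show c₀ + (1 - 2 * (k + 2) : ℤ) = c₀ - 2 * k - 3 by ring] at hid
    have hanti : ((Matrix.of fun i j : Fin (k + 2) => pathSum (lozengeWeight p s w)
          (1 - γ + b + j) (-γ + c) (β + γ) (1 + b + i)).submatrix Fin.succ Fin.castSucc).det *
        ((Matrix.of fun i j : Fin (k + 2) => pathSum (lozengeWeight p s w)
          (1 - γ + b + j) (-γ + c) (β + γ) (1 + b + i)).submatrix Fin.castSucc Fin.succ).det *
        (bracket p s (k + β + γ + 1) * bracket p s (k + 1) *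
          (factor p s w 0 (c₀ + β - k - 2) * factor p s w 0 (c₀ + γ - k - 2))) =
      closedDet V A B C c₀ c₁ c₂ (k + 2) β γ * closedDet V A B C (c₀ - 2) (c₁ + 1) (c₂ + 1) k β γ *
        (oddTheta p (s ^ (β : ℤ)) * oddTheta p (s ^ (γ : ℤ)) *
          (factor p s w 0 (c₀ + β + γ - 1) * factor p s w 0 (c₀ - 2 * k - 3))) := by
      -- For `β = 0` or `γ = 0` one mixed minor has a zero column or row because its path cannot
      -- reach, and the factor `[0]` makes the other side vanish.
      rcases Nat.eq_zero_or_pos β with rfl | hβ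
      · rw [Matrix.det_eq_zero_of_column_eq_zero 0]
        · simp [oddTheta_one hp]
        · intro i
          simp only [Matrix.submatrix_apply, Matrix.of_apply, Fin.val_succ]
          exact pathSum_eq_zero _ _ _ _ _ (by simp; omega)
      rcases Nat.eq_zero_or_pos γ with rfl | hγ
      · rw [mul_comm (Matrix.det _), Matrix.det_eq_zero_of_row_eq_zero 0]
        · simp [oddTheta_one hp]
        · intro i
          simp only [Matrix.submatrix_apply, Matrix.of_apply, Fin.val_succ]
          exact pathSum_eq_zero _ _ _ _ _ (by simp)
      have m4 := ih1 (β - 1) (γ + 1) (b + 1) (c + 1)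
      have m5 := ih1 (β + 1) (γ - 1) b (c - 1)
      have e4 : (Matrix.of fun i j : Fin (k + 2) => pathSum (lozengeWeight p s w)
            (1 - γ + b + j) (-γ + c) (β + γ) (1 + b + i)).submatrix Fin.succ Fin.castSucc =
          Matrix.of fun i j : Fin (k + 1) => pathSum (lozengeWeight p s w)
            (1 - (γ + 1 : ℕ) + (b + 1) + j) (-(γ + 1 : ℕ) + (c + 1)) (β - 1 + (γ + 1))
            (1 + (b + 1) + i) := by
        ext i j
        simp only [Matrix.submatrix_apply, Matrix.of_apply, Fin.val_succ, Fin.val_castSucc]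
        congr 1 <;> push_cast <;> omega
      have e5 : (Matrix.of fun i j : Fin (k + 2) => pathSum (lozengeWeight p s w)
            (1 - γ + b + j) (-γ + c) (β + γ) (1 + b + i)).submatrix Fin.castSucc Fin.succ =
          Matrix.of fun i j : Fin (k + 1) => pathSum (lozengeWeight p s w)
            (1 - (γ - 1 : ℕ) + b + j) (-(γ - 1 : ℕ) + (c - 1)) (β + 1 + (γ - 1)) (1 + b + i) := by
        ext i j
        simp only [Matrix.submatrix_apply, Matrix.of_apply, Fin.val_succ, Fin.val_castSucc]
        congr 1 <;> push_cast [Nat.cast_sub hγ] <;> omega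
      rw [← bracket_of_ne_zero (show (β : ℤ) ≠ 0 by omega),
        ← bracket_of_ne_zero (show (γ : ℤ) ≠ 0 by omega), ← h2, e4, e5, m4, m5]
      push_cast [Nat.cast_sub hγ, Nat.cast_sub hβ]
      congr 3 <;> omega
    push_cast at h m1 m2 m3 ⊢
    refine mul_right_cancel₀ hden (mul_right_cancel₀
      (closedDet_ne_zero V A B C (c₀ - 2) (c₁ + 1) (c₂ + 1) k β γ) ?_)
    linear_combination (bracket p s (k + β + γ + 1) * bracket p s (k + 1) *
        (factor p s w 0 (c₀ + β - k - 2) * factor p s w 0 (c₀ + γ - k - 2))) * h + h1 - hanti -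
      closedDet V A B C c₀ c₁ c₂ (k + 2) β γ *
        closedDet V A B C (c₀ - 2) (c₁ + 1) (c₂ + 1) k β γ * hid'

end

end EllipticHexagon

namespace EllipticHexagon

variable {p s : ℂ}

/-! ### Products over boxes and over the edges of the hexagon -/

theorem BoxPotential.prod_box {f : ℤ → ℂ} (A : BoxPotential f) (a : ℤ) (m n : ℕ) :
    ∏ i ∈ Finset.range m, ∏ j ∈ Finset.range n, f (a + i + j) =
      A.G (a + m + n) * A.G a / (A.G (a + m) * A.G (a + n)) := by
  have h := A.ne_zero
  have hrow (b : ℤ) : ∏ j ∈ Finset.range n, f (b + j) =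
      A.G (b + n + 1) * A.G b / (A.G (b + n) * A.G (b + 1)) := by
    induction n with
    | zero => simp; field_simp [h]
    | succ n ih =>
      rw [Finset.prod_range_succ, ih, A.eq_div]
      push_cast
      ring_nf
      field_simp [h]
  induction m with
  | zero => simp; field_simp [h]
  | succ m ih =>
    rw [Finset.prod_range_succ, ih, hrow]
    push_cast
    ring_nf
    field_simp [h]

/-- An edge potential gives a box potential. -/
noncomputable def EdgePotential.toBoxPotential {f : ℤ → ℂ} (V : EdgePotential f) : BoxPotential f where
  G e := (V.v (e - 2) * V.v (e - 3))⁻¹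
  ne_zero e := inv_ne_zero (mul_ne_zero (V.ne_zero _) (V.ne_zero _))
  eq_div e := by
    have h := V.ne_zero
    rw [V.eq_div]
    ring_nf
    field_simp [h]

/-- The product of `f` telescopes to a quotient of terms two apart. -/
theorem EdgePotential.prod_row {f : ℤ → ℂ} (V : EdgePotential f) (a : ℤ) (n : ℕ) :
    ∏ j ∈ Finset.range n, f (a + j) = V.v (a - 1) * V.v (a + n - 3) /
      (V.v (a + n - 1) * V.v (a - 3)) := by
  have h := V.ne_zero
  induction n with
  | zero => simp [h]
  | succ n ih =>
    rw [Finset.prod_range_succ, ih, V.eq_div]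
    push_cast
    ring_nf
    field_simp [h]

theorem mem_upEdges (α β γ : ℕ) (b c : ℤ) : (b, c) ∈ upEdges ![α, β, γ] ↔
    ((1 - (γ : ℤ) ≤ b ∧ b ≤ α) ∧ (-(γ : ℤ) ≤ c ∧ c ≤ β) ∧
      -(α : ℤ) ≤ c - b ∧ c - b + 1 ≤ β) ∧ c < β := by
  rw [upEdges, Finset.mem_filter, mem_hexagonEdges]
  rfl

theorem upEdges_zero (β γ : ℕ) : upEdges ![0, β, γ] =
    (Finset.range γ ×ˢ Finset.range β).image fun x : ℕ × ℕ => (-(x.1 : ℤ), (x.2 : ℤ) - x.1) := by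
  ext ⟨b, c⟩
  simp only [mem_upEdges, Finset.mem_image, Finset.mem_product,
    Finset.mem_range, Prod.exists, Prod.mk.injEq]
  constructor
  · intro h
    exact ⟨(-b).toNat, (c - b).toNat, by omega⟩
  · rintro ⟨i, j, h, rfl, rfl⟩
    omega

/-- Enlarging the first side by one adds two strips along the boundary, of lengths `γ` and `β`;
along each the type `0` exponents are consecutive integers. -/
theorem upEdges_succ (α β γ : ℕ) : upEdges ![α + 1, β, γ] = upEdges ![α, β, γ] ∪
    ((Finset.range γ).image (fun i : ℕ => ((α : ℤ) - i, -1 - (i : ℤ))) ∪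
      (Finset.range β).image fun i : ℕ => ((α : ℤ) + 1, (i : ℤ))) := by
  ext ⟨b, c⟩
  simp only [mem_upEdges, Finset.mem_union, Finset.mem_image,
    Finset.mem_range, Prod.mk.injEq]
  push_cast
  constructor
  · intro h
    by_cases h1 : b = α + 1 ∧ 0 ≤ c
    · exact .inr (.inr ⟨c.toNat, by omega⟩)
    by_cases h2 : b - c = α + 1 ∧ c < 0
    · exact .inr (.inl ⟨(-1 - c).toNat, by omega⟩)
    exact .inl (by omega)
  · rintro (h | ⟨i, h, rfl, rfl⟩ | ⟨i, h, rfl, rfl⟩) <;> omega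

theorem EdgePotential.prod_upEdges {f : ℤ → ℂ} (V : EdgePotential f) (α β γ : ℕ) :
    ∏ v ∈ upEdges ![α, β, γ], f (v.2 - 2 * v.1 + 1) =
      V.v (γ - 2 * α - 1) * V.v (β - 2 * α - 2) * V.v (γ - 2) * V.v (β - 1) /
        (V.v (-2 * α - 1) * V.v (-2 * α - 2) * V.v (β + γ - 2) * V.v (β + γ - 1)) := by
  have h := V.ne_zero
  induction α with
  | zero =>
    have h1 := V.toBoxPotential.prod_box 1 γ β
    rw [upEdges_zero, Finset.prod_image, Finset.prod_product]
    · have h2 (i j : ℕ) : f ((j : ℤ) - i - 2 * -(i : ℤ) + 1) = f (1 + i + j) := by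
        congr 1; ring
      simp only [h2, h1, EdgePotential.toBoxPotential]
      push_cast
      ring_nf
      field_simp [h]
    · rintro ⟨i, j⟩ - ⟨i', j'⟩ - hij
      simp only [Prod.mk.injEq] at hij ⊢
      omega
  | succ α ih =>
    have h1 := V.prod_row (-2 * α) γ
    have h2 := V.prod_row (-2 * α - 1) β
    rw [upEdges_succ, Finset.prod_union, Finset.prod_union, ih, Finset.prod_image, Finset.prod_image]
    · have h3 (i : ℕ) : f (-1 - (i : ℤ) - 2 * ((α : ℤ) - i) + 1) = f (-2 * α + i) := by
        congr 1; ring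
      have h4 (i : ℕ) : f ((i : ℤ) - 2 * ((α : ℤ) + 1) + 1) = f (-2 * α - 1 + i) := by
        congr 1; ring
      simp only [h3, h4, h1, h2]
      push_cast
      ring_nf
      field_simp [h]
    · intro i _ j _ hij
      simpa using hij
    · intro i _ j _ hij
      simpa using hij
    · rw [Finset.disjoint_left]
      rintro ⟨b, c⟩ h1 h2
      simp only [Finset.mem_image, Prod.mk.injEq] at h1 h2
      omega
    · rw [Finset.disjoint_left]
      rintro ⟨b, c⟩ h1 h2
      simp only [mem_upEdges, Finset.mem_union, Finset.mem_image,
        Prod.mk.injEq] at h1 h2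
      omega

/-! ### The product formula -/

/-- The product `∏ f (a + i + j)` over `i < m` and `j < n`. -/
noncomputable def box (f : ℤ → ℂ) (a : ℤ) (m n : ℕ) : ℂ :=
  ∏ i ∈ Finset.range m, ∏ j ∈ Finset.range n, f (a + i + j)

/-- The elliptic analogue of MacMahon's box formula, with denominators cleared so that it survives
passage to nongeneric parameters. The type `0` prefactor and the determinant are both in potentials,
so they combine by cancellation. -/
theorem partitionFunction_mul_box_of_isGeneric (hp : ‖p‖ < 1) (hs : s ≠ 0) {w : Fin 3 → ℂ}
    (hw : w 0 * w 1 * w 2 = 1 ∨ w 0 * w 1 * w 2 = -1) (hg : IsGeneric p s w) (α β γ : ℕ) :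
    partitionFunction p s ![α, β, γ] w * box (fun e => oddTheta p (s ^ e)) 1 α β =
      box (fun e => oddTheta p (s ^ e)) (1 + γ) α β *
        (box (factor p s w 0) (1 - α) β γ * box (factor p s w 1) (1 - β) α γ *
          box (factor p s w 2) (1 - γ) α β) := by
  obtain ⟨V⟩ := nonempty_edgePotential (hg.factor_ne_zero 0)
  obtain ⟨A⟩ := nonempty_boxPotential (hg.factor_ne_zero 1)
  obtain ⟨B⟩ := nonempty_boxPotential (hg.factor_ne_zero 2)
  obtain ⟨C⟩ := nonempty_boxPotential hg.bracket_ne_zero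
  -- Only positive exponents occur, so the convention for `[0]` plays no role.
  have hC (a : ℕ) : box (fun e => oddTheta p (s ^ e)) (1 + a) α β = box (bracket p s) (1 + a) α β := by
    refine Finset.prod_congr rfl fun i _ => Finset.prod_congr rfl fun j _ => ?_
    rw [bracket_of_ne_zero (by omega)]
  have hC0 := hC 0
  rw [Nat.cast_zero, add_zero] at hC0
  have hZ := partitionFunction_eq_det (p := p) (s := s) (a := ![α, β, γ]) (w := w)
    fun v => hg.factor_ne_zero 0 _
  have hE : ∏ v ∈ upEdges ![α, β, γ], lozengeWeight p s w (0, v) =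
      ∏ v ∈ upEdges ![α, β, γ], factor p s w 0 (v.2 - 2 * v.1 + 1) := by
    refine Finset.prod_congr rfl fun v _ => ?_
    rw [lozengeWeight_eq_factor w 0 v.1 v.2]
    congr 1
    simp
    ring
  have hD := det_pathSum_eq_closedDet V A B C hp hs hw hg α β γ 0 0
  simp only [add_zero, mul_zero, sub_zero] at hD
  rw [hE, V.prod_upEdges] at hZ
  have hZ : partitionFunction p s ![α, β, γ] w = _ * (Matrix.of fun i j : Fin α =>
    pathSum (lozengeWeight p s w) (1 - γ + j) (-γ) (β + γ) (1 + i)).det := hZ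
  have h0 := V.ne_zero
  have h1 := A.ne_zero
  have h2 := B.ne_zero
  have h3 := C.ne_zero
  rw [hZ, hD, hC0, hC, box, box, box, box, box, V.toBoxPotential.prod_box, A.prod_box, B.prod_box,
    C.prod_box, C.prod_box]
  simp only [closedDet, EdgePotential.toBoxPotential]
  ring_nf
  field_simp [h0, h1, h2, h3]

end EllipticHexagon

namespace EllipticHexagon

variable {p s : ℂ}

/-! ### Removing the genericity assumption -/

theorem continuousOn_oddTheta (hp : ‖p‖ < 1) : ContinuousOn (oddTheta p) {0}ᶜ :=
  (continuousOn_inv₀ (G₀ := ℂ)).mul ((continuousOn_theta hp).comp (continuous_pow 2).continuousOn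
    fun _ hx => pow_ne_zero 2 hx)

theorem countable_oddTheta_exp_eq_zero (hp : ‖p‖ < 1) {z : ℂ} (hz : z ≠ 0) {c : ℝ} (hc : c ≠ 0) :
    {t : ℝ | oddTheta p (z * Complex.exp ((c * t : ℝ))) = 0}.Countable := by
  have hinj : Function.Injective fun t : ℝ => (z * Complex.exp ((c * t : ℝ))) ^ 2 := by
    intro t t' h
    simp only [mul_pow, ← Complex.ofReal_exp] at h
    have h1 := mul_left_cancel₀ (pow_ne_zero 2 hz) h
    norm_cast at h1
    rw [pow_left_inj₀ (Real.exp_pos _).le (Real.exp_pos _).le two_ne_zero, Real.exp_eq_exp] at h1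
    exact mul_left_cancel₀ hc h1
  refine ((countable_theta_eq_zero hp).preimage hinj).mono fun t ht => ?_
  have ht : oddTheta p (z * Complex.exp ((c * t : ℝ))) = 0 := ht
  rw [oddTheta] at ht
  exact (mul_eq_zero.1 ht).resolve_left
    (inv_ne_zero (mul_ne_zero hz (Complex.exp_ne_zero _)))

/-- The directions in which `u₁, u₂, u₃` are deformed. -/
noncomputable def slope : Fin 3 → ℝ := ![1 / 5, 2 / 5, -3 / 5]

/-- The slopes are not integers, so every label really moves with `t`; their sum is zero, which
keeps the product of the roots fixed. -/
theorem add_slope_ne_zero (e : ℤ) (k : Fin 3) : e + slope k ≠ 0 := by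
  intro h
  have h5 : (5 * e + ![1, 2, -3] k : ℤ) = (0 : ℝ) := by
    push_cast
    fin_cases k <;> simp [slope] at h ⊢ <;> linarith
  norm_cast at h5
  fin_cases k <;> simp at h5 <;> omega

/-- Along the curve `S t`, `W t` each theta factor vanishes for only countably many `t`. Generic `t`
are therefore dense, and both sides are continuous; the claim is the value at `t = 0`. -/
theorem partitionFunction_mul_box (hp : ‖p‖ < 1) (hs : s ≠ 0) {w : Fin 3 → ℂ}
    (hw : w 0 * w 1 * w 2 = 1 ∨ w 0 * w 1 * w 2 = -1) (α β γ : ℕ) :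
    partitionFunction p s ![α, β, γ] w * box (fun e => oddTheta p (s ^ e)) 1 α β =
      box (fun e => oddTheta p (s ^ e)) (1 + γ) α β *
        (box (factor p s w 0) (1 - α) β γ * box (factor p s w 1) (1 - β) α γ *
          box (factor p s w 2) (1 - γ) α β) := by
  have hw0 (k : Fin 3) : w k ≠ 0 := by
    fin_cases k <;> rintro h <;> simp at h <;> simp [h] at hw
  let S (t : ℝ) : ℂ := s * Complex.exp t
  let W (t : ℝ) (k : Fin 3) : ℂ := w k * Complex.exp ((slope k * t : ℝ))
  have hS (t : ℝ) : S t ≠ 0 := mul_ne_zero hs (Complex.exp_ne_zero _)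
  have hW (t : ℝ) (k : Fin 3) : W t k ≠ 0 := mul_ne_zero (hw0 k) (Complex.exp_ne_zero _)
  have hSe (t : ℝ) (e : ℤ) : S t ^ e = s ^ e * Complex.exp ((e * t : ℝ)) := by
    simp only [S]
    rw [mul_zpow, ← Complex.exp_int_mul]
    push_cast
    rfl
  have hSW (t : ℝ) (e : ℤ) (k : Fin 3) :
      S t ^ e * W t k = s ^ e * w k * Complex.exp (((e + slope k) * t : ℝ)) := by
    rw [hSe, add_mul, Complex.ofReal_add, Complex.exp_add]
    ring
  have hbad : {t : ℝ | ¬IsGeneric p (S t) (W t)}.Countable := by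
    have h1 : (⋃ e : {e : ℤ // e ≠ 0}, {t : ℝ | oddTheta p (s ^ (e : ℤ) *
        Complex.exp (((e : ℤ) * t : ℝ))) = 0}).Countable :=
      Set.countable_iUnion fun e => countable_oddTheta_exp_eq_zero hp (zpow_ne_zero _ hs)
        (Int.cast_ne_zero.2 e.2)
    have h2 : (⋃ x : Fin 3 × ℤ, {t : ℝ | oddTheta p (s ^ x.2 * w x.1 *
        Complex.exp (((x.2 + slope x.1) * t : ℝ))) = 0}).Countable :=
      Set.countable_iUnion fun x => countable_oddTheta_exp_eq_zero hp
        (mul_ne_zero (zpow_ne_zero _ hs) (hw0 _)) (add_slope_ne_zero _ _)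
    refine (h1.union h2).mono fun t ht => ?_
    by_contra h
    refine ht ⟨fun e he h0 => h (.inl (Set.mem_iUnion.2 ⟨⟨e, he⟩, ?_⟩)),
      fun k e h0 => h (.inr (Set.mem_iUnion.2 ⟨(k, e), ?_⟩))⟩
    · rwa [hSe] at h0
    · rwa [factor, hSW] at h0
  have hSc : Continuous S := by fun_prop
  have hWc (k : Fin 3) : Continuous fun t => W t k := by fun_prop
  have hbr (e : ℤ) : Continuous fun t => oddTheta p (S t ^ e) :=
    (continuousOn_oddTheta hp).comp_continuous (hSc.zpow₀ e fun t => .inl (hS t))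
      fun t => zpow_ne_zero e (hS t)
  have hfac (k : Fin 3) (e : ℤ) : Continuous fun t => factor p (S t) (W t) k e :=
    (continuousOn_oddTheta hp).comp_continuous
      ((hSc.zpow₀ e fun t => .inl (hS t)).mul (hWc k))
      fun t => mul_ne_zero (zpow_ne_zero e (hS t)) (hW t k)
  have hbox (f : ℝ → ℤ → ℂ) (hf : ∀ e, Continuous fun t => f t e) (a : ℤ) (m n : ℕ) :
      Continuous fun t => box (f t) a m n :=
    continuous_finsetProd _ fun i _ => continuous_finsetProd _ fun j _ => hf _
  have hZ : Continuous fun t => partitionFunction p (S t) ![α, β, γ] (W t) :=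
    continuous_finsetSum _ fun T _ => continuous_finsetProd _ fun l _ => hfac l.1 _
  have hdense : Dense {t : ℝ | ¬IsGeneric p (S t) (W t)}ᶜ := hbad.dense_compl ℝ
  have h := Continuous.ext_on hdense (hZ.mul (hbox (fun t e => oddTheta p (S t ^ e)) hbr 1 α β))
    ((hbox (fun t e => oddTheta p (S t ^ e)) hbr (1 + γ) α β).mul
      (((hbox _ (hfac 0) (1 - α) β γ).mul (hbox _ (hfac 1) (1 - β) α γ)).mul
        (hbox _ (hfac 2) (1 - γ) α β))) fun t ht =>
      partitionFunction_mul_box_of_isGeneric hp (hS t) ?_ (not_not.1 ht) α β γ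
  · have h0 := congrFun h 0
    have hS0 : S 0 = s := by simp [S]
    have hW0 : W 0 = w := by funext k; simp [W]
    simpa only [Pi.mul_apply, hS0, hW0] using h0
  · have : W t 0 * W t 1 * W t 2 = w 0 * w 1 * w 2 := by
      have h1 : Complex.exp ((slope 0 * t : ℝ)) * Complex.exp ((slope 1 * t : ℝ)) *
          Complex.exp ((slope 2 * t : ℝ)) = 1 := by
        rw [← Complex.exp_add, ← Complex.exp_add, Complex.exp_eq_one_iff]
        refine ⟨0, ?_⟩
        simp [slope]
        ring
      simp only [W]
      linear_combination w 0 * w 1 * w 2 * h1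
    rwa [this]

end EllipticHexagon

namespace EllipticHexagon

variable {p q s : ℂ}

/-! ### The closed formula in terms of triple elliptic gamma functions -/

/-- The product `∏ θ_p(q^(i+j) x)` over `i < m` and `j < n`. -/
noncomputable def thetaBox (p q x : ℂ) (m n : ℕ) : ℂ :=
  ∏ i ∈ Finset.range m, ∏ j ∈ Finset.range n, theta p (q ^ (i + j) * x)

/-- The exponent is described through its double, avoiding integer division. -/
theorem exists_prod_zpow_box (hs : s ≠ 0) (a : ℤ) (m n : ℕ) :
    ∃ e : ℤ, 2 * e = m * n * (2 * a + m + n - 2) ∧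
      ∏ i ∈ Finset.range m, ∏ j ∈ Finset.range n, s ^ (a + i + j) = s ^ e := by
  have hrow (b : ℤ) : ∃ e : ℤ, 2 * e = n * (2 * b + n - 1) ∧
      ∏ j ∈ Finset.range n, s ^ (b + j) = s ^ e := by
    induction n with
    | zero => exact ⟨0, by simp⟩
    | succ n ih =>
      obtain ⟨e, he, h⟩ := ih
      refine ⟨e + (b + n), ?_, ?_⟩
      · push_cast
        linear_combination he
      · rw [Finset.prod_range_succ, h, ← zpow_add₀ hs]
  induction m with
  | zero => exact ⟨0, by simp⟩
  | succ m ih =>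
    obtain ⟨e, he, h⟩ := ih
    obtain ⟨e', he', h'⟩ := hrow (a + m)
    refine ⟨e + e', ?_, ?_⟩
    · push_cast
      linear_combination he + he'
    · rw [Finset.prod_range_succ, h, h', ← zpow_add₀ hs]

theorem exists_box_oddTheta (hs : s ≠ 0) (hq : s ^ 2 = q) {x : ℂ} (hx : x ≠ 0) (a : ℤ) (m n : ℕ) :
    ∃ e : ℤ, 2 * e = m * n * (2 * a + m + n - 2) ∧
      s ^ e * x ^ (m * n) * box (fun e => oddTheta p (s ^ e * x)) a m n =
        thetaBox p q (q ^ a * x ^ 2) m n := by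
  obtain ⟨e, he, h⟩ := exists_prod_zpow_box hs a m n
  refine ⟨e, he, ?_⟩
  have h1 : s ^ e * x ^ (m * n) =
      ∏ i ∈ Finset.range m, ∏ j ∈ Finset.range n, s ^ (a + i + j) * x := by
    simp only [Finset.prod_mul_distrib, h, Finset.prod_const, Finset.card_range, ← pow_mul]
    rw [mul_comm n m]
  rw [h1, box, thetaBox, ← Finset.prod_mul_distrib]
  refine Finset.prod_congr rfl fun i _ => ?_
  rw [← Finset.prod_mul_distrib]
  refine Finset.prod_congr rfl fun j _ => ?_
  rw [oddTheta, ← mul_assoc, mul_inv_cancel₀ (mul_ne_zero (zpow_ne_zero _ hs) hx), one_mul, ← hq]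
  congr 1
  rw [add_assoc, zpow_add₀ hs, mul_pow, mul_pow, ← Nat.cast_add, zpow_natCast, ← pow_mul,
    ← pow_mul, mul_comm 2 (i + j), ← zpow_natCast, ← zpow_natCast s 2, ← zpow_mul, ← zpow_mul,
    mul_comm a]
  ring

theorem paramNum_eq (hp : ‖p‖ < 1) (hq : ‖q‖ < 1) (hq0 : q ≠ 0) (α β γ : ℕ) {u : Fin 3 → ℂ}
    (hu : ∀ i, u i ≠ 0) :
    paramNum p q α β γ u = paramDen p q α β γ u *
      (thetaBox p q (q ^ (1 - α : ℤ) * u 0) β γ * thetaBox p q (q ^ (1 - β : ℤ) * u 1) α γ *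
        thetaBox p q (q ^ (1 - γ : ℤ) * u 2) α β) := by
  have hz (e : ℤ) (n : ℕ) (x : ℂ) : q ^ n * (q ^ e * x) = q ^ (e + n) * x := by
    rw [← mul_assoc, ← zpow_natCast, ← zpow_add₀ hq0, add_comm]
  have h0 := tripleGamma_box hp hq hq0 β γ (mul_ne_zero (zpow_ne_zero (1 - α : ℤ) hq0) (hu 0))
  have h1 := tripleGamma_box hp hq hq0 α γ (mul_ne_zero (zpow_ne_zero (1 - β : ℤ) hq0) (hu 1))
  have h2 := tripleGamma_box hp hq hq0 α β (mul_ne_zero (zpow_ne_zero (1 - γ : ℤ) hq0) (hu 2))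
  rw [hz, hz, hz, ← thetaBox] at h0 h1 h2
  push_cast [← add_assoc] at h0 h1 h2
  simp only [paramNum, paramDen, tripleGammas, List.map_cons, List.map_nil, List.prod_cons,
    List.prod_nil, mul_one]
  linear_combination (tripleGamma p q q (q ^ (1 - β + α + γ : ℤ) * u 1) *
      tripleGamma p q q (q ^ (1 - β : ℤ) * u 1) * tripleGamma p q q (q ^ (1 - γ + α + β : ℤ) * u 2) *
      tripleGamma p q q (q ^ (1 - γ : ℤ) * u 2)) * h0 +
    (tripleGamma p q q (q ^ (1 - α + β : ℤ) * u 0) * tripleGamma p q q (q ^ (1 - α + γ : ℤ) * u 0) *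
      thetaBox p q (q ^ (1 - α : ℤ) * u 0) β γ *
      tripleGamma p q q (q ^ (1 - γ + α + β : ℤ) * u 2) *
      tripleGamma p q q (q ^ (1 - γ : ℤ) * u 2)) * h1 +
    (tripleGamma p q q (q ^ (1 - α + β : ℤ) * u 0) * tripleGamma p q q (q ^ (1 - α + γ : ℤ) * u 0) *
      thetaBox p q (q ^ (1 - α : ℤ) * u 0) β γ *
      (tripleGamma p q q (q ^ (1 - β + α : ℤ) * u 1) *
        tripleGamma p q q (q ^ (1 - β + γ : ℤ) * u 1) *
        thetaBox p q (q ^ (1 - β : ℤ) * u 1) α γ)) * h2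

/-- The box identity for the gamma function at `q` and at `q ^ (1 + γ)`, cross-multiplied so that no
gamma value is divided by. -/
theorem thetaBox_mul_constDen (hp : ‖p‖ < 1) (hq : ‖q‖ < 1) (hq0 : q ≠ 0) (α β γ : ℕ) :
    thetaBox p q q α β * constNum p q 1 α β γ =
      thetaBox p q (q ^ (1 + γ)) α β * constDen p q 1 α β γ := by
  have h0 := tripleGamma_box hp hq hq0 α β hq0
  have h1 := tripleGamma_box hp hq hq0 α β (pow_ne_zero (1 + γ) hq0)
  rw [← thetaBox] at h0 h1
  simp only [← pow_succ, ← pow_add] at h0 h1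
  rw [show α + β + 1 = 1 + α + β by ring, add_comm α 1, add_comm β 1] at h0
  rw [show α + β + (1 + γ) = 1 + α + β + γ by ring, show α + (1 + γ) = 1 + α + γ by ring,
    show β + (1 + γ) = 1 + β + γ by ring] at h1
  simp only [constNum, constDen, tripleGammas, List.map_cons, List.map_nil, List.prod_cons,
    List.prod_nil, mul_one]
  linear_combination (thetaBox p q q α β * tripleGamma p q q (q ^ (1 + α)) *
      tripleGamma p q q (q ^ (1 + β))) * h1 - (tripleGamma p q q (q ^ (1 + α + γ)) *
    tripleGamma p q q (q ^ (1 + β + γ)) * thetaBox p q (q ^ (1 + γ)) α β) * h0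

/-- By the box identity, `Γ(q) Γ(q ^ (1 + α + β))`, a factor of the denominator, is a multiple of
this product. -/
theorem thetaBox_ne_zero_of_constDen_ne_zero (hp : ‖p‖ < 1) (hq : ‖q‖ < 1) (hq0 : q ≠ 0)
    {α β γ : ℕ} (h : constDen p q 1 α β γ ≠ 0) : thetaBox p q q α β ≠ 0 := by
  have h0 := tripleGamma_box hp hq hq0 α β hq0
  rw [← thetaBox] at h0
  simp only [← pow_succ] at h0
  rw [show α + β + 1 = 1 + α + β by ring] at h0
  simp only [constDen, tripleGammas, List.map_cons, List.prod_cons, mul_one] at h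
  intro hz
  rw [hz, mul_zero] at h0
  exact h (by rw [← mul_assoc, h0, zero_mul])

theorem continuousAt_tripleGammas (hp : ‖p‖ < 1) (hq : ‖q‖ < 1) {l : List ℂ} (hl : ∀ x ∈ l, x ≠ 0) :
    ContinuousAt (fun ρ => tripleGammas p q (l.map (· * ρ))) 1 := by
  induction l with
  | nil => exact continuousAt_const
  | cons x l ih =>
    simp only [tripleGammas, List.map_cons, List.prod_cons]
    refine ContinuousAt.mul ?_ (ih fun y hy => hl y (List.mem_cons_of_mem _ hy))
    have hx : x * 1 ≠ 0 := by simpa using hl x List.mem_cons_self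
    exact ContinuousAt.comp (f := fun ρ => x * ρ)
      ((continuousOn_tripleGamma hp hq).continuousAt (isOpen_compl_singleton.mem_nhds hx))
      (continuous_const.mul continuous_id).continuousAt

/-- With a nonzero denominator at `ρ = 1`, the limit is the value of a continuous function. -/
theorem tendsto_constNum_div_constDen (hp : ‖p‖ < 1) (hq : ‖q‖ < 1) (hq0 : q ≠ 0) {α β γ : ℕ}
    (h : constDen p q 1 α β γ ≠ 0) :
    Tendsto (fun ρ => constNum p q ρ α β γ / constDen p q ρ α β γ) (𝓝[≠] 1)
      (𝓝 (constNum p q 1 α β γ / constDen p q 1 α β γ)) := by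
  have h1 : ContinuousAt (fun ρ => constNum p q ρ α β γ) 1 :=
    continuousAt_tripleGammas hp hq (l := [q ^ (1 + α + β + γ), q ^ (1 + α), q ^ (1 + β),
      q ^ (1 + γ)]) (by simp [hq0])
  have h2 : ContinuousAt (fun ρ => constDen p q ρ α β γ) 1 :=
    continuousAt_tripleGammas hp hq (l := [q, q ^ (1 + α + β), q ^ (1 + α + γ), q ^ (1 + β + γ)])
      (by simp [hq0])
  exact (h1.div h2 h).tendsto.mono_left nhdsWithin_le_nhds

/-! ### Edge coordinates -/

section

variable {t : Fin 3 → ℂ}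

theorem edgeConstNum_edgeRoot (hq0 : q ≠ 0) (ht : ∀ i, t i ≠ 0) (ρ : ℂ) (α β γ : ℕ) :
    edgeConstNum p q ρ (edgeRoot q α β γ t) = constNum p q ρ α β γ := by
  have := ht 0
  have := ht 1
  have := ht 2
  rw [edgeConstNum, constNum]
  congr 1
  simp only [edgeRoot, Matrix.cons_val, List.cons.injEq, and_true]
  refine ⟨?_, ?_, ?_, ?_⟩ <;> simp only [zpow_neg, zpow_natCast, pow_add, pow_one] <;> field_simp

theorem edgeConstDen_edgeRoot (hq0 : q ≠ 0) (ht : ∀ i, t i ≠ 0) (ρ : ℂ) (α β γ : ℕ) :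
    edgeConstDen p q ρ (edgeRoot q α β γ t) = constDen p q ρ α β γ := by
  have := ht 0
  have := ht 1
  have := ht 2
  rw [edgeConstDen, constDen]
  congr 1
  simp only [edgeRoot, Matrix.cons_val, List.cons.injEq, true_and, and_true]
  refine ⟨?_, ?_, ?_⟩ <;> simp only [zpow_neg, zpow_natCast, pow_add, pow_one] <;> field_simp

/-- Unlike the constant factor, where the `t i` cancel, this needs `t 0 * t 1 * t 2 = 1` to turn
monomials such as `t 0 ^ 2 / (t 1 * t 2)` into `t 0 ^ 3`. -/
theorem edgeParamNum_edgeRoot (hq0 : q ≠ 0) (ht : ∀ i, t i ≠ 0) (h : t 0 * t 1 * t 2 = 1)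
    (α β γ : ℕ) :
    edgeParamNum p q (edgeRoot q α β γ t) = paramNum p q α β γ (fun i => t i ^ 3) := by
  have := ht 0
  have := ht 1
  have h2 : t 2 = (t 0 * t 1)⁻¹ := eq_inv_of_mul_eq_one_right h
  rw [edgeParamNum, paramNum]
  congr 1
  simp only [edgeRoot, Matrix.cons_val, List.cons.injEq, and_true]
  refine ⟨?_, ?_, ?_, ?_, ?_, ?_⟩ <;>
    simp only [zpow_neg, zpow_natCast, zpow_add₀ hq0, zpow_sub₀ hq0, zpow_one, h2] <;> field_simp

theorem edgeParamDen_edgeRoot (hq0 : q ≠ 0) (ht : ∀ i, t i ≠ 0) (h : t 0 * t 1 * t 2 = 1)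
    (α β γ : ℕ) :
    edgeParamDen p q (edgeRoot q α β γ t) = paramDen p q α β γ (fun i => t i ^ 3) := by
  have := ht 0
  have := ht 1
  have h2 : t 2 = (t 0 * t 1)⁻¹ := eq_inv_of_mul_eq_one_right h
  rw [edgeParamDen, paramDen]
  congr 1
  simp only [edgeRoot, Matrix.cons_val, List.cons.injEq, and_true]
  refine ⟨?_, ?_, ?_, ?_, ?_, ?_⟩ <;>
    simp only [zpow_neg, zpow_natCast, zpow_add₀ hq0, zpow_sub₀ hq0, zpow_one, h2] <;> field_simp

end

theorem partitionFunction_eq_closedFormula (hp : ‖p‖ < 1) (hs : s ≠ 0) (hq : s ^ 2 = q)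
    (hq1 : ‖q‖ < 1) (α β γ : ℕ) {u w : Fin 3 → ℂ} (hu : u 0 * u 1 * u 2 = 1)
    (hw : ∀ i, w i ^ 2 = u i) (hC : constDen p q 1 α β γ ≠ 0) (hP : paramDen p q α β γ u ≠ 0) :
    partitionFunction p s ![α, β, γ] w = prefactor s w α β γ *
      (constNum p q 1 α β γ / constDen p q 1 α β γ) *
        (paramNum p q α β γ u / paramDen p q α β γ u) := by
  have hq0 : q ≠ 0 := hq ▸ pow_ne_zero 2 hs
  have hu0 (i : Fin 3) : u i ≠ 0 := by
    fin_cases i <;> rintro h <;> simp at h <;> simp [h] at hu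
  have hw0 (i : Fin 3) : w i ≠ 0 := fun h => hu0 i (by rw [← hw, h]; simp)
  have hw1 : w 0 * w 1 * w 2 = 1 ∨ w 0 * w 1 * w 2 = -1 := by
    rw [← sq_eq_one_iff, mul_pow, mul_pow, hw, hw, hw, hu]
  have hZ := partitionFunction_mul_box hp hs hw1 α β γ
  obtain ⟨e₁, he₁, h₁⟩ := exists_box_oddTheta (p := p) hs hq one_ne_zero 1 α β
  obtain ⟨e₂, he₂, h₂⟩ := exists_box_oddTheta (p := p) hs hq one_ne_zero (1 + γ) α β
  obtain ⟨d₀, hd₀, k₀⟩ := exists_box_oddTheta (p := p) hs hq (hw0 0) (1 - α) β γ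
  obtain ⟨d₁, hd₁, k₁⟩ := exists_box_oddTheta (p := p) hs hq (hw0 1) (1 - β) α γ
  obtain ⟨d₂, hd₂, k₂⟩ := exists_box_oddTheta (p := p) hs hq (hw0 2) (1 - γ) α β
  simp only [one_pow, mul_one, hw] at h₁ h₂ k₀ k₁ k₂
  rw [zpow_one] at h₁
  rw [← Nat.cast_one, ← Nat.cast_add, zpow_natCast] at h₂
  have hT := thetaBox_ne_zero_of_constDen_ne_zero hp hq1 hq0 hC
  have hG : constNum p q 1 α β γ / constDen p q 1 α β γ =
      thetaBox p q (q ^ (1 + γ)) α β / thetaBox p q q α β := by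
    rw [div_eq_div_iff hC hT, mul_comm, thetaBox_mul_constDen hp hq1 hq0]
  -- The boxes of elliptic numbers contribute `e₁ - e₂ = -αβγ`, the three parameter boxes `3αβγ`
  -- minus half the cubic sum.
  have hE : (2 * α * β * γ - (α * β ^ 2 + β * α ^ 2 + α * γ ^ 2 + γ * α ^ 2 + β * γ ^ 2 +
      γ * β ^ 2) / 2 : ℤ) = e₁ - e₂ - d₀ - d₁ - d₂ := by
    have h := Int.ediv_mul_cancel (two_dvd_prefactor_exponent α β γ)
    linarith
  have hX : box (fun e => oddTheta p (s ^ e)) 1 α β ≠ 0 := by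
    intro h
    rw [← h₁, h, mul_zero] at hT
    exact hT rfl
  rw [hG, paramNum_eq hp hq1 hq0 α β γ hu0, mul_div_cancel_left₀ _ hP, ← h₁, ← h₂, ← k₀, ← k₁,
    ← k₂, eq_div_of_mul_eq hX hZ, prefactor, hE]
  have hwz (i : Fin 3) (m n : ℕ) : w i ^ (-(m * n) : ℤ) = (w i ^ (m * n))⁻¹ := by
    rw [zpow_neg, ← Nat.cast_mul, zpow_natCast]
  simp only [hwz, zpow_sub₀ hs]
  have := hw0 0
  have := hw0 1
  have := hw0 2
  push_cast
  field_simp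
  rfl

end EllipticHexagon

/-! ### Assembly of the closed formula, the symmetries and the group isomorphisms. -/

theorem mainTheorem10 (p q s : ℂ) (hp : ‖p‖ < 1) (hs : s ≠ 0) (hq : s ^ 2 = q) :
    -- the closed formula, in both forms
    (‖q‖ < 1 → ∀ (α β γ : ℕ) (u w : Fin 3 → ℂ), u 0 * u 1 * u 2 = 1 → (∀ i, w i ^ 2 = u i) →
      EllipticHexagon.constDen p q 1 α β γ ≠ 0 → EllipticHexagon.paramDen p q α β γ u ≠ 0 →
      ∃ G : ℂ,
        Tendsto (fun ρ => EllipticHexagon.constNum p q ρ α β γ /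
          EllipticHexagon.constDen p q ρ α β γ) (𝓝[≠] 1) (𝓝 G) ∧
        EllipticHexagon.partitionFunction p s ![α, β, γ] w =
          EllipticHexagon.prefactor s w α β γ * G *
            (EllipticHexagon.paramNum p q α β γ u / EllipticHexagon.paramDen p q α β γ u) ∧
        ∀ t : Fin 3 → ℂ, (∀ i, t i ^ 3 = u i) → t 0 * t 1 * t 2 = 1 →
          Tendsto (fun ρ =>
            EllipticHexagon.edgeConstNum p q ρ (EllipticHexagon.edgeRoot q α β γ t) /
              EllipticHexagon.edgeConstDen p q ρ (EllipticHexagon.edgeRoot q α β γ t))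
            (𝓝[≠] 1) (𝓝 G) ∧
          EllipticHexagon.partitionFunction p s ![α, β, γ] w =
            EllipticHexagon.prefactor s w α β γ * G *
              (EllipticHexagon.edgeParamNum p q (EllipticHexagon.edgeRoot q α β γ t) /
                EllipticHexagon.edgeParamDen p q (EllipticHexagon.edgeRoot q α β γ t))) ∧
    -- invariance under `S₃`
    (∀ (σ : Equiv.Perm (Fin 3)) (x : EllipticHexagon.Params),
      (EllipticHexagon.permute σ x).Z p s = x.Z p s) ∧
    -- invariance under the extra involution
    (∀ x : EllipticHexagon.Params, (EllipticHexagon.reflect s hs x).Z p s = x.Z p s) ∧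
    -- the involution with the other sign of the square roots
    (∀ x : EllipticHexagon.Params,
      EllipticHexagon.partitionFunction p s x.side
          (fun i => (s ^ EllipticHexagon.reflectExponent x.side i * x.root i)⁻¹) =
        (-1) ^ (x.side 0 * x.side 1 + x.side 1 * x.side 2 + x.side 2 * x.side 0) * x.Z p s) ∧
    -- the group generated by these symmetries
    (∀ g ∈ EllipticHexagon.symmetryGroup s hs, ∀ x : EllipticHexagon.Params,
      (g x).Z p s = x.Z p s) ∧
    Nonempty (EllipticHexagon.symmetryGroup s hs ≃*
      Equiv.Perm (Fin 3) × Multiplicative (ZMod 2)) ∧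
    Nonempty (EllipticHexagon.symmetryGroup s hs ≃* DihedralGroup 6) ∧
    Nonempty (EllipticHexagon.symmetryGroup s hs ≃* CoxeterMatrix.G₂.Group) := by
  have hq0 : q ≠ 0 := hq ▸ pow_ne_zero 2 hs
  refine ⟨fun hq1 α β γ u w hu hw hC hP => ?_, fun σ x => EllipticHexagon.Z_permute p s σ x,
    fun x => EllipticHexagon.Z_reflect hp hs x, fun x => ?_,
    fun g hg x => EllipticHexagon.Z_of_mem_symmetryGroup hp hs hg x, ?_, ?_, ?_⟩
  · have hG := EllipticHexagon.tendsto_constNum_div_constDen hp hq1 hq0 hC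
    have hZ := EllipticHexagon.partitionFunction_eq_closedFormula hp hs hq hq1 α β γ hu hw hC hP
    refine ⟨_, hG, hZ, fun t ht ht1 => ?_⟩
    have ht0 (i : Fin 3) : t i ≠ 0 := by
      fin_cases i <;> rintro h <;> simp at h <;> simp [h] at ht1
    obtain rfl : (fun i => t i ^ 3) = u := funext ht
    simp only [EllipticHexagon.edgeConstNum_edgeRoot hq0 ht0,
      EllipticHexagon.edgeConstDen_edgeRoot hq0 ht0,
      EllipticHexagon.edgeParamNum_edgeRoot hq0 ht0 ht1,
      EllipticHexagon.edgeParamDen_edgeRoot hq0 ht0 ht1]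
    exact ⟨hG, hZ⟩
  · exact EllipticHexagon.partitionFunction_reflect hp hs _ x.root_ne_zero
  · exact EllipticHexagon.nonempty_symmetryGroup_equiv s hs
  · obtain ⟨e⟩ := EllipticHexagon.nonempty_symmetryGroup_equiv s hs
    obtain ⟨f⟩ := EllipticHexagon.nonempty_dihedral_equiv_prod
    exact ⟨e.trans f.symm⟩
  · obtain ⟨e⟩ := EllipticHexagon.nonempty_symmetryGroup_equiv s hs
    obtain ⟨f⟩ := EllipticHexagon.nonempty_dihedral_equiv_prod
    obtain ⟨c⟩ := EllipticHexagon.nonempty_coxeterG₂_equiv_dihedral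
    exact ⟨(e.trans f.symm).trans c.symm⟩
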